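/- **Theorem 3.** A *cluster graph* is a disjoint union of cliques; its connected components are called its *clusters*. A *2-subcoloring* of a graph $G=(V,E)$ is a pair $(A,B)$ of disjoint, possibly empty sets with $A\cup B=V$ such that $G[A]$ and $G[B]$ are cluster graphs; for an integer $k\ge 0$ it is called *valid* if $G[A]$ has at most $k$ clusters. Let $n=|V|$ and $m=|E|$. Running times count the steps of a random access machine with words of $O(\log(n+m+k))$ bits; $G$ is given by adjacency lists and $k$ is part of the input. In the bounds below, every factor $k$, $n$ or $m$ that equals $0$ is read as $1$, with the exponent $2k+1$ and the sum $n+m$ left as they are. The constants in $O(\cdot)$ are absolute. (a) There is an algorithm that, given $G$ and $k$, decides in $O(k^{2k+1}\cdot nm)$ time whether $G$ has a 2-subcoloring $(A,B)$ such that $G[A]$ has at most $k$ clusters. (b) There is an algorithm that, given $G$, $k$, a vertex $v$ of $G$ and a valid 2-subcoloring $(A',B')$ of $G-v$, decides in $O(k^{2k+1}\cdot(n+m))$ time whether $G$ has a valid 2-subcoloring, and outputs one if it exists. -/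

import Mathlib

/-! ### Cluster graphs and 2-subcolorings -/

/-- A cluster graph is a disjoint union of cliques: any two distinct vertices of the same
connected component are adjacent. Its clusters are its connected components. -/
def IsClusterGraph {V : Type*} (H : SimpleGraph V) : Prop :=
  ∀ u w : V, H.Reachable u w → u ≠ w → H.Adj u w

/-- `(A, B)` is a 2-subcoloring of the induced subgraph `G[S]` such that `G[A]` has at most `k`
clusters: `A` and `B` partition `S` (a part may be empty), and `G[A]` and `G[B]` are cluster
graphs. With `S = Set.univ` this is a 2-subcoloring of `G`, with `S = {v}ᶜ` one of `G - v`. -/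
structure IsValidSubcoloring {V : Type*} (G : SimpleGraph V) (S : Set V) (k : ℕ)
    (A B : Set V) : Prop where
  union_eq : A ∪ B = S
  disjoint : Disjoint A B
  cluster_left : IsClusterGraph (G.induce A)
  cluster_right : IsClusterGraph (G.induce B)
  card_clusters_le : Nat.card (G.induce A).ConnectedComponent ≤ k

/-! ### A word random access machine

Programs are `while`-programs over finitely many natural-number registers and finitely many
random access arrays of natural numbers. Every operation, every read or write of a cell and every
test takes one step. The machine has a bound `W` on the size of its words: each number that
is computed, also as an intermediate result or as an address, must be at most `W`; otherwise
there is no run. -/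

namespace Ram

/-- The contents of the memory: registers `reg x` and cells `arr a i` of arrays. -/
structure Store where
  reg : ℕ → ℕ
  arr : ℕ → ℕ → ℕ

/-- Expressions: constants, registers, array cells, sum, truncated difference, product, and the
comparisons `<` and `=` with value `1` (true) or `0` (false). -/
inductive Exp where
  | const (c : ℕ)
  | reg (x : ℕ)
  | cell (a : ℕ) (i : Exp)
  | add (e f : Exp)
  | sub (e f : Exp)
  | mul (e f : Exp)
  | lt (e f : Exp)
  | eq (e f : Exp)

/-- The value of an expression. -/
def Exp.eval (s : Store) : Exp → ℕ
  | .const c => c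
  | .reg x => s.reg x
  | .cell a i => s.arr a (i.eval s)
  | .add e f => e.eval s + f.eval s
  | .sub e f => e.eval s - f.eval s
  | .mul e f => e.eval s * f.eval s
  | .lt e f => if e.eval s < f.eval s then 1 else 0
  | .eq e f => if e.eval s = f.eval s then 1 else 0

/-- The number of steps needed to evaluate an expression: one per operation or access. -/
def Exp.cost : Exp → ℕ
  | .const _ => 1
  | .reg _ => 1
  | .cell _ i => i.cost + 1
  | .add e f => e.cost + f.cost + 1
  | .sub e f => e.cost + f.cost + 1
  | .mul e f => e.cost + f.cost + 1
  | .lt e f => e.cost + f.cost + 1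
  | .eq e f => e.cost + f.cost + 1

/-- All values that occur in the evaluation of the expression are at most `W`. -/
def Exp.Fits (W : ℕ) (s : Store) : Exp → Prop
  | .const c => c ≤ W
  | .reg x => s.reg x ≤ W
  | .cell a i => i.Fits W s ∧ s.arr a (i.eval s) ≤ W
  | .add e f => e.Fits W s ∧ f.Fits W s ∧ e.eval s + f.eval s ≤ W
  | .sub e f => e.Fits W s ∧ f.Fits W s
  | .mul e f => e.Fits W s ∧ f.Fits W s ∧ e.eval s * f.eval s ≤ W
  | .lt e f => e.Fits W s ∧ f.Fits W s ∧ 1 ≤ W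
  | .eq e f => e.Fits W s ∧ f.Fits W s ∧ 1 ≤ W

/-- Programs. -/
inductive Prog where
  | skip
  | set (x : ℕ) (e : Exp)
  | put (a : ℕ) (i e : Exp)
  | seq (p q : Prog)
  | cond (e : Exp) (p q : Prog)
  | loop (e : Exp) (p : Prog)

/-- Write `v` into register `x`. -/
def Store.setReg (s : Store) (x v : ℕ) : Store :=
  { s with reg := Function.update s.reg x v }

/-- Write `v` into cell `i` of array `a`. -/
def Store.setCell (s : Store) (a i v : ℕ) : Store :=
  { s with arr := Function.update s.arr a (Function.update (s.arr a) i v) }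

/-- `Run W p s t s'`: with word bound `W`, the program `p` started in `s` halts after exactly
`t` steps in `s'`. `cond e p q` executes `p` if the value of `e` is nonzero and `q` otherwise;
`loop e p` executes `p` as long as the value of `e` is nonzero. -/
inductive Run (W : ℕ) : Prog → Store → ℕ → Store → Prop
  | skip (s : Store) : Run W .skip s 1 s
  | set (s : Store) (x : ℕ) (e : Exp) (he : e.Fits W s) :
      Run W (.set x e) s (e.cost + 1) (s.setReg x (e.eval s))
  | put (s : Store) (a : ℕ) (i e : Exp) (hi : i.Fits W s) (he : e.Fits W s) :
      Run W (.put a i e) s (i.cost + e.cost + 1) (s.setCell a (i.eval s) (e.eval s))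
  | seq {p q : Prog} {s s₁ s₂ : Store} {t₁ t₂ : ℕ}
      (hp : Run W p s t₁ s₁) (hq : Run W q s₁ t₂ s₂) : Run W (.seq p q) s (t₁ + t₂) s₂
  | cond_true {e : Exp} {p q : Prog} {s s₁ : Store} {t : ℕ} (he : e.Fits W s)
      (hv : e.eval s ≠ 0) (hp : Run W p s t s₁) : Run W (.cond e p q) s (e.cost + 1 + t) s₁
  | cond_false {e : Exp} {p q : Prog} {s s₁ : Store} {t : ℕ} (he : e.Fits W s)
      (hv : e.eval s = 0) (hq : Run W q s t s₁) : Run W (.cond e p q) s (e.cost + 1 + t) s₁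
  | loop_true {e : Exp} {p : Prog} {s s₁ s₂ : Store} {t₁ t₂ : ℕ} (he : e.Fits W s)
      (hv : e.eval s ≠ 0) (hp : Run W p s t₁ s₁) (hl : Run W (.loop e p) s₁ t₂ s₂) :
      Run W (.loop e p) s (e.cost + 1 + t₁ + t₂) s₂
  | loop_false {e : Exp} {p : Prog} {s : Store} (he : e.Fits W s) (hv : e.eval s = 0) :
      Run W (.loop e p) s (e.cost + 1) s

/-- The machine is deterministic: number of steps and final store are determined by the input. -/
theorem Run.unique {W : ℕ} {p : Prog} {s s₁ s₂ : Store} {t₁ t₂ : ℕ}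
    (h₁ : Run W p s t₁ s₁) (h₂ : Run W p s t₂ s₂) : t₁ = t₂ ∧ s₁ = s₂ := by
  induction h₁ generalizing t₂ s₂ with
  | skip => cases h₂; exact ⟨rfl, rfl⟩
  | set => cases h₂; exact ⟨rfl, rfl⟩
  | put => cases h₂; exact ⟨rfl, rfl⟩
  | seq _ _ ihp ihq =>
    cases h₂ with
    | seq hp hq =>
      obtain ⟨rfl, rfl⟩ := ihp hp
      obtain ⟨rfl, rfl⟩ := ihq hq
      exact ⟨rfl, rfl⟩
  | cond_true _ hv _ ih =>
    cases h₂ with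
    | cond_true _ _ hp => obtain ⟨rfl, rfl⟩ := ih hp; exact ⟨rfl, rfl⟩
    | cond_false _ hv' _ => exact absurd hv' hv
  | cond_false _ hv _ ih =>
    cases h₂ with
    | cond_true _ hv' _ => exact absurd hv hv'
    | cond_false _ _ hq => obtain ⟨rfl, rfl⟩ := ih hq; exact ⟨rfl, rfl⟩
  | loop_true _ hv _ _ ihp ihl =>
    cases h₂ with
    | loop_true _ _ hp hl =>
      obtain ⟨rfl, rfl⟩ := ihp hp
      obtain ⟨rfl, rfl⟩ := ihl hl
      exact ⟨rfl, rfl⟩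
    | loop_false _ hv' => exact absurd hv' hv
  | loop_false _ hv =>
    cases h₂ with
    | loop_true _ hv' _ _ => exact absurd hv hv'
    | loop_false => exact ⟨rfl, rfl⟩

end Ram

/-! ### Encoding of the inputs -/

/-- `nbrs` lists, for every vertex of `G`, its neighbors, each once and in any order. -/
def IsAdjacencyLists {n : ℕ} (G : SimpleGraph (Fin n)) (nbrs : Fin n → List (Fin n)) : Prop :=
  ∀ u : Fin n, (nbrs u).Nodup ∧ ∀ w : Fin n, w ∈ nbrs u ↔ G.Adj u w

/-- The initial store for a graph on the vertices `0, …, n - 1`, given by adjacency lists, and a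
number `k`: register `0` holds `n`, register `1` holds `k`, array `1` holds the concatenation
of the lists of the vertices `0, …, n - 1`, and cell `i ≤ n` of array `0` holds the position
in array `1` at which the list of vertex `i` starts (its total length for `i = n`). All other
registers and cells are `0`. -/
def graphInput {n : ℕ} (nbrs : Fin n → List (Fin n)) (k : ℕ) : Ram.Store where
  reg := fun x => if x = 0 then n else if x = 1 then k else 0
  arr := fun a i =>
    if a = 0 then (if i ≤ n then ((List.ofFn nbrs).take i).flatten.length else 0)
    else if a = 1 then ((List.ofFn nbrs).flatten.map Fin.val).getD i 0
    else 0

open Classical in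
/-- The initial store for a graph, a number `k`, a vertex `v` and a set `A'` of vertices: in
addition to the graph and `k`, register `2` holds `v` and array `2` holds the indicator
function of `A'`. -/
noncomputable def inductiveInput {n : ℕ} (nbrs : Fin n → List (Fin n)) (k : ℕ) (v : Fin n)
    (A' : Set (Fin n)) : Ram.Store where
  reg := fun x => if x = 2 then (v : ℕ) else (graphInput nbrs k).reg x
  arr := fun a i =>
    if a = 2 then (if ∃ u : Fin n, u ∈ A' ∧ (u : ℕ) = i then 1 else 0)
    else (graphInput nbrs k).arr a i

/-! ### Weakest preconditions with running times -/

namespace Ram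

/-! The core is the insertion step (b). Put K = min k n; this cut-off is harmless because there are
never more than n clusters. The clusters of the given 2-subcoloring are numbered, side 1 by even and
side 0 by odd numbers, and `v` gets a number of its own. The final side of `v` is guessed, and `v`
is treated as a vertex that has just moved to that side. Suppose a moved vertex x is known to join
the cluster with label t. Then an unmoved vertex y on the side that x entered can stay only if it is
adjacent to x exactly when its old cluster is t; otherwise y must move too. These forced moves are
propagated through a queue.

Labels are guessed, once per old cluster: two moved vertices of one old cluster are adjacent and
arrive on the same side, so they join the same new cluster (`Solution.target_eq_of_cls`). At most
2K+1 guesses occur: K for old clusters on side 1, K for old clusters on side 0, because their moved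
vertices lie in distinct new clusters on side 1, and one for `v` (`Solution.length_log_le`). Each
guess has at most K+2 options (`Solution.guess_spec`): a vertex entering side 1 joins one of K
clusters, and a vertex entering side 0 joins one of at most K+1 adjacent old clusters or a cluster
without unmoved vertices. Labels on side 1 make sense because the new clusters can be renumbered so
that those containing unmoved vertices keep their old numbers (`exists_solution`).

With guesses that fit to a solution, only vertices that move in the solution enter the queue
(`Solution.correct_step`). When the queue is exhausted, moved vertices with their new sides and all
others with their old sides form a valid 2-subcoloring, even if the solution moves further vertices
(`Solution.good_final`). Every outcome is verified by a linear time test (`check_iff_good`), so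
wrong guesses do no harm.

One propagation takes linear time. A vertex y violating the condition for x is adjacent to x or
belongs to old cluster t. For the latter, every label keeps a pointer to a vertex whose closed
neighborhood contains the unmoved vertices of that cluster. Once x is treated, x itself can serve as
the pointer, so the scan of the old pointer is paid by a potential, the sum of the degrees of the
pointers (`potential_update`, `wp_procProg`). Enumerating all guesses as digits to the base K+3
gives 2(K+3)^(2K+1) rounds of O(n+m) steps, and (K+3)^(2K+1) = O(k^(2k+1)), with k read as 1 if it
is 0 (`min_add_three_pow_le`).

For (a), vertices are inserted one by one; failure is final because validity passes to induced
subgraphs (`Good.congr`). Isolated vertices are left out and put on side 0 in the end. So only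
min(n, 2m) insertions are needed, and the bound is nm rather than n(n+m) (`time_decide_le`). -/

/-- The program halts, and its running time and final store satisfy `Q`. -/
def wp (W : ℕ) (p : Prog) (s : Store) (Q : ℕ → Store → Prop) : Prop :=
  ∃ t s', Run W p s t s' ∧ Q t s'

variable {W : ℕ}

theorem wp.mono {p : Prog} {s : Store} {Q Q' : ℕ → Store → Prop} (h : wp W p s Q)
    (hQ : ∀ t s', Q t s' → Q' t s') : wp W p s Q' := by
  obtain ⟨t, s', hr, hq⟩ := h
  exact ⟨t, s', hr, hQ t s' hq⟩

theorem wp_skip (s : Store) (Q) : wp W .skip s Q ↔ Q 1 s := by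
  constructor
  · rintro ⟨t, s', hr, hq⟩
    cases hr; exact hq
  · intro h; exact ⟨_, _, .skip s, h⟩

theorem wp_set (s : Store) (x e Q) :
    wp W (.set x e) s Q ↔ e.Fits W s ∧ Q (e.cost + 1) (s.setReg x (e.eval s)) := by
  constructor
  · rintro ⟨t, s', hr, hq⟩
    cases hr with
    | set _ _ _ he => exact ⟨he, hq⟩
  · rintro ⟨he, h⟩; exact ⟨_, _, .set s x e he, h⟩

theorem wp_put (s : Store) (a i e Q) :
    wp W (.put a i e) s Q ↔ i.Fits W s ∧ e.Fits W s ∧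
      Q (i.cost + e.cost + 1) (s.setCell a (i.eval s) (e.eval s)) := by
  constructor
  · rintro ⟨t, s', hr, hq⟩
    cases hr with
    | put _ _ _ _ hi he => exact ⟨hi, he, hq⟩
  · rintro ⟨hi, he, h⟩; exact ⟨_, _, .put s a i e hi he, h⟩

theorem wp_seq (p q : Prog) (s : Store) (Q) :
    wp W (.seq p q) s Q ↔ wp W p s fun t s₁ => wp W q s₁ fun t' s₂ => Q (t + t') s₂ := by
  constructor
  · rintro ⟨t, s', hr, hq⟩
    cases hr with
    | seq hp hq' => exact ⟨_, _, hp, _, _, hq', hq⟩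
  · rintro ⟨t, s₁, hp, t', s₂, hq', h⟩
    exact ⟨_, _, .seq hp hq', h⟩

theorem wp_cond (e : Exp) (p q : Prog) (s : Store) (Q) :
    wp W (.cond e p q) s Q ↔ e.Fits W s ∧
      (e.eval s ≠ 0 → wp W p s fun t s₁ => Q (e.cost + 1 + t) s₁) ∧
      (e.eval s = 0 → wp W q s fun t s₁ => Q (e.cost + 1 + t) s₁) := by
  constructor
  · rintro ⟨t, s', hr, hq⟩
    cases hr with
    | cond_true he hv hp => exact ⟨he, fun _ => ⟨_, _, hp, hq⟩, fun h => absurd h hv⟩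
    | cond_false he hv hp => exact ⟨he, fun h => absurd hv h, fun _ => ⟨_, _, hp, hq⟩⟩
  · rintro ⟨he, h1, h2⟩
    by_cases hv : e.eval s = 0
    · obtain ⟨t, s', hr, hq⟩ := h2 hv
      exact ⟨_, _, .cond_false he hv hr, hq⟩
    · obtain ⟨t, s', hr, hq⟩ := h1 hv
      exact ⟨_, _, .cond_true he hv hr, hq⟩

/-- Registers the program may write. -/
def Prog.wr : Prog → ℕ → Bool
  | .skip, _ => false
  | .set x _, y => x == y
  | .put _ _ _, _ => false
  | .seq p q, y => p.wr y || q.wr y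
  | .cond _ p q, y => p.wr y || q.wr y
  | .loop _ p, y => p.wr y

/-- Arrays the program may write. -/
def Prog.wa : Prog → ℕ → Bool
  | .skip, _ => false
  | .set _ _, _ => false
  | .put a _ _, y => a == y
  | .seq p q, y => p.wa y || q.wa y
  | .cond _ p q, y => p.wa y || q.wa y
  | .loop _ p, y => p.wa y

/-- The two stores agree outside of what the program may write. -/
def Frame (p : Prog) (s s' : Store) : Prop :=
  (∀ x, p.wr x = false → s'.reg x = s.reg x) ∧ ∀ a, p.wa a = false → s'.arr a = s.arr a

theorem Frame.refl (p : Prog) (s : Store) : Frame p s s := ⟨fun _ _ => rfl, fun _ _ => rfl⟩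

theorem Frame.trans {p : Prog} {s s₁ s₂ : Store} (h₁ : Frame p s s₁) (h₂ : Frame p s₁ s₂) :
    Frame p s s₂ :=
  ⟨fun x hx => (h₂.1 x hx).trans (h₁.1 x hx), fun a ha => (h₂.2 a ha).trans (h₁.2 a ha)⟩

theorem Frame.weaken {p q : Prog} {s s' : Store} (h : Frame p s s')
    (hr : ∀ x, q.wr x = false → p.wr x = false) (ha : ∀ x, q.wa x = false → p.wa x = false) :
    Frame q s s' := ⟨fun x hx => h.1 x (hr x hx), fun x hx => h.2 x (ha x hx)⟩

/-- What a program may write is a computable syntactic property, so for concrete programs the side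
conditions of frame arguments hold by `rfl`. -/
theorem Run.frame {p : Prog} {s s' : Store} {t : ℕ} (h : Run W p s t s') : Frame p s s' := by
  induction h with
  | skip => exact Frame.refl _ _
  | set s x e he =>
    refine ⟨fun y hy => ?_, fun _ _ => rfl⟩
    simp only [Prog.wr, beq_eq_false_iff_ne] at hy
    simp [Store.setReg, Function.update_of_ne (Ne.symm hy)]
  | put s a i e hi he =>
    refine ⟨fun _ _ => rfl, fun y hy => ?_⟩
    simp only [Prog.wa, beq_eq_false_iff_ne] at hy
    simp [Store.setCell, Function.update_of_ne (Ne.symm hy)]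
  | seq _ _ ih1 ih2 =>
    refine (ih1.weaken ?_ ?_).trans (ih2.weaken ?_ ?_) <;> intro x hx <;>
      simp_all [Prog.wr, Prog.wa]
  | cond_true _ _ _ ih => refine ih.weaken ?_ ?_ <;> intro x hx <;> simp_all [Prog.wr, Prog.wa]
  | cond_false _ _ _ ih => refine ih.weaken ?_ ?_ <;> intro x hx <;> simp_all [Prog.wr, Prog.wa]
  | loop_true _ _ _ _ ih1 ih2 =>
    refine (ih1.weaken ?_ ?_).trans ih2 <;> intro x hx <;> simp_all [Prog.wr, Prog.wa]
  | loop_false => exact Frame.refl _ _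

theorem wp.frame {p : Prog} {s : Store} {Q : ℕ → Store → Prop} (h : wp W p s Q) :
    wp W p s fun t s' => Q t s' ∧ Frame p s s' := by
  obtain ⟨t, s', hr, hq⟩ := h
  exact ⟨t, s', hr, hq, hr.frame⟩

/-- Use a specification of the first of two programs. -/
theorem wp_seq_of {p q : Prog} {s : Store} {Q Q' : ℕ → Store → Prop} (h : wp W p s Q')
    (h' : ∀ t s₁, Q' t s₁ → Frame p s s₁ → wp W q s₁ fun t' s₂ => Q (t + t') s₂) :
    wp W (.seq p q) s Q := by
  rw [wp_seq]
  exact h.frame.mono fun t s₁ hq => h' t s₁ hq.1 hq.2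

/-- Total correctness of a loop: `I` relates elapsed time and store, `μ` decreases. -/
theorem wp_loop {e : Exp} {p : Prog} {Q : ℕ → Store → Prop} (I : ℕ → Store → Prop)
    (μ : Store → ℕ) {s : Store} (h0 : I 0 s)
    (hfit : ∀ t s₁, I t s₁ → Frame p s s₁ → e.Fits W s₁)
    (hstep : ∀ t s₁, I t s₁ → Frame p s s₁ → e.eval s₁ ≠ 0 →
      wp W p s₁ fun t' s₂ => I (t + (e.cost + 1 + t')) s₂ ∧ μ s₂ < μ s₁)
    (hend : ∀ t s₁, I t s₁ → Frame p s s₁ → e.eval s₁ = 0 → Q (t + (e.cost + 1)) s₁) :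
    wp W (.loop e p) s Q := by
  suffices H : ∀ N t s₁, μ s₁ < N → I t s₁ → Frame p s s₁ →
      wp W (.loop e p) s₁ fun t' s₂ => Q (t + t') s₂ by
    simpa using H _ 0 s (Nat.lt_succ_self _) h0 (Frame.refl _ _)
  intro N
  induction N with
  | zero => intro t s₁ h; exact absurd h (Nat.not_lt_zero _)
  | succ N ih =>
    intro t s₁ hμ hI hF
    by_cases hv : e.eval s₁ = 0
    · exact ⟨_, _, .loop_false (hfit t s₁ hI hF) hv, hend t s₁ hI hF hv⟩
    · obtain ⟨t', s₂, hr, ⟨hI', hμ'⟩⟩ := hstep t s₁ hI hF hv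
      obtain ⟨t'', s₃, hr', hq⟩ := ih _ s₂ (by omega) hI' (hF.trans hr.frame)
      refine ⟨_, _, .loop_true (hfit t s₁ hI hF) hv hr hr', ?_⟩
      convert hq using 1
      ring

@[simp] theorem Store.setReg_arr (s : Store) (x v : ℕ) : (s.setReg x v).arr = s.arr := rfl

@[simp] theorem Store.setCell_reg (s : Store) (a i v : ℕ) : (s.setCell a i v).reg = s.reg := rfl

theorem Store.setReg_reg (s : Store) (x v y : ℕ) :
    (s.setReg x v).reg y = if y = x then v else s.reg y := by
  simp [Store.setReg, Function.update_apply]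

theorem Store.setCell_arr (s : Store) (a i v b : ℕ) :
    (s.setCell a i v).arr b = if b = a then Function.update (s.arr a) i v else s.arr b := by
  simp [Store.setCell, Function.update_apply]

/-- `for i := 0 to (register r) - 1`. -/
def forTo (i r : ℕ) (p : Prog) : Prog :=
  .seq (.set i (.const 0))
    (.loop (.lt (.reg i) (.reg r)) (.seq p (.set i (.add (.reg i) (.const 1)))))

/-- The overhead 8 of a round is 4 for the test and 4 for the increment; the 6 outside is 2 for the
initialization and 4 for the last test. -/
theorem wp_forTo {i r : ℕ} {p : Prog} {s : Store} (N : ℕ) (c : ℕ → ℕ) (I : ℕ → Store → Prop)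
    (hr : s.reg r = N) (hir : r ≠ i) (hpi : p.wr i = false) (hpr : p.wr r = false) (hW : N + 1 ≤ W)
    (h0 : I 0 (s.setReg i 0))
    (hstep : ∀ j s₁, j < N → s₁.reg i = j → I j s₁ → Frame (forTo i r p) s s₁ →
      wp W p s₁ fun t s₂ => t ≤ c j ∧ I (j + 1) (s₂.setReg i (j + 1))) :
    wp W (forTo i r p) s fun t s' =>
      t ≤ (∑ j ∈ Finset.range N, (c j + 8)) + 6 ∧ I N s' := by
  unfold forTo
  rw [wp_seq, wp_set]
  refine ⟨by simp [Exp.Fits], ?_⟩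
  refine wp_loop (W := W) (fun t s₁ => s₁.reg r = N ∧ Frame (forTo i r p) s s₁ ∧ ∃ j, j ≤ N ∧
    s₁.reg i = j ∧ I j s₁ ∧ t ≤ ∑ j ∈ Finset.range j, (c j + 8)) (fun s₁ => N - s₁.reg i) ?_ ?_ ?_ ?_
  · refine ⟨by simpa [Store.setReg_reg, hir] using hr, ?_, 0, Nat.zero_le _, ?_, ?_, ?_⟩
    · refine ⟨fun x hx => ?_, fun _ _ => rfl⟩
      simp [forTo, Prog.wr] at hx
      simp [Store.setReg_reg, Exp.eval, Ne.symm hx.1]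
    · simp [Store.setReg_reg, Exp.eval]
    · simpa [Exp.eval] using h0
    · simp
  · rintro t s₁ ⟨hr', -, j, hj, hi, -⟩ -
    simp only [Exp.Fits, hr', hi]
    omega
  · rintro t s₁ ⟨hr', hF, j, hj, hi, hI, ht⟩ - hv
    have hjN : j < N := by
      by_contra h
      simp [Exp.eval, hi, hr', h] at hv
    refine wp_seq_of (hstep j s₁ hjN hi hI hF) ?_
    rintro t' s₂ ⟨ht', hI'⟩ hF2
    have hi2 : s₂.reg i = j := by rw [hF2.1 _ hpi, hi]
    rw [wp_set]
    refine ⟨by simp [Exp.Fits, Exp.eval, hi2]; omega, ⟨?_, ?_, j + 1, by omega, ?_, ?_, ?_⟩, ?_⟩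
    · simp [Store.setReg_reg, hir, hF2.1 _ hpr, hr']
    · refine hF.trans ⟨fun x hx => ?_, fun a ha => ?_⟩
      · simp [forTo, Prog.wr] at hx
        simp [Store.setReg_reg, Ne.symm hx.1, hF2.1 _ hx.2.1]
      · simp [forTo, Prog.wa] at ha
        simp [hF2.2 _ ha]
    · simp [Store.setReg_reg, Exp.eval, hi2]
    · simpa [Exp.eval, hi2] using hI'
    · rw [Finset.sum_range_succ]
      simp only [Exp.cost]
      omega
    · simp [Store.setReg_reg, Exp.eval, hi2, hi]
      omega
  · rintro t s₁ ⟨hr', hF, j, hj, hi, hI, ht⟩ - hv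
    have hjN : j = N := by
      by_contra h
      have : j < N := by omega
      simp [Exp.eval, hi, hr', this] at hv
    subst hjN
    refine ⟨?_, hI⟩
    simp only [Exp.cost]
    omega

theorem wp_forTo_const {i r : ℕ} {p : Prog} {s : Store} (N c : ℕ) (I : ℕ → Store → Prop)
    (hr : s.reg r = N) (hir : r ≠ i) (hpi : p.wr i = false) (hpr : p.wr r = false) (hW : N + 1 ≤ W)
    (h0 : I 0 (s.setReg i 0))
    (hstep : ∀ j s₁, j < N → s₁.reg i = j → I j s₁ → Frame (forTo i r p) s s₁ →
      wp W p s₁ fun t s₂ => t ≤ c ∧ I (j + 1) (s₂.setReg i (j + 1))) :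
    wp W (forTo i r p) s fun t s' => t ≤ N * (c + 8) + 6 ∧ I N s' := by
  have := wp_forTo N (fun _ => c) I hr hir hpi hpr hW h0 hstep
  simpa using this

end Ram

/-! ### Graphs given by lists of neighbors -/

/-- A graph on the vertices `0, …, n - 1`, given by lists of neighbors. -/
structure ListGraph where
  n : ℕ
  nb : ℕ → List ℕ
  lt : ∀ {u w : ℕ}, w ∈ nb u → w < n
  symm : ∀ {u w : ℕ}, w ∈ nb u → u ∈ nb w
  irrefl : ∀ u, u ∉ nb u
  nodup : ∀ u, (nb u).Nodup

namespace ListGraph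

/-- The position at which the list of `u` starts. -/
def off (L : ListGraph) (u : ℕ) : ℕ := ∑ i ∈ Finset.range u, (L.nb i).length

theorem off_succ (L : ListGraph) (u : ℕ) : L.off (u + 1) = L.off u + (L.nb u).length :=
  Finset.sum_range_succ _ _

theorem off_mono (L : ListGraph) : Monotone L.off :=
  monotone_nat_of_le_succ fun u => by rw [off_succ]; omega

theorem off_le (L : ListGraph) {u : ℕ} (hu : u ≤ L.n) : L.off u ≤ L.off L.n := L.off_mono hu

/-- The store contains the graph. -/
structure Holds (L : ListGraph) (s : Ram.Store) : Prop where
  reg : s.reg 0 = L.n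
  off : ∀ u ≤ L.n, s.arr 0 u = L.off u
  nb : ∀ u < L.n, ∀ i (h : i < (L.nb u).length), s.arr 1 (L.off u + i) = (L.nb u)[i]

theorem Holds.congr {L : ListGraph} {s s' : Ram.Store} (h : L.Holds s) (hr : s'.reg 0 = s.reg 0)
    (h0 : s'.arr 0 = s.arr 0) (h1 : s'.arr 1 = s.arr 1) : L.Holds s' :=
  ⟨by rw [hr, h.reg], by rw [h0]; exact h.off, by rw [h1]; exact h.nb⟩

theorem Holds.frame {L : ListGraph} {s s' : Ram.Store} {p : Ram.Prog} (h : L.Holds s)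
    (hF : Ram.Frame p s s') (hr : p.wr 0 = false)
    (h0 : p.wa 0 = false) (h1 : p.wa 1 = false) : L.Holds s' :=
  h.congr (hF.1 _ hr) (hF.2 _ h0) (hF.2 _ h1)

end ListGraph

/-! ### Traversal of a neighbor list -/

namespace Ram

/-- Execute the program for all neighbors of the vertex in register `z`. -/
def forNbr (z : ℕ) (p : Prog) : Prog :=
  .seq (.set 20 (.cell 0 (.reg z))) (.seq (.set 21 (.cell 0 (.add (.reg z) (.const 1))))
    (.loop (.lt (.reg 20) (.reg 21)) (.seq (.set 22 (.cell 1 (.reg 20)))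
      (.seq p (.set 20 (.add (.reg 20) (.const 1)))))))

/-- The invariant speaks of the treated prefix of the list. It has to be insensitive to registers 20
to 22, which the traversal itself overwrites. A round costs 4 + 3 + 4 = 11 besides the body; the 12
outside is 3 + 5 for reading the two ends and 4 for the last test. -/
theorem wp_forNbr {W z : ℕ} {p : Prog} {s : Store} (L : ListGraph) (u c : ℕ)
    (I : List ℕ → Store → Prop) (hL : L.Holds s) (hu : u < L.n) (hz : s.reg z = u) (hz20 : z ≠ 20)
    (hW : L.off L.n + L.n + 2 ≤ W)
    (hp0 : p.wr 0 = false) (hp20 : p.wr 20 = false) (hp21 : p.wr 21 = false)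
    (ha0 : p.wa 0 = false) (ha1 : p.wa 1 = false)
    (hI : ∀ l s₁ b, I l s₁ →
      I l (s₁.setReg 20 b) ∧ I l (s₁.setReg 21 b) ∧ I l (s₁.setReg 22 b))
    (h0 : I [] s)
    (hstep : ∀ l y l' s₁, L.nb u = l ++ y :: l' → I l s₁ → s₁.reg 22 = y →
      Frame (forNbr z p) s s₁ →
      wp W p s₁ fun t s₂ => t ≤ c ∧ I (l ++ [y]) s₂) :
    wp W (forNbr z p) s fun t s' => t ≤ (L.nb u).length * (c + 11) + 12 ∧ I (L.nb u) s' := by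
  have e1 : s.arr 0 u = L.off u := hL.off u hu.le
  have e2 : s.arr 0 (u + 1) = L.off (u + 1) := hL.off (u + 1) hu
  have e3 := L.off_le hu.le
  have e4 := L.off_le (show u + 1 ≤ L.n from hu)
  have e5 := L.off_succ u
  unfold forNbr
  rw [wp_seq, wp_set]
  refine ⟨by simp [Exp.Fits, Exp.eval, hz, e1]; omega, ?_⟩
  rw [wp_seq, wp_set]
  refine ⟨by simp [Exp.Fits, Exp.eval, Store.setReg_reg, hz20, hz, e2]; omega, ?_⟩
  set s0 := (s.setReg 20 (Exp.eval s (.cell 0 (.reg z)))).setReg 21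
    (Exp.eval (s.setReg 20 (Exp.eval s (.cell 0 (.reg z)))) (.cell 0 (.add (.reg z) (.const 1))))
    with hs0
  have f0 : Frame (forNbr z p) s s0 := by
    refine ⟨fun x hx => ?_, fun _ _ => rfl⟩
    simp [forNbr, Prog.wr] at hx
    simp [hs0, Store.setReg_reg, Ne.symm hx.1, Ne.symm hx.2.1]
  have r20 : s0.reg 20 = L.off u := by simp [hs0, Store.setReg_reg, Exp.eval, hz, e1]
  have r21 : s0.reg 21 = L.off (u + 1) := by
    simp [hs0, Store.setReg_reg, Exp.eval, hz, hz20, e2]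
  refine wp_loop (W := W) (fun t s₁ => s₁.reg 21 = L.off (u + 1) ∧ Frame (forNbr z p) s s₁ ∧
    ∃ l l', L.nb u = l ++ l' ∧ s₁.reg 20 = L.off u + l.length ∧ I l s₁ ∧
      t ≤ l.length * (c + 11)) (fun s₁ => L.off (u + 1) - s₁.reg 20) ?_ ?_ ?_ ?_
  · exact ⟨r21, f0, [], L.nb u, rfl, by simpa using r20, (hI _ _ _ (hI _ _ _ h0).1).2.1, by simp⟩
  · rintro t s₁ ⟨h21, -, l, l', hl, h20, hJ, ht⟩ -
    have : (L.nb u).length = l.length + l'.length := by rw [hl, List.length_append]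
    simp only [Exp.Fits, h21, h20]
    omega
  · rintro t s₁ ⟨h21, hF, l, l', hl, h20, hJ, ht⟩ - hv
    have hlen : (L.nb u).length = l.length + l'.length := by rw [hl, List.length_append]
    have hlt : l.length < (L.nb u).length := by
      by_contra h
      have : ¬ (L.off u + l.length < L.off u + (L.nb u).length) := by omega
      simp [Exp.eval, h20, h21, e5, this] at hv
    obtain _ | ⟨y, l'⟩ := l'
    · simp at hlen; omega
    have hF0 : L.Holds s₁ := by
      refine hL.frame hF ?_ ?_ ?_ <;> simp [forNbr, Prog.wr, Prog.wa, hp0, ha0, ha1]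
    have hy : s₁.arr 1 (L.off u + l.length) = y := by
      rw [hF0.nb u hu _ hlt]; simp [hl]
    have hyn : y < L.n := L.lt (u := u) (by rw [hl]; simp)
    rw [wp_seq, wp_set]
    refine ⟨by simp [Exp.Fits, Exp.eval, h20, hy]; omega, ?_⟩
    have f1 : Frame (forNbr z p) s (s₁.setReg 22 y) := by
      refine hF.trans ⟨fun x hx => ?_, fun _ _ => rfl⟩
      simp [forNbr, Prog.wr] at hx
      simp [Store.setReg_reg, Ne.symm hx.2.2.1]
    have := hstep l y l' (s₁.setReg 22 y) hl (hI _ _ _ hJ).2.2 (by simp [Store.setReg_reg]) f1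
    simp only [Exp.eval, h20, hy]
    refine wp_seq_of this ?_
    rintro t' s₂ ⟨ht', hI'⟩ hF2
    have q20 : s₂.reg 20 = L.off u + l.length := by
      rw [hF2.1 _ hp20]; simp [Store.setReg_reg, h20]
    have q21 : s₂.reg 21 = L.off (u + 1) := by
      rw [hF2.1 _ hp21]; simp [Store.setReg_reg, h21]
    rw [wp_set]
    refine ⟨by simp [Exp.Fits, Exp.eval, q20]; omega, ⟨?_, ?_, l ++ [y], l', by simp [hl], ?_, ?_, ?_⟩, ?_⟩
    · simp [Store.setReg_reg, q21]
    · refine f1.trans ⟨fun x hx => ?_, fun a ha => ?_⟩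
      · simp [forNbr, Prog.wr] at hx
        simp [Store.setReg_reg, Ne.symm hx.1, hF2.1 _ hx.2.2.2.1, Ne.symm hx.2.2.1]
      · simp [forNbr, Prog.wa] at ha
        simp [hF2.2 _ ha]
    · simp [Store.setReg_reg, Exp.eval, q20]; omega
    · exact (hI _ _ _ hI').1
    · simp only [Exp.cost, List.length_append, List.length_singleton]
      ring_nf
      ring_nf at ht
      omega
    · simp [Store.setReg_reg, Exp.eval, q20]
      omega
  · rintro t s₁ ⟨h21, hF, l, l', hl, h20, hJ, ht⟩ - hv
    have hlen : (L.nb u).length = l.length + l'.length := by rw [hl, List.length_append]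
    obtain _ | ⟨y, l'⟩ := l'
    · simp at hl
      subst hl
      refine ⟨?_, hJ⟩
      simp only [Exp.cost]
      omega
    · simp [Exp.eval, h20, h21, e5, hlen] at hv

end Ram

/-! ### Numbering and checking clusters -/

namespace ListGraph

variable (L : ListGraph) (pr sd : ℕ → ℕ)

/-- The sides `sd` define a 2-subcoloring of the present vertices (those with `pr u ≠ 0`) with at
most `K` clusters on side `1`; `f` numbers the clusters. -/
def Good (K : ℕ) : Prop :=
  ∃ f : ℕ → ℕ, (∀ u < L.n, ∀ w < L.n, pr u ≠ 0 → pr w ≠ 0 → sd u = sd w →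
    (f u = f w ↔ u = w ∨ w ∈ L.nb u)) ∧ ∀ u < L.n, pr u ≠ 0 → sd u = 1 → f u < K

/-- Give a new cluster number to an unnumbered vertex and its neighbors on the same side. -/
def clsStep (st : (ℕ → ℕ) × ℕ) (u : ℕ) : (ℕ → ℕ) × ℕ :=
  if pr u ≠ 0 ∧ st.1 u = 0 then
    (fun w => if w = u ∨ (w ∈ L.nb u ∧ pr w ≠ 0 ∧ sd w = sd u) then
      (if sd u = 1 then 2 * (st.2 + 1) else 2 * u + 1) else st.1 w,
      if sd u = 1 then st.2 + 1 else st.2)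
  else st

/-- Cluster numbers and number of clusters on side `1` after treating the vertices below `j`. -/
def clsRun : ℕ → (ℕ → ℕ) × ℕ
  | 0 => (fun _ => 0, 0)
  | j + 1 => clsStep L pr sd (clsRun j) j

/-- These facts hold for arbitrary sides, valid or not. The value 0 means unnumbered and the parity
of a number reveals the side, so numbers never clash between the sides. -/
theorem clsRun_basic (j : ℕ) :
    (clsRun L pr sd j).2 ≤ j ∧
    (∀ u, pr u = 0 → (clsRun L pr sd j).1 u = 0) ∧
    (∀ u < j, pr u ≠ 0 → (clsRun L pr sd j).1 u ≠ 0) ∧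
    (∀ u, (clsRun L pr sd j).1 u ≠ 0 → sd u = 1 →
      ∃ a, (clsRun L pr sd j).1 u = 2 * a ∧ 1 ≤ a ∧ a ≤ (clsRun L pr sd j).2) ∧
    (∀ u, (clsRun L pr sd j).1 u ≠ 0 → sd u ≠ 1 →
      ∃ a < j, (clsRun L pr sd j).1 u = 2 * a + 1) := by
  induction j with
  | zero => simp [clsRun]
  | succ j ih =>
    obtain ⟨h1, h2, h3, h4, h5⟩ := ih
    rw [clsRun, clsStep]
    set st := clsRun L pr sd j with hst
    by_cases hc : pr j ≠ 0 ∧ st.1 j = 0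
    · rw [if_pos hc]
      refine ⟨by dsimp only; split_ifs <;> omega, fun u hu => ?_, fun u hu hp => ?_,
        fun u hu hs => ?_, fun u hu hs => ?_⟩
      · dsimp only
        rw [if_neg, h2 u hu]
        rintro (rfl | h)
        · exact hc.1 hu
        · exact h.2.1 hu
      · dsimp only
        split_ifs with h
        · omega
        · omega
        · exact h3 u (by have : u ≠ j := fun e => h (Or.inl e)
                         omega) hp
      · dsimp only at hu ⊢
        split_ifs at hu ⊢ with h h' h'
        · exact ⟨_, rfl, by omega, le_refl _⟩
        · exfalso
          rcases h with rfl | h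
          · exact h' hs
          · exact h' (by rw [← h.2.2, hs])
        · obtain ⟨a, ha⟩ := h4 u hu hs
          exact ⟨a, ha.1, by omega, by omega⟩
        · exact h4 u hu hs
      · dsimp only at hu ⊢
        split_ifs at hu ⊢ with h h'
        · exfalso
          rcases h with rfl | h
          · exact hs h'
          · exact hs (by rw [h.2.2, h'])
        · exact ⟨j, by omega, rfl⟩
        · obtain ⟨a, ha⟩ := h5 u hu hs
          exact ⟨a, by omega, ha.2⟩
    · rw [if_neg hc]
      refine ⟨by omega, h2, fun u hu hp => ?_, h4, fun u hu hs => ?_⟩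
      · rcases Nat.lt_succ_iff_lt_or_eq.1 hu with h | rfl
        · exact h3 u h hp
        · exact fun h => hc ⟨hp, h⟩
      · obtain ⟨a, ha⟩ := h5 u hu hs
        exact ⟨a, by omega, ha.2⟩

/-- If `f` witnesses validity, the closed neighborhood of `j` on its own side is a whole class of
`f`. A step therefore numbers an entire cluster at once and never splits or overwrites one numbered
before. -/
theorem clsRun_of_good {f : ℕ → ℕ}
    (hf : ∀ u < L.n, ∀ w < L.n, pr u ≠ 0 → pr w ≠ 0 → sd u = sd w →
      (f u = f w ↔ u = w ∨ w ∈ L.nb u)) (j : ℕ) (hj : j ≤ L.n) :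
    (∀ u < L.n, ∀ w < L.n, pr u ≠ 0 → pr w ≠ 0 → sd u = sd w → f u = f w →
      (clsRun L pr sd j).1 u = (clsRun L pr sd j).1 w) ∧
    (∀ u < L.n, ∀ w < L.n, pr u ≠ 0 → pr w ≠ 0 → sd u = sd w →
      (clsRun L pr sd j).1 u = (clsRun L pr sd j).1 w → (clsRun L pr sd j).1 u ≠ 0 → f u = f w) ∧
    ∀ a, 1 ≤ a → a ≤ (clsRun L pr sd j).2 →
      ∃ u < L.n, pr u ≠ 0 ∧ sd u = 1 ∧ (clsRun L pr sd j).1 u = 2 * a := by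
  induction j with
  | zero => simp [clsRun]; omega
  | succ j ih =>
    obtain ⟨h1, h2, h3⟩ := ih (by omega)
    obtain ⟨-, -, -, b4, b5⟩ := clsRun_basic L pr sd j
    rw [clsRun, clsStep]
    set st := clsRun L pr sd j with hst
    by_cases hc : pr j ≠ 0 ∧ st.1 j = 0
    swap
    · rw [if_neg hc]
      exact ⟨h1, h2, h3⟩
    rw [if_pos hc]
    have key : ∀ w < L.n, pr w ≠ 0 → ((w = j ∨ (w ∈ L.nb j ∧ pr w ≠ 0 ∧ sd w = sd j)) ↔
        sd j = sd w ∧ f j = f w) := by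
      intro w hw hp
      constructor
      · rintro (rfl | h)
        · exact ⟨rfl, rfl⟩
        · exact ⟨h.2.2.symm, (hf j (by omega) w hw hc.1 hp h.2.2.symm).2 (Or.inr h.1)⟩
      · rintro ⟨hs, h⟩
        rcases (hf j (by omega) w hw hc.1 hp hs).1 h with h | h
        · exact Or.inl h.symm
        · exact Or.inr ⟨h, hp, hs.symm⟩
    refine ⟨fun u hu w hw pu pw hs hfw => ?_, fun u hu w hw pu pw hs hfw hne => ?_, fun a ha ha' => ?_⟩
    · dsimp only
      by_cases h : sd j = sd u ∧ f j = f u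
      · rw [if_pos ((key u hu pu).2 h), if_pos ((key w hw pw).2 ⟨h.1.trans hs, h.2.trans hfw⟩)]
      · rw [if_neg (mt (key u hu pu).1 h), if_neg]
        · exact h1 u hu w hw pu pw hs hfw
        · exact mt (key w hw pw).1 fun h' => h ⟨h'.1.trans hs.symm, h'.2.trans hfw.symm⟩
    · dsimp only at hfw hne
      -- The new number is unused: earlier even numbers are at most `2 * st.2`, earlier odd ones
      -- come from vertices below `j`.
      have fresh : ∀ x, sd x = sd j → st.1 x ≠ (if sd j = 1 then 2 * (st.2 + 1) else 2 * j + 1) := by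
        intro x hx he
        split_ifs at he with h
        · obtain ⟨a, ha⟩ := b4 x (by omega) (by omega)
          omega
        · obtain ⟨a, ha⟩ := b5 x (by omega) (by omega)
          omega
      by_cases h : sd j = sd u ∧ f j = f u <;> by_cases h' : sd j = sd w ∧ f j = f w
      · rw [← h.2, h'.2]
      · rw [if_pos ((key u hu pu).2 h), if_neg (mt (key w hw pw).1 h')] at hfw
        exact absurd hfw.symm (fresh w (by rw [← hs, h.1]))
      · rw [if_pos ((key w hw pw).2 h'), if_neg (mt (key u hu pu).1 h)] at hfw
        exact absurd hfw (fresh u (by rw [hs, h'.1]))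
      · rw [if_neg (mt (key w hw pw).1 h'), if_neg (mt (key u hu pu).1 h)] at hfw
        rw [if_neg (mt (key u hu pu).1 h)] at hne
        exact h2 u hu w hw pu pw hs hfw hne
    · dsimp only at ha' ⊢
      by_cases hold : a ≤ st.2
      · obtain ⟨u, hu, pu, su, hcu⟩ := h3 a ha hold
        refine ⟨u, hu, pu, su, ?_⟩
        rw [if_neg, hcu]
        -- If this step renumbered the representative `u` of an old cluster, `j` would share that
        -- cluster and would already have a number.
        intro h
        have := (key u hu pu).1 h
        have := h1 j (by omega) u hu hc.1 pu this.1 this.2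
        omega
      · split_ifs at ha' with h
        · refine ⟨j, by omega, hc.1, h, ?_⟩
          rw [if_pos (Or.inl rfl), if_pos h]
          omega
        · omega

/-- The outcome of the linear time test for being a valid 2-subcoloring. -/
def Check (K : ℕ) : Prop :=
  (∀ u < L.n, pr u ≠ 0 → ∀ y ∈ L.nb u, pr y ≠ 0 ∧ sd y = sd u →
    (clsRun L pr sd L.n).1 y = (clsRun L pr sd L.n).1 u) ∧
  (∀ u < L.n, pr u ≠ 0 →
    1 + (L.nb u).countP (fun y => decide (pr y ≠ 0 ∧ sd y = sd u)) =
      (List.range L.n).countP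
        (fun w => decide (pr w ≠ 0 ∧ (clsRun L pr sd L.n).1 w = (clsRun L pr sd L.n).1 u))) ∧
  (clsRun L pr sd L.n).2 ≤ K

theorem card_same (u : ℕ) :
    (insert u ((L.nb u).filter (fun y => decide (pr y ≠ 0 ∧ sd y = sd u))).toFinset).card =
      1 + (L.nb u).countP (fun y => decide (pr y ≠ 0 ∧ sd y = sd u)) := by
  rw [Finset.card_insert_of_notMem (by simp [L.irrefl]),
    List.toFinset_card_of_nodup ((L.nodup u).filter _), List.countP_eq_length_filter, add_comm]

theorem card_cls (c : ℕ → ℕ) (u : ℕ) :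
    ((List.range L.n).filter (fun w => decide (pr w ≠ 0 ∧ c w = c u))).toFinset.card =
      (List.range L.n).countP (fun w => decide (pr w ≠ 0 ∧ c w = c u)) := by
  rw [List.toFinset_card_of_nodup (List.nodup_range.filter _), List.countP_eq_length_filter]

/-- The first test puts the closed neighborhood of `u` on its side inside the set of vertices with
the number of `u`. The second test says that both have the same size, so they coincide, and having
equal numbers is the same as being equal or adjacent. -/
theorem good_of_check {K : ℕ} (h : Check L pr sd K) :
    Good L pr sd K := by
  obtain ⟨h1, h2, h3⟩ := h
  obtain ⟨-, -, b3, b4, b5⟩ := clsRun_basic L pr sd L.n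
  set st := clsRun L pr sd L.n with hst
  have key : ∀ u < L.n, ∀ w < L.n, pr u ≠ 0 → pr w ≠ 0 → sd u = sd w →
      (st.1 u = st.1 w ↔ u = w ∨ w ∈ L.nb u) := by
    intro u hu w hw pu pw hs
    constructor
    · intro he
      have hsub : insert u ((L.nb u).filter (fun y => decide (pr y ≠ 0 ∧ sd y = sd u))).toFinset ⊆
          ((List.range L.n).filter (fun w => decide (pr w ≠ 0 ∧ st.1 w = st.1 u))).toFinset := by
        intro y hy
        simp only [Finset.mem_insert, List.mem_toFinset, List.mem_filter, decide_eq_true_eq,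
          List.mem_range] at hy ⊢
        rcases hy with rfl | ⟨hy, hp⟩
        · exact ⟨hu, pu, rfl⟩
        · exact ⟨L.lt hy, hp.1, h1 u hu pu y hy hp⟩
      have heq := Finset.eq_of_subset_of_card_le hsub (by
        rw [card_same, card_cls, h2 u hu pu])
      have : w ∈ insert u
          ((L.nb u).filter (fun y => decide (pr y ≠ 0 ∧ sd y = sd u))).toFinset := by
        rw [heq]; simp [hw, pw, he]
      simp only [Finset.mem_insert, List.mem_toFinset, List.mem_filter] at this
      exact this.imp Eq.symm And.left
    · rintro (rfl | h)
      · rfl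
      · exact (h1 u hu pu w h ⟨pw, hs.symm⟩).symm
  -- Numbers 2, 4, …, 2K on side 1 are moved to 0, …, K - 1.
  refine ⟨fun u => if sd u = 1 then st.1 u / 2 - 1 else st.1 u, fun u hu w hw pu pw hs => ?_,
    fun u hu pu hs => ?_⟩
  · rw [← key u hu w hw pu pw hs]
    by_cases h : sd u = 1
    · simp only [h, ← hs, if_true]
      obtain ⟨a, ha⟩ := b4 u (b3 u hu pu) h
      obtain ⟨a', ha'⟩ := b4 w (b3 w hw pw) (hs ▸ h)
      omega
    · simp only [h, ← hs, if_false]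
  · simp only [hs, if_true]
    obtain ⟨a, ha⟩ := b4 u (b3 u hu pu) hs
    omega

/-- Properties of the cluster numbers of a valid 2-subcoloring. -/
structure IsNumbering (K : ℕ) (c : ℕ → ℕ) : Prop where
  eq_iff : ∀ u < L.n, ∀ w < L.n, pr u ≠ 0 → pr w ≠ 0 → sd u = sd w →
    (c u = c w ↔ u = w ∨ w ∈ L.nb u)
  left : ∀ u < L.n, pr u ≠ 0 → sd u = 1 → ∃ a, c u = 2 * a ∧ 1 ≤ a ∧ a ≤ K
  right : ∀ u < L.n, pr u ≠ 0 → sd u ≠ 1 → ∃ a < L.n, c u = 2 * a + 1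

/-- Each number used on side 1 has a representative, and the values of a witness `f` at these
representatives are distinct and below `K`. -/
theorem clsRun_card_le {K : ℕ} (h : Good L pr sd K) :
    (clsRun L pr sd L.n).2 ≤ K := by
  obtain ⟨f, hf, hK⟩ := h
  obtain ⟨g1, g2, g3⟩ := clsRun_of_good L pr sd hf L.n le_rfl
  choose! w hw hp hs hc using g3
  have := Finset.card_le_card_of_injOn (s := Finset.Icc 1 (clsRun L pr sd L.n).2)
    (t := Finset.range K) (fun a => f (w a)) (by
      intro a ha
      simp only [Finset.coe_Icc, Set.mem_Icc] at ha
      simpa using hK _ (hw a ha.1 ha.2) (hp a ha.1 ha.2) (hs a ha.1 ha.2)) (by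
      intro a ha b hb hab
      simp only [Finset.coe_Icc, Set.mem_Icc] at ha hb
      have := g1 _ (hw a ha.1 ha.2) _ (hw b hb.1 hb.2) (hp a ha.1 ha.2) (hp b hb.1 hb.2)
        (by rw [hs a ha.1 ha.2, hs b hb.1 hb.2]) hab
      rw [hc a ha.1 ha.2, hc b hb.1 hb.2] at this
      omega)
  simpa using this

theorem isNumbering_clsRun {K : ℕ} (h : Good L pr sd K) :
    IsNumbering L pr sd K (clsRun L pr sd L.n).1 := by
  have hcard := clsRun_card_le L pr sd h
  obtain ⟨f, hf, hK⟩ := h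
  obtain ⟨g1, g2, g3⟩ := clsRun_of_good L pr sd hf L.n le_rfl
  obtain ⟨-, -, b3, b4, b5⟩ := clsRun_basic L pr sd L.n
  refine ⟨fun u hu w hw pu pw hs => ?_, fun u hu pu hs => ?_, fun u hu pu hs => ?_⟩
  · rw [← hf u hu w hw pu pw hs]
    exact ⟨fun h => g2 u hu w hw pu pw hs h (b3 u hu pu), g1 u hu w hw pu pw hs⟩
  · obtain ⟨a, ha⟩ := b4 u (b3 u hu pu) hs
    exact ⟨a, ha.1, ha.2.1, by omega⟩
  · exact b5 u (b3 u hu pu) hs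

/-- Equal numbers have equal parity, which only tells whether both sides are 1; that the sides are 0
or 1 turns this into equality of sides. -/
theorem check_of_good {K : ℕ} (hs1 : ∀ u < L.n, sd u ≤ 1) (h : Good L pr sd K) :
    Check L pr sd K := by
  have hcard := clsRun_card_le L pr sd h
  obtain ⟨n1, n2, n3⟩ := isNumbering_clsRun L pr sd h
  refine ⟨fun u hu pu y hy hp => ?_, fun u hu pu => ?_, hcard⟩
  · exact ((n1 u hu y (L.lt hy) pu hp.1 hp.2.symm).2 (Or.inr hy)).symm
  · rw [← card_same, ← card_cls]
    congr 1
    ext y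
    simp only [Finset.mem_insert, List.mem_toFinset, List.mem_filter, decide_eq_true_eq,
      List.mem_range]
    constructor
    · rintro (rfl | ⟨hy, hp⟩)
      · exact ⟨hu, pu, rfl⟩
      · exact ⟨L.lt hy, hp.1, ((n1 u hu y (L.lt hy) pu hp.1 hp.2.symm).2 (Or.inr hy)).symm⟩
    · rintro ⟨hy, py, he⟩
      have hs : sd u = sd y := by
        by_cases a : sd u = 1 <;> by_cases b : sd y = 1
        · rw [a, b]
        · obtain ⟨_, _⟩ := n2 u hu pu a
          obtain ⟨_, _⟩ := n3 y hy py b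
          omega
        · obtain ⟨_, _⟩ := n3 u hu pu a
          obtain ⟨_, _⟩ := n2 y hy py b
          omega
        · have := hs1 u hu
          have := hs1 y hy
          omega
      exact ((n1 u hu y hy pu py hs).1 he.symm).imp Eq.symm fun h => ⟨h, py, hs.symm⟩

theorem check_iff_good {K : ℕ} (hs1 : ∀ u < L.n, sd u ≤ 1) : Check L pr sd K ↔ Good L pr sd K :=
  ⟨good_of_check L pr sd, check_of_good L pr sd hs1⟩

end ListGraph

/-! ### Propagation of forced moves -/

namespace Flip

/-- The distinct elements of a list in the order of their first occurrences. -/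
def firstOcc (l : List ℕ) : List ℕ :=
  l.foldl (fun acc j => if j ∈ acc then acc else acc ++ [j]) []

theorem firstOcc_append (l : List ℕ) (j : ℕ) :
    firstOcc (l ++ [j]) = if j ∈ firstOcc l then firstOcc l else firstOcc l ++ [j] := by
  simp only [firstOcc, List.foldl_append, List.foldl_cons, List.foldl_nil]
  rfl

theorem mem_firstOcc (l : List ℕ) (j : ℕ) : j ∈ firstOcc l ↔ j ∈ l := by
  induction l using List.reverseRecOn with
  | nil => simp [firstOcc]
  | append_singleton l a ih =>
    rw [firstOcc_append]
    split_ifs with h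
    · rw [ih, List.mem_append, List.mem_singleton]
      refine ⟨Or.inl, ?_⟩
      rintro (h' | rfl)
      · exact h'
      · rwa [← ih]
    · simp [ih]

theorem nodup_firstOcc (l : List ℕ) : (firstOcc l).Nodup := by
  induction l using List.reverseRecOn with
  | nil => simp [firstOcc]
  | append_singleton l a ih =>
    rw [firstOcc_append]
    split_ifs with h
    · exact ih
    · rw [List.nodup_append]
      refine ⟨ih, List.nodup_singleton _, ?_⟩
      intro b hb c hc e
      rw [List.mem_singleton] at hc
      exact h (hc ▸ e ▸ hb)

/-- The state of the propagation: the queue of flipped vertices, the number of treated ones,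
the labels (plus one) of the groups, for every label a vertex (plus one) whose closed neighborhood
contains the unflipped vertices with this number, and the vertices that caused a guess. -/
structure State where
  q : List ℕ
  hd : ℕ
  lab : ℕ → ℕ
  ptr : ℕ → ℕ
  log : List ℕ

variable (L : ListGraph) (pr sd cls : ℕ → ℕ)

/-- Given that `x` moved and belongs to the cluster with label `t`, must `y` move? -/
def viol (x t : ℕ) (q : List ℕ) (y : ℕ) : Bool :=
  decide (pr y ≠ 0 ∧ sd y ≠ sd x ∧ y ∉ q ∧ ¬ (y ∈ L.nb x ↔ cls y = t))

/-- Move the vertices of the closed neighborhood of `z` that have to move because of `x`. -/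
def scan (x t z : ℕ) (q : List ℕ) : List ℕ :=
  q ++ (L.nb z ++ [z]).filter (viol L pr sd cls x t q)

/-- The clusters on side `0` that are adjacent to `x`. -/
def classes (x : ℕ) : List ℕ :=
  firstOcc (((L.nb x).filter fun y => decide (pr y ≠ 0 ∧ sd y = 0)).map cls)

/-- The label of the group of `x` that belongs to the guess `d`. -/
def lbl (x d : ℕ) : ℕ := if sd x = 0 then 2 * (d + 1) else (classes L pr sd cls x).getD d 0

/-- Treat the next vertex of the queue; `ch` supplies the guesses. -/
def step (ch : ℕ → ℕ → ℕ) (s : State) : State :=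
  if s.hd < s.q.length then
    let x := s.q.getD s.hd 0
    let lab := if s.lab (cls x) = 0 then
      Function.update s.lab (cls x) (lbl L pr sd cls x (ch s.log.length x) + 1) else s.lab
    let t := lab (cls x) - 1
    let q₁ := scan L pr sd cls x t x s.q
    { q := if s.ptr t = 0 then q₁ else scan L pr sd cls x t (s.ptr t - 1) q₁
      hd := s.hd + 1
      lab := lab
      ptr := Function.update s.ptr t (x + 1)
      log := if s.lab (cls x) = 0 then s.log ++ [x] else s.log }
  else s

/-- Some member of every cluster, plus one. -/
def ptrRun : ℕ → ℕ → ℕ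
  | 0 => fun _ => 0
  | j + 1 => if pr j ≠ 0 then Function.update (ptrRun j) (cls j) (j + 1) else ptrRun j

/-- The initial state. -/
def init (v : ℕ) : State := ⟨[v], 0, fun _ => 0, ptrRun pr cls L.n, []⟩

/-- The state after `i` steps. -/
def run (ch : ℕ → ℕ → ℕ) (v i : ℕ) : State :=
  (step L pr sd cls ch)^[i] (init L pr cls v)

/-- The sides after moving the vertices of `q`. -/
def newSide (q : List ℕ) (u : ℕ) : ℕ := if sd u = (if u ∈ q then 1 else 0) then 0 else 1

theorem run_succ (ch : ℕ → ℕ → ℕ) (v i : ℕ) :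
    run L pr sd cls ch v (i + 1) = step L pr sd cls ch (run L pr sd cls ch v i) :=
  Function.iterate_succ_apply' _ _ _

variable {L pr sd cls}

theorem mem_scan {x t z y : ℕ} {q : List ℕ} : y ∈ scan L pr sd cls x t z q ↔
    y ∈ q ∨ ((y ∈ L.nb z ∨ y = z) ∧ pr y ≠ 0 ∧ sd y ≠ sd x ∧ y ∉ q ∧
      ¬ (y ∈ L.nb x ↔ cls y = t)) := by
  simp only [scan, viol, List.mem_append, List.mem_filter, List.mem_singleton, decide_eq_true_eq]

theorem nodup_closed (z : ℕ) : (L.nb z ++ [z]).Nodup := by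
  rw [List.nodup_append]
  refine ⟨L.nodup z, List.nodup_singleton _, fun a ha b hb e => ?_⟩
  rw [List.mem_singleton] at hb
  rw [e, hb] at ha
  exact L.irrefl z ha

theorem nodup_scan {x t z : ℕ} {q : List ℕ} (h : q.Nodup) :
    (scan L pr sd cls x t z q).Nodup := by
  rw [scan, List.nodup_append]
  refine ⟨h, (nodup_closed z).filter _, fun a ha b hb e => ?_⟩
  subst e
  simp only [viol, List.mem_filter, decide_eq_true_eq] at hb
  exact hb.2.2.2.1 ha

theorem lt_scan {x t z : ℕ} {q : List ℕ} (hz : z < L.n) (h : ∀ y ∈ q, y < L.n) :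
    ∀ y ∈ scan L pr sd cls x t z q, y < L.n := by
  intro y hy
  rcases mem_scan.1 hy with hy | ⟨hy | rfl, -⟩
  · exact h y hy
  · exact L.lt hy
  · exact hz

theorem prefix_scan {x t z : ℕ} {q : List ℕ} : q <+: scan L pr sd cls x t z q :=
  List.prefix_append _ _

/-- What holds during the propagation for all guesses. -/
structure Basic (L : ListGraph) (s : State) : Prop where
  nodup : s.q.Nodup
  lt : ∀ y ∈ s.q, y < L.n
  ptr : ∀ t, s.ptr t ≠ 0 → s.ptr t - 1 < L.n
  hd : s.hd ≤ s.q.length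

theorem ptrRun_spec (j : ℕ) :
    (∀ t, ptrRun pr cls j t ≠ 0 → ∃ u < j, pr u ≠ 0 ∧ cls u = t ∧ ptrRun pr cls j t = u + 1) ∧
    ∀ u < j, pr u ≠ 0 → ptrRun pr cls j (cls u) ≠ 0 := by
  induction j with
  | zero => simp [ptrRun]
  | succ j ih =>
    rw [ptrRun]
    split_ifs with h
    · refine ⟨fun t ht => ?_, fun u hu pu => ?_⟩
      · by_cases e : t = cls j
        · subst e
          exact ⟨j, by omega, h, rfl, by simp⟩
        · rw [Function.update_of_ne e] at ht ⊢
          obtain ⟨u, hu, hr⟩ := ih.1 t ht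
          exact ⟨u, by omega, hr⟩
      · by_cases e : cls u = cls j
        · rw [e]; simp
        · rw [Function.update_of_ne e]
          refine ih.2 u ?_ pu
          rcases Nat.lt_succ_iff_lt_or_eq.1 hu with h' | rfl
          · exact h'
          · exact absurd rfl e
    · refine ⟨fun t ht => ?_, fun u hu pu => ?_⟩
      · obtain ⟨u, hu, hr⟩ := ih.1 t ht
        exact ⟨u, by omega, hr⟩
      · refine ih.2 u ?_ pu
        rcases Nat.lt_succ_iff_lt_or_eq.1 hu with h' | rfl
        · exact h'
        · exact absurd pu h

theorem basic_init {v : ℕ} (hv : v < L.n) : Basic L (init L pr cls v) := by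
  refine ⟨List.nodup_singleton _, by simp [init, hv], fun t ht => ?_, by simp [init]⟩
  obtain ⟨u, hu, -, -, h⟩ := (ptrRun_spec L.n).1 t ht
  show ptrRun pr cls L.n t - 1 < L.n
  omega

theorem Basic.step {s : State} (h : Basic L s) (ch : ℕ → ℕ → ℕ) :
    Basic L (step L pr sd cls ch s) := by
  unfold Flip.step
  split_ifs with hq
  swap
  · exact h
  have hx : s.q.getD s.hd 0 < L.n := by
    rw [List.getD_eq_getElem _ _ hq]
    exact h.lt _ (List.getElem_mem hq)
  dsimp only
  set x := s.q.getD s.hd 0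
  set lab := if s.lab (cls x) = 0 then
      Function.update s.lab (cls x) (lbl L pr sd cls x (ch s.log.length x) + 1) else s.lab
  set t := lab (cls x) - 1
  have h1 := nodup_scan (x := x) (t := t) (z := x) (L := L) (pr := pr) (sd := sd) (cls := cls) h.nodup
  have h2 := lt_scan (x := x) (t := t) (L := L) (pr := pr) (sd := sd) (cls := cls) hx h.lt
  have h3 := (prefix_scan (L := L) (pr := pr) (sd := sd) (cls := cls) (x := x) (t := t) (z := x)
    (q := s.q)).length_le
  refine ⟨?_, ?_, fun t' ht' => ?_, ?_⟩
  · dsimp only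
    split_ifs
    · exact h1
    · exact nodup_scan h1
  · dsimp only
    split_ifs with hp
    · exact h2
    · exact lt_scan (h.ptr t hp) h2
  · dsimp only at ht' ⊢
    by_cases e : t' = t
    · subst e
      simpa using hx
    · rw [Function.update_of_ne e] at ht' ⊢
      exact h.ptr t' ht'
  · dsimp only
    split_ifs with hp
    · omega
    · have := (prefix_scan (L := L) (pr := pr) (sd := sd) (cls := cls) (x := x) (t := t)
        (z := s.ptr t - 1) (q := scan L pr sd cls x t x s.q)).length_le
      omega

theorem basic_run {v : ℕ} (hv : v < L.n) (ch : ℕ → ℕ → ℕ) (i : ℕ) :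
    Basic L (run L pr sd cls ch v i) := by
  induction i with
  | zero => exact basic_init hv
  | succ i ih => rw [run_succ]; exact ih.step ch

theorem Basic.length_le {s : State} (h : Basic L s) : s.q.length ≤ L.n := by
  have := Finset.card_le_card (s := s.q.toFinset) (t := Finset.range L.n) (by
    intro y hy
    simpa using h.lt y (by simpa using hy))
  rwa [List.toFinset_card_of_nodup h.nodup, Finset.card_range] at this

theorem step_of_done {ch : ℕ → ℕ → ℕ} {s : State} (h : ¬ s.hd < s.q.length) :
    step L pr sd cls ch s = s := if_neg h

theorem step_hd {ch : ℕ → ℕ → ℕ} {s : State} (h : s.hd < s.q.length) :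
    (step L pr sd cls ch s).hd = s.hd + 1 := by rw [step, if_pos h]

theorem run_of_done {ch : ℕ → ℕ → ℕ} {v i j : ℕ} (hij : i ≤ j)
    (h : ¬ (run L pr sd cls ch v i).hd < (run L pr sd cls ch v i).q.length) :
    run L pr sd cls ch v j = run L pr sd cls ch v i := by
  induction j, hij using Nat.le_induction with
  | base => rfl
  | succ j _ ih => rw [run_succ, ih, step_of_done h]

/-- A step that is not idle advances the head, and the queue holds distinct vertices below `L.n`; so
after `L.n + 1` steps it is exhausted whatever the guesses are. -/
theorem run_final {v : ℕ} (hv : v < L.n) (ch : ℕ → ℕ → ℕ) :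
    (run L pr sd cls ch v (L.n + 1)).hd = (run L pr sd cls ch v (L.n + 1)).q.length := by
  have key : ∀ i, (run L pr sd cls ch v i).hd = i ∨
      (run L pr sd cls ch v i).hd = (run L pr sd cls ch v i).q.length := by
    intro i
    induction i with
    | zero => left; rfl
    | succ i ih =>
      by_cases h : (run L pr sd cls ch v i).hd < (run L pr sd cls ch v i).q.length
      · left
        rw [run_succ, step_hd h]
        omega
      · right
        have := (basic_run (pr := pr) (sd := sd) (cls := cls) hv ch i).hd
        rw [run_succ, step_of_done h]
        omega
  rcases key (L.n + 1) with h | h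
  · have h1 := basic_run (pr := pr) (sd := sd) (cls := cls) hv ch (L.n + 1)
    have := h1.length_le
    have := h1.hd
    omega
  · exact h

/-- A 2-subcoloring `σ` of the present vertices and `v`, with `v` on the other side than in `sd`,
and cluster numbers `f` that agree with those of `sd` on side `1`. -/
structure Solution (L : ListGraph) (pr sd cls : ℕ → ℕ) (v K : ℕ) (σ f : ℕ → ℕ) : Prop where
  v_lt : v < L.n
  cls_v : cls v = 2 * L.n + 1
  num : L.IsNumbering pr sd K cls
  sd_le : ∀ u < L.n, sd u ≤ 1
  side_le : ∀ u < L.n, σ u ≤ 1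
  side_v : σ v ≠ sd v
  f_iff : ∀ u < L.n, ∀ w < L.n, (pr u ≠ 0 ∨ u = v) → (pr w ≠ 0 ∨ w = v) → σ u = σ w →
    (f u = f w ↔ u = w ∨ w ∈ L.nb u)
  f_lt : ∀ u < L.n, (pr u ≠ 0 ∨ u = v) → σ u = 1 → f u < K
  norm : ∀ u < L.n, pr u ≠ 0 → sd u = 1 → σ u = 1 → cls u = 2 * (f u + 1)

open Classical in
/-- The label of the cluster of `u` in the solution. -/
noncomputable def target (L : ListGraph) (pr sd cls σ f : ℕ → ℕ) (u : ℕ) : ℕ :=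
  if σ u = 1 then 2 * (f u + 1) else
    if h : ∃ w, w < L.n ∧ pr w ≠ 0 ∧ sd w = 0 ∧ σ w = 0 ∧ f w = f u then cls h.choose else 0

/-- The guess for `x` that fits to the solution. -/
noncomputable def guess (L : ListGraph) (pr sd cls σ f : ℕ → ℕ) (K x : ℕ) : ℕ :=
  if σ x = 1 then f x else
    if target L pr sd cls σ f x = 0 then K + 1
    else (classes L pr sd cls x).idxOf (target L pr sd cls σ f x)

/-! ### Labels determined by a solution -/

namespace Solution

variable {v K : ℕ} {σ f : ℕ → ℕ} (S : Solution L pr sd cls v K σ f)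
include S

/-- The three kinds of labels are told apart arithmetically: positive even for clusters on side 1,
odd for clusters on side 0 that keep an unmoved vertex, and 0 for the other clusters on side 0. -/
theorem target_cases (u : ℕ) :
    (σ u = 1 ∧ target L pr sd cls σ f u = 2 * (f u + 1)) ∨
    (σ u ≠ 1 ∧ ∃ w < L.n, pr w ≠ 0 ∧ sd w = 0 ∧ σ w = 0 ∧ f w = f u ∧
      target L pr sd cls σ f u = cls w ∧ ∃ a, cls w = 2 * a + 1) ∨
    (σ u ≠ 1 ∧ target L pr sd cls σ f u = 0 ∧
      ¬ ∃ w, w < L.n ∧ pr w ≠ 0 ∧ sd w = 0 ∧ σ w = 0 ∧ f w = f u) := by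
  by_cases h : σ u = 1
  · left; simp [target, h]
  · right
    by_cases h' : ∃ w, w < L.n ∧ pr w ≠ 0 ∧ sd w = 0 ∧ σ w = 0 ∧ f w = f u
    · left
      refine ⟨h, h'.choose, h'.choose_spec.1, h'.choose_spec.2.1, h'.choose_spec.2.2.1,
        h'.choose_spec.2.2.2.1, h'.choose_spec.2.2.2.2, by rw [target, if_neg h, dif_pos h'], ?_⟩
      obtain ⟨a, -, ha⟩ := S.num.right _ h'.choose_spec.1 h'.choose_spec.2.1
        (by rw [h'.choose_spec.2.2.1]; decide)
      exact ⟨a, ha⟩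
    · right
      exact ⟨h, by rw [target, if_neg h, dif_neg h'], h'⟩

omit S in
theorem target_congr {u w : ℕ} (h : σ u = σ w) (h' : f u = f w) :
    target L pr sd cls σ f u = target L pr sd cls σ f w := by
  simp only [target, h, h']

/-- This is the rule behind forced moves: for `y` that stays on the side where `x` ends up, the
label of `x` decides adjacency. On side 1 this is `norm`. On side 0 the label is the old number of
an unmoved vertex in the new cluster of `x`, and unmoved vertices share a new cluster exactly when
they share an old one. -/
theorem target_iff {x y : ℕ} (hx : x < L.n) (px : pr x ≠ 0 ∨ x = v) (hy : y < L.n) (py : pr y ≠ 0)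
    (hs : σ x = sd y) (hs' : σ y = sd y) :
    cls y = target L pr sd cls σ f x ↔ x = y ∨ y ∈ L.nb x := by
  rw [← S.f_iff x hx y hy px (Or.inl py) (hs.trans hs'.symm)]
  rcases S.target_cases x with ⟨h, e⟩ | ⟨h, w, hw, pw, sw, σw, fw, e, -⟩ | ⟨h, e, hn⟩
  · rw [e, S.norm y hy py (by omega) (by omega)]
    omega
  · have := S.sd_le y hy
    rw [e, ← fw, S.num.eq_iff y hy w hw py pw (by omega),
      ← S.f_iff y hy w hw (Or.inl py) (Or.inl pw) (by omega)]
    exact eq_comm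
  · have := S.sd_le y hy
    rw [e]
    constructor
    · intro h0
      obtain ⟨a, -, ha⟩ := S.num.right y hy py (by omega)
      omega
    · intro hf
      exact absurd ⟨y, hy, py, by omega, by omega, hf.symm⟩ hn

theorem side_of_target {x y : ℕ} (hx : x < L.n) (hy : y < L.n) (py : pr y ≠ 0)
    (h : cls y = target L pr sd cls σ f x) : sd y = σ x := by
  have h1 := S.sd_le y hy
  have h2 := S.side_le x hx
  by_cases hs : sd y = 1
  · obtain ⟨a, ha⟩ := S.num.left y hy py hs
    rcases S.target_cases x with h' | ⟨-, w, -, -, -, -, -, e, b, hb⟩ | h' <;> omega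
  · obtain ⟨a, ha⟩ := S.num.right y hy py hs
    rcases S.target_cases x with h' | ⟨h', -⟩ | h' <;> omega

/-- Parity separates the sides, and `2 * L.n + 1` exceeds every number on side 0, so `v` shares its
number with no other vertex. -/
theorem cls_iff {x y : ℕ} (hx : x < L.n) (hy : y < L.n) (px : pr x ≠ 0 ∨ x = v)
    (py : pr y ≠ 0 ∨ y = v) (h : cls x = cls y) : x = y ∨ (pr x ≠ 0 ∧ pr y ≠ 0 ∧ sd x = sd y ∧
      y ∈ L.nb x) := by
  have bound : ∀ u < L.n, pr u ≠ 0 → (sd u = 1 ∧ cls u % 2 = 0) ∨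
      (sd u = 0 ∧ cls u % 2 = 1 ∧ cls u < 2 * L.n) := by
    intro u hu pu
    by_cases hs : sd u = 1
    · obtain ⟨a, ha⟩ := S.num.left u hu pu hs
      left; omega
    · obtain ⟨a, ha⟩ := S.num.right u hu pu hs
      have := S.sd_le u hu
      right; omega
  by_cases hxv : x = v <;> by_cases hyv : y = v
  · left; rw [hxv, hyv]
  · have := bound y hy (by tauto)
    have := S.cls_v
    rw [hxv] at h
    omega
  · have := bound x hx (by tauto)
    have := S.cls_v
    rw [hyv] at h
    omega
  · have px' : pr x ≠ 0 := by tauto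
    have py' : pr y ≠ 0 := by tauto
    have h1 := bound x hx px'
    have h2 := bound y hy py'
    have hs : sd x = sd y := by omega
    rcases (S.num.eq_iff x hx y hy px' py' hs).1 h with h | h
    · exact Or.inl h
    · exact Or.inr ⟨px', py', hs, h⟩

/-- Two vertices of one old cluster are adjacent, and if both change sides they meet again on the
other side. This is why one guess per old cluster is enough. -/
theorem target_eq_of_cls {x y : ℕ} (hx : x < L.n) (hy : y < L.n) (px : pr x ≠ 0 ∨ x = v)
    (py : pr y ≠ 0 ∨ y = v) (sx : σ x ≠ sd x) (sy : σ y ≠ sd y) (h : cls x = cls y) :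
    target L pr sd cls σ f x = target L pr sd cls σ f y := by
  rcases S.cls_iff hx hy px py h with rfl | ⟨-, -, hs, hadj⟩
  · rfl
  · have := S.sd_le x hx
    have := S.sd_le y hy
    have := S.side_le x hx
    have := S.side_le y hy
    have hσ : σ x = σ y := by omega
    exact target_congr hσ ((S.f_iff x hx y hy px py hσ).2 (Or.inr hadj))

omit S in
theorem mem_classes {x c : ℕ} : c ∈ classes L pr sd cls x ↔
    ∃ y ∈ L.nb x, pr y ≠ 0 ∧ sd y = 0 ∧ cls y = c := by
  rw [classes, mem_firstOcc]
  simp only [List.mem_map, List.mem_filter, decide_eq_true_eq]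
  constructor
  · rintro ⟨y, ⟨h1, h2, h3⟩, h4⟩; exact ⟨y, h1, h2, h3, h4⟩
  · rintro ⟨y, h1, h2, h3, h4⟩; exact ⟨y, ⟨h1, h2, h3⟩, h4⟩

/-- Suppose `x` ends on side 0 and is adjacent to a vertex of a cluster on side 0 other than its
target. Then this neighbor has to move to side 1. Neighbors from different old clusters are not
adjacent and so occupy different new clusters there, at most `K` of them; the target adds one. -/
theorem length_classes_le {x : ℕ} (hx : x < L.n) (px : pr x ≠ 0 ∨ x = v) (sx : σ x = 0) :
    (classes L pr sd cls x).length ≤ K + 1 := by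
  have hex : ∀ c ∈ classes L pr sd cls x, ∃ y ∈ L.nb x, pr y ≠ 0 ∧ sd y = 0 ∧ cls y = c :=
    fun c hc => mem_classes.1 hc
  choose! y hy py sy cy using hex
  have hside : ∀ c ∈ classes L pr sd cls x, c ≠ target L pr sd cls σ f x → σ (y c) = 1 := by
    intro c hc hne
    by_contra h
    have := S.side_le _ (L.lt (hy c hc))
    refine hne ?_
    rw [← cy c hc, S.target_iff hx px (L.lt (hy c hc)) (py c hc) (by rw [sx, sy c hc])
      (by rw [sy c hc]; omega)]
    exact Or.inr (hy c hc)
  have := Finset.card_le_card_of_injOn (s := (classes L pr sd cls x).toFinset)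
    (t := Finset.range (K + 1))
    -- The value `K` is free for the target because the other values are cluster numbers on side 1,
    -- below `K`.
    (fun c => if c = target L pr sd cls σ f x then K else f (y c)) (by
      intro c hc
      simp only [List.coe_toFinset, Set.mem_ofPred_eq] at hc
      simp only [Finset.coe_range, Set.mem_Iio]
      split_ifs with h
      · omega
      · have := S.f_lt _ (L.lt (hy c hc)) (Or.inl (py c hc)) (hside c hc h)
        omega) (by
      intro c hc c' hc' h
      simp only [List.coe_toFinset, Set.mem_ofPred_eq] at hc hc'
      dsimp only at h
      split_ifs at h with h1 h2 h2
      · rw [h1, h2]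
      · have := S.f_lt _ (L.lt (hy c' hc')) (Or.inl (py c' hc')) (hside c' hc' h2)
        omega
      · have := S.f_lt _ (L.lt (hy c hc)) (Or.inl (py c hc)) (hside c hc h1)
        omega
      · have := (S.f_iff _ (L.lt (hy c hc)) _ (L.lt (hy c' hc')) (Or.inl (py c hc))
          (Or.inl (py c' hc')) (by rw [hside c hc h1, hside c' hc' h2])).1 h
        rw [← cy c hc, ← cy c' hc', S.num.eq_iff _ (L.lt (hy c hc)) _ (L.lt (hy c' hc'))
          (py c hc) (py c' hc') (by rw [sy c hc, sy c' hc'])]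
        exact this)
  rwa [classes, List.toFinset_card_of_nodup (nodup_firstOcc _), Finset.card_range] at this

/-- A vertex entering side 1 guesses the number of its cluster, one entering side 0 the position of
its target in `classes`. The target is found there because it contains an unmoved vertex, which is
adjacent to `x`. -/
theorem guess_spec {x : ℕ} (hx : x < L.n) (px : pr x ≠ 0 ∨ x = v) (sx : σ x ≠ sd x) :
    guess L pr sd cls σ f K x < K + 2 ∧
      lbl L pr sd cls x (guess L pr sd cls σ f K x) = target L pr sd cls σ f x := by
  have h1 := S.sd_le x hx
  have h2 := S.side_le x hx
  rcases S.target_cases x with ⟨h, e⟩ | ⟨h, w, hw, pw, sw, σw, fw, e, a, ha⟩ | ⟨h, e, hn⟩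
  · have := S.f_lt x hx px h
    have h3 : sd x = 0 := by omega
    simp only [guess, lbl, h, e, h3, if_true]
    exact ⟨by omega, trivial⟩
  · have hlen := S.length_classes_le hx px (by omega)
    have h3 : sd x ≠ 0 := by omega
    have hmem : cls w ∈ classes L pr sd cls x := by
      refine mem_classes.2 ⟨w, ?_, pw, sw, rfl⟩
      rcases (S.f_iff x hx w hw px (Or.inl pw) (by omega)).1 fw.symm with rfl | h4
      · exact absurd sw h3
      · exact h4
    have hlt := List.idxOf_lt_length_of_mem hmem
    have h0 : cls w ≠ 0 := by omega
    simp only [guess, lbl, h, e, h0, h3, if_false]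
    exact ⟨by omega, by rw [List.getD_eq_getElem _ _ hlt, List.getElem_idxOf]⟩
  · have hlen := S.length_classes_le hx px (by omega)
    have h3 : sd x ≠ 0 := by omega
    simp only [guess, lbl, h, e, h3, if_false, if_true]
    -- The guess `K + 1` lies beyond the end of the list, so the default value 0 gives the label
    -- without unmoved vertices.
    exact ⟨by omega, List.getD_eq_default _ _ hlen⟩

end Solution

/-- What holds during the propagation if all guesses fit to the solution. -/
structure Correct (L : ListGraph) (pr sd cls : ℕ → ℕ) (v : ℕ) (σ f : ℕ → ℕ) (s : State) :
    Prop where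
  moved : ∀ y ∈ s.q, (pr y ≠ 0 ∨ y = v) ∧ σ y ≠ sd y
  lab : ∀ c, s.lab c ≠ 0 → ∃ x ∈ s.q, cls x = c ∧ s.lab c = target L pr sd cls σ f x + 1
  done : ∀ x ∈ s.q.take s.hd, ∀ y < L.n, pr y ≠ 0 → y ∉ s.q → sd y = σ x →
    (y ∈ L.nb x ↔ cls y = target L pr sd cls σ f x)
  ptr : ∀ y < L.n, pr y ≠ 0 → y ∉ s.q → s.ptr (cls y) ≠ 0 ∧
    (y ∈ L.nb (s.ptr (cls y) - 1) ∨ y = s.ptr (cls y) - 1)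
  log_sub : ∀ x ∈ s.log, x ∈ s.q
  log_nodup : (s.log.map cls).Nodup
  log_lab : ∀ x ∈ s.log, s.lab (cls x) ≠ 0

variable {v K : ℕ} {σ f : ℕ → ℕ}

theorem Solution.correct_init (S : Solution L pr sd cls v K σ f) :
    Correct L pr sd cls v σ f (init L pr cls v) := by
  refine ⟨?_, by simp [init], by simp [init], ?_, by simp [init], by simp [init], by simp [init]⟩
  · intro y hy
    simp only [init, List.mem_singleton] at hy
    subst hy
    exact ⟨Or.inr rfl, S.side_v⟩
  · intro y hy py _
    show ptrRun pr cls L.n _ ≠ 0 ∧ (y ∈ L.nb (ptrRun pr cls L.n _ - 1) ∨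
      y = ptrRun pr cls L.n _ - 1)
    have h0 := (ptrRun_spec (cls := cls) L.n).2 y hy py
    obtain ⟨u, hu, pu, hc, e⟩ := (ptrRun_spec L.n).1 _ h0
    refine ⟨h0, ?_⟩
    rw [e, Nat.add_sub_cancel]
    rcases S.cls_iff hu hy (Or.inl pu) (Or.inl py) hc with h | h
    · exact Or.inr h.symm
    · exact Or.inl h.2.2.2

/-- With fitting guesses the label of `x` is its target, so every move made is also made by the
solution. Conversely, the two scans meet all vertices that violate the condition for `x`; hence the
condition holds for `x` and all vertices still unmoved, and `x` may become the pointer of its label.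
-/
theorem Solution.correct_step (S : Solution L pr sd cls v K σ f) {s : State} (hb : Basic L s)
    (hc : Correct L pr sd cls v σ f s) :
    Correct L pr sd cls v σ f
      (step L pr sd cls (fun _ x => guess L pr sd cls σ f K x) s) := by
  unfold Flip.step
  split_ifs with hq
  swap
  · exact hc
  have hxq : s.q.getD s.hd 0 ∈ s.q := by
    rw [List.getD_eq_getElem _ _ hq]
    exact List.getElem_mem hq
  have htake : s.q.take (s.hd + 1) = s.q.take s.hd ++ [s.q.getD s.hd 0] := by
    rw [List.getD_eq_getElem _ _ hq, List.take_succ_eq_append_getElem hq]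
  dsimp only
  set x := s.q.getD s.hd 0
  have hx := hb.lt x hxq
  obtain ⟨px, sx⟩ := hc.moved x hxq
  obtain ⟨-, hlbl⟩ := S.guess_spec hx px sx
  rw [hlbl]
  set lab := if s.lab (cls x) = 0 then
      Function.update s.lab (cls x) (target L pr sd cls σ f x + 1) else s.lab with hlab
  -- If the label was stored earlier, it was stored for a moved vertex of the same old cluster,
  -- whose target is the same.
  have hlabx : lab (cls x) = target L pr sd cls σ f x + 1 := by
    rw [hlab]
    split_ifs with h
    · simp
    · obtain ⟨y, hy, hcy, e⟩ := hc.lab _ h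
      obtain ⟨py, sy⟩ := hc.moved y hy
      rw [e, S.target_eq_of_cls (hb.lt y hy) hx py px sy sx hcy]
  have hlabo : ∀ c, c ≠ cls x → lab c = s.lab c := by
    intro c hne
    rw [hlab]
    split_ifs with h
    · exact Function.update_of_ne hne _ _
    · rfl
  rw [hlabx, Nat.add_sub_cancel]
  set t := target L pr sd cls σ f x with ht
  set q₁ := scan L pr sd cls x t x s.q with hq₁
  set q₂ := if s.ptr t = 0 then q₁ else scan L pr sd cls x t (s.ptr t - 1) q₁ with hq₂
  have sdx := S.sd_le x hx
  have σx := S.side_le x hx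
  -- By contraposition: if `y` stayed in the solution, `target_iff` would give the equivalence.
  have hforced : ∀ y < L.n, pr y ≠ 0 → sd y ≠ sd x → ¬ (y ∈ L.nb x ↔ cls y = t) →
      σ y ≠ sd y := by
    intro y hy py sy hv hs
    have := S.sd_le y hy
    apply hv
    rw [ht, S.target_iff hx px hy py (by omega) hs]
    constructor
    · exact Or.inr
    · rintro (rfl | h)
      · exact absurd hs sx
      · exact h
  have hpre : s.q <+: q₂ := by
    rw [hq₂]
    split_ifs
    · exact prefix_scan
    · exact prefix_scan.trans prefix_scan
  have hsub := hpre.subset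
  have hlt₁ : ∀ y ∈ q₁, y < L.n := lt_scan hx hb.lt
  have hlt₂ : ∀ y ∈ q₂, y < L.n := by
    rw [hq₂]
    split_ifs with hp
    · exact hlt₁
    · exact lt_scan (hb.ptr t hp) hlt₁
  have hmoved₁ : ∀ y ∈ q₁, (pr y ≠ 0 ∨ y = v) ∧ σ y ≠ sd y := by
    intro y hy
    rcases mem_scan.1 hy with h | ⟨-, h1, h2, -, h3⟩
    · exact hc.moved y h
    · exact ⟨Or.inl h1, hforced y (hlt₁ y hy) h1 h2 h3⟩
  have hmoved₂ : ∀ y ∈ q₂, (pr y ≠ 0 ∨ y = v) ∧ σ y ≠ sd y := by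
    intro y hy
    have hyn := hlt₂ y hy
    rw [hq₂] at hy
    split_ifs at hy with hp
    · exact hmoved₁ y hy
    · rcases mem_scan.1 hy with h | ⟨-, h1, h2, -, h3⟩
      · exact hmoved₁ y h
      · exact ⟨Or.inl h1, hforced y hyn h1 h2 h3⟩
  have hdone : ∀ y < L.n, pr y ≠ 0 → y ∉ q₂ → sd y = σ x → (y ∈ L.nb x ↔ cls y = t) := by
    intro y hy py hnq hs
    by_contra hv
    have hsy : sd y ≠ sd x := by omega
    have hnq₁ : y ∉ q₁ := by
      intro h
      apply hnq
      rw [hq₂]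
      split_ifs
      · exact h
      · exact mem_scan.2 (Or.inl h)
    have hns : y ∉ s.q := fun h => hnq (hsub h)
    by_cases hadj : y ∈ L.nb x
    · exact hnq₁ (mem_scan.2 (Or.inr ⟨Or.inl hadj, py, hsy, hns, hv⟩))
    -- A violator not adjacent to `x` lies in the old cluster with number `t`, so the pointer of `t`
    -- leads to it and the second scan finds it.
    · have hct : cls y = t := by tauto
      obtain ⟨h1, h2⟩ := hc.ptr y hy py hns
      rw [hct] at h1 h2
      apply hnq
      rw [hq₂, if_neg h1]
      exact mem_scan.2 (Or.inr ⟨h2, py, hsy, hnq₁, hv⟩)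
  refine ⟨hmoved₂, ?_, ?_, ?_, ?_, ?_, ?_⟩
  · intro c h
    dsimp only at h ⊢
    by_cases e : c = cls x
    · exact ⟨x, hsub hxq, e.symm, by rw [e, hlabx]⟩
    · rw [hlabo _ e] at h ⊢
      obtain ⟨y, hy, hr⟩ := hc.lab c h
      exact ⟨y, hsub hy, hr⟩
  · intro z hz y hy py hnq hs
    dsimp only at hz hnq
    rw [(List.prefix_iff_eq_take.1 hpre : s.q = q₂.take s.q.length), List.take_take] at htake
    rw [min_eq_left (by omega)] at htake
    rw [htake, List.mem_append, List.mem_singleton, ← List.prefix_iff_eq_take.1 hpre] at hz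
    rcases hz with hz | rfl
    · exact hc.done z hz y hy py (fun h => hnq (hsub h)) hs
    · exact hdone y hy py hnq hs
  · intro y hy py hnq
    dsimp only at hnq ⊢
    by_cases e : cls y = t
    · rw [e, Function.update_self]
      -- After the scans, every unmoved vertex with number `t` is adjacent to `x`, so the new
      -- pointer `x` covers all of them.
      refine ⟨by omega, Or.inl ?_⟩
      rw [Nat.add_sub_cancel]
      exact (hdone y hy py hnq (S.side_of_target hx hy py e)).2 e
    · rw [Function.update_of_ne e]
      exact hc.ptr y hy py fun h => hnq (hsub h)
  · intro y hy
    dsimp only at hy ⊢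
    split_ifs at hy with h
    · rcases List.mem_append.1 hy with h' | h'
      · exact hsub (hc.log_sub y h')
      · rw [List.mem_singleton] at h'
        rw [h']
        exact hsub hxq
    · exact hsub (hc.log_sub y hy)
  · dsimp only
    split_ifs with h
    · rw [List.map_append, List.nodup_append]
      refine ⟨hc.log_nodup, by simp, fun a ha b hb' e => ?_⟩
      simp only [List.map_cons, List.map_nil, List.mem_singleton] at hb'
      obtain ⟨y, hy, rfl⟩ := List.mem_map.1 ha
      -- A guess is made only when the old cluster of `x` has no label yet, whereas clusters of
      -- logged vertices have one.
      exact hc.log_lab y hy (by rw [e, hb', h])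
    · exact hc.log_nodup
  · intro y hy
    dsimp only at hy ⊢
    by_cases e : cls y = cls x
    · rw [e, hlabx]; omega
    · rw [hlabo _ e]
      split_ifs at hy with h
      · rcases List.mem_append.1 hy with h' | h'
        · exact hc.log_lab y h'
        · rw [List.mem_singleton] at h'
          exact absurd (by rw [h']) e
      · exact hc.log_lab y hy

end Flip

/-! ### Number of guesses and completeness of the propagation -/

namespace Flip

variable {L : ListGraph} {pr sd cls : ℕ → ℕ} {v K : ℕ} {σ f : ℕ → ℕ}

theorem Solution.correct_run (S : Solution L pr sd cls v K σ f) (i : ℕ) :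
    Correct L pr sd cls v σ f
      (run L pr sd cls (fun _ x => guess L pr sd cls σ f K x) v i) := by
  induction i with
  | zero => exact S.correct_init
  | succ i ih =>
    rw [run_succ]
    exact S.correct_step (basic_run S.v_lt _ i) ih

/-- Logged vertices belong to distinct old clusters. They inject into `2 * K + 1` values: an old
cluster on side 1 gives a value below `K`, a vertex leaving side 0 gives `K` plus its new cluster
number, and `v` gives `2 * K`. -/
theorem Solution.length_log_le (S : Solution L pr sd cls v K σ f) {s : State} (hb : Basic L s)
    (hc : Correct L pr sd cls v σ f s) : s.log.length ≤ 2 * K + 1 := by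
  have hnd : s.log.Nodup := hc.log_nodup.of_map _
  have hinj : ∀ x ∈ s.log, ∀ y ∈ s.log, cls x = cls y → x = y :=
    fun x hx y hy h => List.inj_on_of_nodup_map hc.log_nodup hx hy h
  have hlt : ∀ x ∈ s.log, x < L.n := fun x hx => hb.lt x (hc.log_sub x hx)
  have hcase : ∀ x ∈ s.log, x ≠ v → (sd x = 1 ∧ ∃ a, cls x = 2 * a ∧ 1 ≤ a ∧ a ≤ K) ∨
      (sd x = 0 ∧ σ x = 1 ∧ f x < K) := by
    intro x hx hv
    obtain ⟨px, sx⟩ := hc.moved x (hc.log_sub x hx)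
    have := S.sd_le x (hlt x hx)
    have := S.side_le x (hlt x hx)
    by_cases h : sd x = 1
    · exact Or.inl ⟨h, S.num.left x (hlt x hx) (by tauto) h⟩
    · exact Or.inr ⟨by omega, by omega, S.f_lt x (hlt x hx) px (by omega)⟩
  have := Finset.card_le_card_of_injOn (s := s.log.toFinset) (t := Finset.range (2 * K + 1))
    (fun x => if x = v then 2 * K else if sd x = 1 then cls x / 2 - 1 else K + f x) (by
      intro x hx
      simp only [List.coe_toFinset, Set.mem_ofPred_eq] at hx
      simp only [Finset.coe_range, Set.mem_Iio]
      split_ifs with h1 h2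
      · omega
      · rcases hcase x hx h1 with ⟨_, a, _⟩ | _ <;> omega
      · rcases hcase x hx h1 with ⟨_, a, _⟩ | _ <;> omega) (by
      intro x hx y hy h
      simp only [List.coe_toFinset, Set.mem_ofPred_eq] at hx hy
      dsimp only at h
      by_cases hxv : x = v <;> by_cases hyv : y = v
      · rw [hxv, hyv]
      · rw [if_pos hxv, if_neg hyv] at h
        rcases hcase y hy hyv with ⟨h1, a, ha⟩ | h1
        · rw [if_pos h1] at h; omega
        · rw [if_neg (by omega)] at h; omega
      · rw [if_pos hyv, if_neg hxv] at h
        rcases hcase x hx hxv with ⟨h1, a, ha⟩ | h1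
        · rw [if_pos h1] at h; omega
        · rw [if_neg (by omega)] at h; omega
      · rw [if_neg hxv, if_neg hyv] at h
        have px : pr x ≠ 0 := by have := (hc.moved x (hc.log_sub x hx)).1; tauto
        have py : pr y ≠ 0 := by have := (hc.moved y (hc.log_sub y hy)).1; tauto
        apply hinj x hx y hy
        rcases hcase x hx hxv with ⟨h1, a, ha⟩ | h1 <;> rcases hcase y hy hyv with ⟨h2, b, hb⟩ | h2
        · rw [if_pos h1, if_pos h2] at h
          omega
        · rw [if_pos h1, if_neg (by omega)] at h
          omega
        · rw [if_neg (by omega), if_pos h2] at h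
          omega
        · rw [if_neg (by omega), if_neg (by omega)] at h
          -- Two vertices that both leave side 0 and share a new cluster are adjacent, so they came
          -- from the same old cluster.
          rw [S.num.eq_iff x (hlt x hx) y (hlt y hy) px py (by omega),
            ← S.f_iff x (hlt x hx) y (hlt y hy) (Or.inl px) (Or.inl py) (by omega)]
          omega)
  rwa [List.toFinset_card_of_nodup hnd, Finset.card_range] at this

theorem newSide_mem {q : List ℕ} {u : ℕ} (h : u ∈ q) (h1 : sd u ≤ 1) (h2 : σ u ≤ 1)
    (h3 : σ u ≠ sd u) : newSide sd q u = σ u := by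
  rw [newSide, if_pos h]
  split_ifs <;> omega

theorem newSide_notMem {q : List ℕ} {u : ℕ} (h : u ∉ q) (h1 : sd u ≤ 1) :
    newSide sd q u = sd u := by
  rw [newSide, if_neg h]
  split_ifs <;> omega

theorem newSide_le (q : List ℕ) (u : ℕ) : newSide sd q u ≤ 1 := by
  rw [newSide]
  split_ifs <;> omega

/-- Two moved vertices relate as in the solution, two unmoved ones as before, and mixed pairs are
handled by the `done` property of the exhausted queue. The solution may move vertices that are not
in the queue; they stay where they were. -/
theorem Solution.good_final (S : Solution L pr sd cls v K σ f) {s : State} (hb : Basic L s)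
    (hv : v ∈ s.q) (hc : Correct L pr sd cls v σ f s) (hd : s.hd = s.q.length) :
    L.Good (Function.update pr v 1) (newSide sd s.q) K := by
  have hpr : ∀ u, Function.update pr v 1 u ≠ 0 → pr u ≠ 0 ∨ u = v := by
    intro u hu
    by_cases h : u = v
    · exact Or.inr h
    · rw [Function.update_of_ne h] at hu
      exact Or.inl hu
  have hmem : ∀ u ∈ s.q, newSide sd s.q u = σ u := fun u hu =>
    newSide_mem hu (S.sd_le u (hb.lt u hu)) (S.side_le u (hb.lt u hu)) (hc.moved u hu).2
  have hnot : ∀ u < L.n, u ∉ s.q → newSide sd s.q u = sd u := fun u hu h =>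
    newSide_notMem h (S.sd_le u hu)
  have hp : ∀ u, Function.update pr v 1 u ≠ 0 → u ∉ s.q → pr u ≠ 0 := by
    intro u hu h
    rcases hpr u hu with h' | rfl
    · exact h'
    · exact absurd hv h
  have hdone : ∀ x ∈ s.q, ∀ y < L.n, pr y ≠ 0 → y ∉ s.q → sd y = σ x →
      (y ∈ L.nb x ↔ cls y = target L pr sd cls σ f x) := by
    intro x hx
    refine hc.done x ?_
    rwa [hd, List.take_length]
  let m : ℕ → ℕ := fun u => if u ∈ s.q then target L pr sd cls σ f u else cls u
  -- The label 0 may be shared by several new clusters on side 0. They are separated by the even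
  -- numbers `2 * f u + 2`, which avoid the odd labels.
  let g : ℕ → ℕ := fun u => if newSide sd s.q u = 1 then m u / 2 - 1 else
    if m u = 0 then 2 * f u + 2 else m u
  have mixed : ∀ u < L.n, ∀ w < L.n, u ∈ s.q → w ∉ s.q → pr w ≠ 0 →
      newSide sd s.q u = newSide sd s.q w → (g u = g w ↔ w ∈ L.nb u) := by
    intro u hu w hw uq wq pw hs
    have hu1 := hmem u uq
    have hw1 := hnot w hw wq
    rw [hdone u uq w hw pw wq (by omega)]
    simp only [g, m, ← hs, if_pos uq, if_neg wq, hu1]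
    by_cases h1 : σ u = 1
    · obtain ⟨a, ha⟩ := S.num.left w hw pw (by omega)
      rcases S.target_cases u with h | h | h <;> rw [if_pos h1, if_pos h1] <;> omega
    · obtain ⟨a, ha⟩ := S.num.right w hw pw (by omega)
      rw [if_neg h1, if_neg h1, if_neg (show cls w ≠ 0 by omega)]
      split_ifs <;> omega
  refine ⟨g, fun u hu w hw pu pw hs => ?_, fun u hu pu hs => ?_⟩
  · by_cases uq : u ∈ s.q <;> by_cases wq : w ∈ s.q
    · have hu1 := hmem u uq
      have hw1 := hmem w wq
      rw [← S.f_iff u hu w hw (hpr u pu) (hpr w pw) (by omega)]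
      simp only [g, m, ← hs, if_pos uq, if_pos wq, hu1]
      by_cases h1 : σ u = 1
      · rcases S.target_cases u with h | h | h <;> rcases S.target_cases w with h' | h' | h' <;>
          rw [if_pos h1, if_pos h1] <;> omega
      · have hcongr : f u = f w → target L pr sd cls σ f u = target L pr sd cls σ f w :=
          target_congr (by omega)
        rw [if_neg h1, if_neg h1]
        rcases S.target_cases u with h | ⟨h, x, hx, px, sx, σx, fx, e, a, ha⟩ | ⟨h, e, -⟩ <;>
          rcases S.target_cases w with h' | ⟨h', y, hy, py, sy, σy, fy, e', b, hb⟩ | ⟨h', e', -⟩ <;>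
          try omega
        · rw [if_neg (by omega), if_neg (by omega), e, e',
            S.num.eq_iff x hx y hy px py (by omega),
            ← S.f_iff x hx y hy (Or.inl px) (Or.inl py) (by omega), fx, fy]
        · rw [if_neg (by omega), if_pos e']
          constructor
          · omega
          · intro h; have := hcongr h; omega
        · rw [if_pos e, if_neg (by omega)]
          constructor
          · omega
          · intro h; have := hcongr h; omega
        · rw [if_pos e, if_pos e']
          omega
    · rw [mixed u hu w hw uq wq (hp w pw wq) hs]
      constructor
      · exact Or.inr
      · rintro (rfl | h)
        · exact absurd uq wq
        · exact h
    · rw [eq_comm, mixed w hw u hu wq uq (hp u pu uq) hs.symm]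
      constructor
      · exact fun h => Or.inr (L.symm h)
      · rintro (rfl | h)
        · exact absurd wq uq
        · exact L.symm h
    · have hu1 := hnot u hu uq
      have hw1 := hnot w hw wq
      have pu' := hp u pu uq
      have pw' := hp w pw wq
      rw [← S.num.eq_iff u hu w hw pu' pw' (by omega)]
      simp only [g, m, ← hs, if_neg uq, if_neg wq, hu1]
      by_cases h1 : sd u = 1
      · obtain ⟨a, ha⟩ := S.num.left u hu pu' h1
        obtain ⟨b, hb⟩ := S.num.left w hw pw' (by omega)
        rw [if_pos h1, if_pos h1]
        omega
      · obtain ⟨a, ha⟩ := S.num.right u hu pu' h1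
        obtain ⟨b, hb⟩ := S.num.right w hw pw' (by omega)
        rw [if_neg h1, if_neg h1, if_neg (by omega), if_neg (by omega)]
  · simp only [g, if_pos hs, m]
    by_cases uq : u ∈ s.q
    · rw [if_pos uq]
      have h1 := hmem u uq
      have := S.f_lt u hu (hpr u pu) (by omega)
      rcases S.target_cases u with h | h | h <;> omega
    · rw [if_neg uq]
      have h1 := hnot u hu uq
      obtain ⟨a, ha⟩ := S.num.left u hu (hp u pu uq) (by omega)
      omega

theorem step_log_prefix (ch : ℕ → ℕ → ℕ) (s : State) :
    s.log <+: (step L pr sd cls ch s).log := by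
  unfold step
  split_ifs
  · dsimp only
    split_ifs
    · exact List.prefix_append _ _
    · exact List.prefix_refl _
  · exact List.prefix_refl _

theorem step_q_prefix (ch : ℕ → ℕ → ℕ) (s : State) :
    s.q <+: (step L pr sd cls ch s).q := by
  unfold step
  split_ifs
  · dsimp only
    split_ifs <;> first | exact prefix_scan | exact prefix_scan.trans prefix_scan
  · exact List.prefix_refl _

theorem run_log_prefix (ch : ℕ → ℕ → ℕ) (v : ℕ) {i j : ℕ} (h : i ≤ j) :
    (run L pr sd cls ch v i).log <+: (run L pr sd cls ch v j).log := by
  induction j, h using Nat.le_induction with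
  | base => exact List.prefix_refl _
  | succ j _ ih => rw [run_succ]; exact ih.trans (step_log_prefix _ _)

theorem mem_run_q (ch : ℕ → ℕ → ℕ) (v i : ℕ) : v ∈ (run L pr sd cls ch v i).q := by
  induction i with
  | zero => simp [run, init]
  | succ i ih => rw [run_succ]; exact (step_q_prefix _ _).subset ih

/-- The guesses of a run depend only on the vertices that need one. -/
theorem run_eq_run (g : ℕ → ℕ) (dig : ℕ → ℕ) (v N : ℕ)
    (h : ∀ i (hi : i < (run L pr sd cls (fun _ x => g x) v N).log.length),
      dig i = g ((run L pr sd cls (fun _ x => g x) v N).log[i])) (i : ℕ) (hi : i ≤ N) :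
    run L pr sd cls (fun m _ => dig m) v i = run L pr sd cls (fun _ x => g x) v i := by
  induction i with
  | zero => rfl
  | succ i ih =>
    rw [run_succ, run_succ, ih (by omega)]
    have hpre := run_log_prefix (L := L) (pr := pr) (sd := sd) (cls := cls) (fun _ x => g x) v hi
    rw [run_succ] at hpre
    set s := run L pr sd cls (fun _ x => g x) v i
    set log := (run L pr sd cls (fun _ x => g x) v N).log
    by_cases hq : s.hd < s.q.length
    swap
    · rw [step_of_done hq, step_of_done hq]
    by_cases hl : s.lab (cls (s.q.getD s.hd 0)) = 0
    · have e : dig s.log.length = g (s.q.getD s.hd 0) := by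
        simp only [step, if_pos hq, if_pos hl] at hpre
        obtain ⟨r, hr⟩ := hpre
        have hlen : s.log.length < log.length := by
          rw [← hr]; simp
        rw [h _ hlen]
        congr 1
        simp [← hr]
      simp only [step, if_pos hq, if_pos hl, e]
    · simp only [step, if_pos hq, if_neg hl]

/-- Listing the fitting guesses in the order in which they are requested turns them into digits that
do not depend on the vertices. The length of the log shows that only the first `2 * K + 1` digits
are read. -/
theorem Solution.exists_guess (S : Solution L pr sd cls v K σ f) :
    ∃ dig : ℕ → ℕ, (∀ i, dig i < K + 2) ∧ ∀ dig' : ℕ → ℕ, (∀ i < 2 * K + 1, dig' i = dig i) →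
      L.Good (Function.update pr v 1)
        (newSide sd (run L pr sd cls (fun m _ => dig' m) v (L.n + 1)).q) K := by
  set g := guess L pr sd cls σ f K with hg
  set s := run L pr sd cls (fun _ x => g x) v (L.n + 1) with hs
  have hc : Correct L pr sd cls v σ f s := S.correct_run _
  have hb : Basic L s := basic_run S.v_lt _ _
  have hlen := S.length_log_le hb hc
  refine ⟨fun i => if h : i < s.log.length then g s.log[i] else 0, fun i => ?_,
    fun dig' hd => ?_⟩
  · dsimp only
    split_ifs with h
    · have hm := hc.log_sub _ (List.getElem_mem h)
      have := hc.moved _ hm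
      exact (S.guess_spec (hb.lt _ hm) this.1 this.2).1
    · omega
  · rw [run_eq_run g dig' v (L.n + 1) (fun i hi => ?_) _ le_rfl]
    · exact S.good_final hb (mem_run_q _ _ _) hc (run_final S.v_lt _)
    · rw [hd i (lt_of_lt_of_le hi hlen)]
      exact dif_pos hi

/-- A partial injection on `{0, …, K - 1}` extends to a permutation. -/
theorem exists_perm_extend (K : ℕ) (s : Set ℕ) (h : ℕ → ℕ) (hs : ∀ i ∈ s, i < K ∧ h i < K)
    (hi : Set.InjOn h s) :
    ∃ π : ℕ → ℕ, (∀ i ∈ s, π i = h i) ∧ (∀ i < K, π i < K) ∧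
      ∀ i < K, ∀ j < K, π i = π j → i = j := by
  classical
  let F : Fin K → Fin K := fun i => if hh : h i < K then ⟨h i, hh⟩ else i
  obtain ⟨e, he⟩ := Finset.exists_equiv_extend_of_card_eq (α := Fin K) (t := Finset.univ)
    (by simp) (s := Finset.univ.filter fun i : Fin K => (i : ℕ) ∈ s) (f := F)
    (Finset.subset_univ _) (by
      intro i hi' j hj' hij
      simp only [Finset.coe_filter, Finset.mem_univ, true_and, Set.mem_ofPred_eq] at hi' hj'
      simp only [F, dif_pos (hs _ hi').2, dif_pos (hs _ hj').2, Fin.mk.injEq] at hij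
      exact Fin.ext (hi hi' hj' hij))
  refine ⟨fun i => if hh : i < K then (e ⟨i, hh⟩ : Fin K) else i, fun i hi' => ?_, fun i hh => ?_,
    fun i hh j hh' hij => ?_⟩
  · have hK := hs i hi'
    simp only [dif_pos hK.1, he ⟨i, hK.1⟩ (by simpa using hi'), F, dif_pos hK.2]
  · simp only [dif_pos hh, Fin.is_lt]
  · simp only [dif_pos hh, dif_pos hh'] at hij
    have := e.injective (Subtype.ext (Fin.ext hij))
    simpa using this

/-- Only `norm` has to be arranged. Vertices that stay on side 1 share a new cluster exactly when
they share an old one; so sending new to old numbers is a partial injection on `{0, …, K - 1}`,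
which extends to a permutation. -/
theorem exists_solution (hv : v < L.n) (cv : cls v = 2 * L.n + 1)
    (num : L.IsNumbering pr sd K cls) (hsd : ∀ u < L.n, sd u ≤ 1) (hσ : ∀ u < L.n, σ u ≤ 1)
    (hne : σ v ≠ sd v) (hg : L.Good (Function.update pr v 1) σ K) :
    ∃ f, Solution L pr sd cls v K σ f := by
  obtain ⟨f, hf, hK⟩ := hg
  have hpr : ∀ u, (pr u ≠ 0 ∨ u = v) → Function.update pr v 1 u ≠ 0 := by
    intro u hu
    by_cases h : u = v
    · rw [h]; simp
    · rw [Function.update_of_ne h]; tauto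
  -- `T` collects the new clusters on side 1 that contain a stationary vertex.
  let T : Set ℕ := {i | ∃ u < L.n, pr u ≠ 0 ∧ sd u = 1 ∧ σ u = 1 ∧ f u = i}
  choose! r hr pr' sr σr fr using fun i (hi : i ∈ T) => hi
  obtain ⟨π, h1, h2, h3⟩ := exists_perm_extend K T (fun i => cls (r i) / 2 - 1) (by
      intro i hi
      obtain ⟨a, ha⟩ := num.left _ (hr i hi) (pr' i hi) (sr i hi)
      have := hK _ (hr i hi) (hpr _ (Or.inl (pr' i hi))) (σr i hi)
      have := fr i hi
      omega) (by
      intro i hi j hj hij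
      obtain ⟨a, ha⟩ := num.left _ (hr i hi) (pr' i hi) (sr i hi)
      obtain ⟨b, hb⟩ := num.left _ (hr j hj) (pr' j hj) (sr j hj)
      have hc : cls (r i) = cls (r j) := by
        dsimp only at hij
        omega
      rw [num.eq_iff _ (hr i hi) _ (hr j hj) (pr' i hi) (pr' j hj) (by rw [sr i hi, sr j hj]),
        ← hf _ (hr i hi) _ (hr j hj) (hpr _ (Or.inl (pr' i hi))) (hpr _ (Or.inl (pr' j hj)))
        (by rw [σr i hi, σr j hj]), fr i hi, fr j hj] at hc
      exact hc)
  refine ⟨fun u => if σ u = 1 then π (f u) else f u, hv, cv, num, hsd, hσ, hne, ?_, ?_, ?_⟩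
  · intro u hu w hw pu pw hs
    rw [← hf u hu w hw (hpr u pu) (hpr w pw) hs]
    by_cases h : σ u = 1
    · simp only [← hs, h, if_true]
      exact ⟨h3 _ (hK u hu (hpr u pu) h) _ (hK w hw (hpr w pw) (hs ▸ h)), fun h => by rw [h]⟩
    · simp only [← hs, h, if_false]
  · intro u hu pu hs
    simp only [hs, if_true]
    exact h2 _ (hK u hu (hpr u pu) hs)
  · intro u hu pu su σu
    have hT : f u ∈ T := ⟨u, hu, pu, su, σu, rfl⟩
    simp only [σu, if_true, h1 _ hT]
    have hc : cls (r (f u)) = cls u := by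
      rw [num.eq_iff _ (hr _ hT) _ hu (pr' _ hT) pu (by rw [sr _ hT, su]),
        ← hf _ (hr _ hT) _ hu (hpr _ (Or.inl (pr' _ hT))) (hpr _ (Or.inl pu))
        (by rw [σr _ hT, σu]), fr _ hT]
    obtain ⟨a, ha⟩ := num.left u hu pu su
    omega

end Flip

/-! ### Programs for numbering and checking clusters

Registers: `0` number of vertices, `1` bound `k`, `2` vertex to be inserted, `3` its cut-off
`K = min k n`, `4` size of the label range, `5` number of guesses, `6` success flag, `8` number of
clusters, `10` loop variable, `11` and `12` ends of the queue, `20` to `22` traversal of a list.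
Arrays: `0` and `1` the input lists, `2` sides, `3` present vertices, `4` adjacency matrix,
`5` cluster numbers, `6` flipped vertices, `7` queue, `11` guesses, `12` new sides. -/

namespace Ram

/-- The machine words are large enough. -/
structure Wide (L : ListGraph) (K W : ℕ) : Prop where
  lin : 8 * (L.n + L.off L.n + K + 4) ≤ W
  sq : L.n * L.n + L.n ≤ W

theorem sum_deg (L : ListGraph) (a b n : ℕ) :
    ∑ j ∈ Finset.range n, ((L.nb j).length * a + b) = a * L.off n + b * n := by
  rw [Finset.sum_add_distrib, ← Finset.sum_mul, ListGraph.off]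
  simp only [Finset.sum_const, Finset.card_range, smul_eq_mul]
  ring

theorem index_inj {n u w u' w' : ℕ} (hw : w < n) (hw' : w' < n) :
    u * n + w = u' * n + w' ↔ u = u' ∧ w = w' := by
  constructor
  · intro h
    have h1 : (u * n + w) / n = u := by
      rw [Nat.mul_comm, Nat.mul_add_div (by omega), Nat.div_eq_of_lt hw, Nat.add_zero]
    have h2 : (u' * n + w') / n = u' := by
      rw [Nat.mul_comm, Nat.mul_add_div (by omega), Nat.div_eq_of_lt hw', Nat.add_zero]
    have : u = u' := by rw [← h1, h, h2]
    subst this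
    exact ⟨rfl, by omega⟩
  · rintro ⟨rfl, rfl⟩; rfl

theorem index_le {n u w : ℕ} (hu : u < n) (hw : w < n) : u * n ≤ n * n ∧ u * n + w ≤ n * n + n :=
  have := Nat.mul_le_mul_right n hu.le
  ⟨this, by omega⟩

variable {W K : ℕ} {L : ListGraph}

/-- Write the adjacency matrix into array `4`. -/
def adjProg : Prog :=
  forTo 10 0 (forNbr 10 (.put 4 (.add (.mul (.reg 10) (.reg 0)) (.reg 22)) (.const 1)))

/-- Array `4` holds the adjacency matrix. -/
def HasAdj (L : ListGraph) (s : Store) : Prop :=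
  ∀ u < L.n, ∀ w < L.n, s.arr 4 (u * L.n + w) = if w ∈ L.nb u then 1 else 0

/-- The matrix has `L.n * L.n` cells, but all cells are initially 0 and only the ones are written,
so the time is linear in the length of the lists. -/
theorem wp_adjProg {s : Store} (hW : Wide L K W) (hL : L.Holds s) (h4 : ∀ i, s.arr 4 i = 0) :
    wp W adjProg s fun t s' => t ≤ 40 * (L.n + L.off L.n + 1) ∧ HasAdj L s' := by
  have hl := hW.lin
  refine (wp_forTo L.n (fun j => (L.nb j).length * 30 + 12)
    (fun j s' => ∀ u < L.n, ∀ w < L.n, s'.arr 4 (u * L.n + w) =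
      if u < j ∧ w ∈ L.nb u then 1 else 0) hL.reg (by decide) rfl rfl (by omega) ?_ ?_).mono ?_
  · intro u hu w hw
    simp [h4]
  · intro j s₁ hj hji hI hF
    have hL₁ := hL.frame hF rfl rfl rfl
    refine (wp_forNbr L j 19 (fun l s' => ∀ u < L.n, ∀ w < L.n, s'.arr 4 (u * L.n + w) =
      if u < j ∧ w ∈ L.nb u ∨ u = j ∧ w ∈ l then 1 else 0) hL₁ hj hji (by decide) (by omega)
      rfl rfl rfl rfl rfl (fun l s₁ b h => ⟨h, h, h⟩) ?_ ?_).mono ?_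
    · intro u hu w hw
      rw [hI u hu w hw]
      simp
    · intro l y l' s₂ hl' hI₂ hy hF₂
      have hyn : y < L.n := L.lt (u := j) (by rw [hl']; simp)
      have e0 : s₂.reg 0 = L.n := by rw [hF₂.1 _ rfl, hL₁.reg]
      have e10 : s₂.reg 10 = j := by rw [hF₂.1 _ rfl, hji]
      have hi := index_le hj hyn
      have := hW.sq
      simp only [wp_put, Exp.Fits, Exp.eval, Exp.cost, e0, e10, hy, Store.setCell_arr, if_true]
      refine ⟨by omega, by omega, by omega, fun u hu w hw => ?_⟩
      rw [Function.update_apply, hI₂ u hu w hw]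
      simp only [index_inj hw hyn, List.mem_append, List.mem_singleton]
      by_cases h1 : u = j ∧ w = y
      · simp [h1]
      · have h1' : u = j → ¬ w = y := by tauto
        by_cases h2 : u = j
        · simp [h2, h1' h2]
        · simp [h2]
    · rintro t s₂ ⟨ht, hI₂⟩
      refine ⟨by omega, fun u hu w hw => ?_⟩
      simp only [Store.setReg_arr, hI₂ u hu w hw]
      refine if_congr ?_ rfl rfl
      constructor
      · rintro (h | ⟨rfl, h⟩)
        · exact ⟨by omega, h.2⟩
        · exact ⟨by omega, h⟩
      · rintro ⟨h, h'⟩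
        rcases Nat.lt_succ_iff_lt_or_eq.1 h with h | rfl
        · exact Or.inl ⟨h, h'⟩
        · exact Or.inr ⟨rfl, h'⟩
  · rintro t s' ⟨ht, hI⟩
    refine ⟨?_, fun u hu w hw => by rw [hI u hu w hw]; simp [hu]⟩
    have := sum_deg L 30 20 L.n
    simp only [add_assoc, Nat.reduceAdd] at ht
    omega

/-- Number the clusters: array `3` tells the present vertices, array `a` their sides, array `b`
receives the numbers, and register `8` the number of clusters on side `1`. -/
def clsProg (a b : ℕ) : Prog :=
  .seq (.set 8 (.const 0)) (.seq (forTo 10 0 (.put b (.reg 10) (.const 0)))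
    (forTo 10 0 (.cond (.mul (.lt (.const 0) (.cell 3 (.reg 10))) (.eq (.cell b (.reg 10)) (.const 0)))
      (.seq (.cond (.eq (.cell a (.reg 10)) (.const 1))
          (.seq (.set 8 (.add (.reg 8) (.const 1))) (.set 9 (.mul (.const 2) (.reg 8))))
          (.set 9 (.add (.mul (.const 2) (.reg 10)) (.const 1))))
        (.seq (.put b (.reg 10) (.reg 9))
          (forNbr 10 (.cond (.mul (.lt (.const 0) (.cell 3 (.reg 22)))
              (.eq (.cell a (.reg 22)) (.cell a (.reg 10))))
            (.put b (.reg 22) (.reg 9)) .skip))))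
      .skip)))

theorem clsRun_le (L : ListGraph) (pr sd : ℕ → ℕ) {j : ℕ} (hj : j ≤ L.n) (u : ℕ) :
    (L.clsRun pr sd j).1 u ≤ 2 * L.n ∧ (L.clsRun pr sd j).2 ≤ L.n := by
  obtain ⟨h1, -, -, h4, h5⟩ := L.clsRun_basic pr sd j
  refine ⟨?_, by omega⟩
  by_cases h : (L.clsRun pr sd j).1 u = 0
  · omega
  · by_cases hs : sd u = 1
    · obtain ⟨a, ha⟩ := h4 u h hs
      omega
    · obtain ⟨a, ha⟩ := h5 u h hs
      omega

theorem wp_fill {s : Store} {b i r N : ℕ} (hr : s.reg r = N) (hir : r ≠ i) (hW : N + 1 ≤ W) :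
    wp W (forTo i r (.put b (.reg i) (.const 0))) s fun t s' => t ≤ N * 11 + 6 ∧
      ∀ u, s'.arr b u = if u < N then 0 else s.arr b u := by
  refine (wp_forTo_const N 3 (fun j s' => ∀ u, s'.arr b u = if u < j then 0 else s.arr b u) hr hir
    rfl rfl hW ?_ ?_).mono ?_
  · simp
  · intro j s₁ hj hji hI hF
    simp only [wp_put, Exp.Fits, Exp.eval, Exp.cost, hji, Store.setCell_arr, Store.setReg_arr,
      if_true]
    refine ⟨by omega, by omega, by omega, fun u => ?_⟩
    rw [Function.update_apply, hI]
    split_ifs <;> omega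
  · rintro t s' ⟨ht, hI⟩
    exact ⟨by omega, hI⟩

theorem wp_clsProg {s : Store} {a b : ℕ} {pr sd : ℕ → ℕ} (hW : Wide L K W) (hL : L.Holds s)
    (hpr : s.arr 3 = pr) (hsd : s.arr a = sd) (hab : a ≠ b) (hb0 : b ≠ 0) (hb1 : b ≠ 1)
    (hb3 : b ≠ 3) (hp1 : ∀ u < L.n, pr u ≤ 1) (hs1 : ∀ u < L.n, sd u ≤ 1) :
    wp W (clsProg a b) s fun t s' => t ≤ 100 * (L.n + L.off L.n + 1) ∧
      (∀ u < L.n, s'.arr b u = (L.clsRun pr sd L.n).1 u) ∧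
      s'.reg 8 = (L.clsRun pr sd L.n).2 := by
  have hl := hW.lin
  -- Here the array `b` is a variable, so frame conditions need this fact instead of `rfl`.
  have hwa : ∀ x, b ≠ x → (clsProg a b).wa x = false := by
    intro x hx
    simp [clsProg, forTo, forNbr, Prog.wa, hx]
  unfold clsProg
  rw [wp_seq, wp_set]
  refine ⟨by simp [Exp.Fits], ?_⟩
  refine wp_seq_of (wp_fill (N := L.n) (by simp [Store.setReg_reg, hL.reg]) (by decide)
    (by omega)) ?_
  rintro t₁ s₁ ⟨ht₁, hz⟩ hF₁
  have hF0 : Frame (clsProg a b) s s₁ := by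
    refine ⟨fun x hx => ?_, fun x hx => ?_⟩
    · simp [clsProg, forTo, forNbr, Prog.wr] at hx
      rw [hF₁.1 x (by simp [forTo, Prog.wr]; tauto)]
      simp [Store.setReg_reg]; tauto
    · rw [hF₁.2 x (by simp [clsProg, forTo, forNbr, Prog.wa] at hx ⊢; tauto)]
      rfl
  have hL₁ : L.Holds s₁ := hL.frame hF0 rfl (hwa _ hb0) (hwa _ hb1)
  have h8 : s₁.reg 8 = 0 := by rw [hF₁.1 _ rfl]; simp [Store.setReg_reg, Exp.eval]
  have hpr₁ : s₁.arr 3 = pr := by rw [hF0.2 _ (hwa _ hb3), hpr]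
  have hsd₁ : s₁.arr a = sd := by rw [hF0.2 _ (hwa _ hab.symm), hsd]
  refine (wp_forTo L.n (fun j => (L.nb j).length * 30 + 60)
    (fun j s' => (∀ u < L.n, s'.arr b u = (L.clsRun pr sd j).1 u) ∧
      s'.reg 8 = (L.clsRun pr sd j).2) hL₁.reg (by decide) rfl rfl (by omega) ?_ ?_).mono ?_
  · refine ⟨fun u hu => ?_, ?_⟩
    · simp [hz, hu, ListGraph.clsRun]
    · simpa [Store.setReg_reg, ListGraph.clsRun] using h8
  · intro j s₂ hj hji ⟨hI, hI8⟩ hF₂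
    have hwa2 : ∀ x, b ≠ x → s₂.arr x = s₁.arr x := by
      intro x hx
      exact hF₂.2 x (by simp [forTo, forNbr, Prog.wa, hx])
    have hL₂ : L.Holds s₂ := hL₁.congr (hF₂.1 _ rfl) (hwa2 _ hb0) (hwa2 _ hb1)
    have hpr₂ : s₂.arr 3 = pr := by rw [hwa2 _ hb3, hpr₁]
    have hsd₂ : s₂.arr a = sd := by rw [hwa2 _ hab.symm, hsd₁]
    have hle := fun u => clsRun_le L pr sd hj.le u
    have hpj := hp1 j hj
    have hsj := hs1 j hj
    have hcj := hle j
    rw [wp_cond]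
    simp only [Exp.Fits, Exp.eval, Exp.cost, hji, hpr₂, hI j hj]
    set st := L.clsRun pr sd j with hst
    refine ⟨by split_ifs <;> omega, fun hc => ?_, fun hc => ?_⟩
    swap
    · have hstep : L.clsRun pr sd (j + 1) = st := by
        rw [ListGraph.clsRun, ListGraph.clsStep, if_neg]
        rintro ⟨h1, h2⟩
        rw [if_pos (by omega), if_pos h2] at hc
        omega
      simp only [wp_skip, Store.setReg_arr, Store.setReg_reg, hstep]
      exact ⟨by omega, hI, by simpa using hI8⟩
    have hc1 : pr j ≠ 0 ∧ st.1 j = 0 := by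
      split_ifs at hc <;> omega
    have hstep : L.clsRun pr sd (j + 1) = (fun w => if w = j ∨ (w ∈ L.nb j ∧ pr w ≠ 0 ∧ sd w = sd j)
      then (if sd j = 1 then 2 * (st.2 + 1) else 2 * j + 1) else st.1 w,
      if sd j = 1 then st.2 + 1 else st.2) := by
        rw [ListGraph.clsRun, ListGraph.clsStep, if_pos hc1]
    set id := if sd j = 1 then 2 * (st.2 + 1) else 2 * j + 1 with hid
    set cA := if sd j = 1 then st.2 + 1 else st.2 with hcA
    have hidle : id ≤ 2 * L.n + 2 := by rw [hid]; split_ifs <;> omega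
    refine wp_seq_of (Q' := fun t s₃ => t ≤ 20 ∧ s₃.reg 8 = cA ∧ s₃.reg 9 = id) ?_ ?_
    · rw [wp_cond]
      simp only [wp_seq, wp_set, Exp.Fits, Exp.eval, Exp.cost, Store.setReg_reg, hji, hsd₂, hI8]
      refine ⟨by omega, fun h => ?_, fun h => ?_⟩
      · have h1 : sd j = 1 := by split_ifs at h <;> omega
        simp only [hid, hcA, h1, if_true]
        refine ⟨by omega, by omega, by omega, by simp, by simp⟩
      · have h1 : sd j ≠ 1 := fun h' => by rw [if_pos h'] at h; omega
        simp only [hid, hcA, h1, if_false]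
        refine ⟨by omega, by omega, by simp, by simp⟩
    rintro t₃ s₃ ⟨ht₃, h8₃, h9₃⟩ hF₃
    have ha₃ : ∀ x, s₃.arr x = s₂.arr x := fun x => hF₃.2 x rfl
    have hji₃ : s₃.reg 10 = j := by rw [hF₃.1 _ rfl, hji]
    rw [wp_seq, wp_put]
    simp only [Exp.Fits, Exp.eval, Exp.cost, hji₃, h9₃]
    refine ⟨by omega, by omega, ?_⟩
    have hL₄ : L.Holds (s₃.setCell b j id) := by
      refine hL₂.congr ?_ ?_ ?_
      · simp [hF₃.1 0 rfl]
      · simp [Store.setCell_arr, Ne.symm hb0, ha₃]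
      · simp [Store.setCell_arr, Ne.symm hb1, ha₃]
    refine (wp_forNbr L j 16 (fun l s' => (∀ u < L.n, s'.arr b u =
      if u = j ∨ (u ∈ l ∧ pr u ≠ 0 ∧ sd u = sd j) then id else st.1 u)) hL₄ hj
      (by simp [hji₃]) (by decide) (by omega)
      rfl rfl rfl (by simp [Prog.wa, hb0]) (by simp [Prog.wa, hb1])
      (fun l s₁ b h => ⟨h, h, h⟩) ?_ ?_).frame.mono ?_
    · intro u hu
      simp [Store.setCell_arr, Function.update_apply, ha₃, hI u hu]
    · intro l y l' s₅ hl' hI₅ hy hF₅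
      have hyn : y < L.n := L.lt (u := j) (by rw [hl']; simp)
      have hwa5 : ∀ x, b ≠ x → s₅.arr x = s₂.arr x := by
        intro x hx
        rw [hF₅.2 x (by simp [forNbr, Prog.wa, hx])]
        simp [Store.setCell_arr, Ne.symm hx, ha₃]
      have e3 : s₅.arr 3 = pr := by rw [hwa5 _ hb3, hpr₂]
      have ea : s₅.arr a = sd := by rw [hwa5 _ hab.symm, hsd₂]
      have e9 : s₅.reg 9 = id := by rw [hF₅.1 _ rfl]; simpa using h9₃
      have e10 : s₅.reg 10 = j := by rw [hF₅.1 _ rfl]; simpa using hji₃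
      have hpy := hp1 y hyn
      have hsy := hs1 y hyn
      rw [wp_cond]
      simp only [wp_put, wp_skip, Exp.Fits, Exp.eval, Exp.cost, e3, ea, e9, e10, hy,
        Store.setCell_arr, if_true]
      refine ⟨by split_ifs <;> omega, fun h => ⟨by omega, by omega, by omega, fun u hu => ?_⟩,
        fun h => ⟨by omega, fun u hu => ?_⟩⟩
      · have h1 : pr y ≠ 0 ∧ sd y = sd j := by split_ifs at h <;> omega
        rw [Function.update_apply, hI₅ u hu]
        by_cases huy : u = y
        · subst huy; simp [h1]
        · simp [huy]
      · have h1 : ¬ (pr y ≠ 0 ∧ sd y = sd j) := by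
          rintro ⟨h1, h2⟩
          rw [if_pos (by omega), if_pos h2] at h
          omega
        rw [hI₅ u hu]
        by_cases huy : u = y
        · subst huy; simp [h1]
        · simp [huy]
    · rintro t₅ s₅ ⟨⟨ht₅, hI₅⟩, hF₅⟩
      refine ⟨by omega, fun u hu => ?_, ?_⟩
      · simp only [Store.setReg_arr, hI₅ u hu, hstep]
      · simp only [Store.setReg_reg, hstep]
        rw [if_neg (by decide), hF₅.1 _ rfl]
        simpa using h8₃
  · rintro t s' ⟨ht, hI⟩
    refine ⟨?_, hI⟩
    have := sum_deg L 30 68 L.n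
    simp only [add_assoc, Nat.reduceAdd] at ht
    simp only [Exp.cost]
    omega

/-- Test whether the vertex in register `10` has the right neighbors on its side. -/
def checkVertex : Prog :=
  .seq (.set 19 (.const 1))
    (.seq (forNbr 10 (.cond (.mul (.cell 3 (.reg 22)) (.eq (.cell 12 (.reg 22)) (.cell 12 (.reg 10))))
        (.seq (.set 19 (.add (.reg 19) (.const 1)))
          (.cond (.eq (.cell 13 (.reg 22)) (.cell 13 (.reg 10))) .skip (.set 6 (.const 0))))
        .skip))
      (.cond (.eq (.reg 19) (.cell 14 (.cell 13 (.reg 10)))) .skip (.set 6 (.const 0))))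

theorem wp_checkVertex {s : Store} {pr sd c : ℕ → ℕ} {j N : ℕ} (hW : Wide L K W) (hL : L.Holds s)
    (hj : j < L.n) (hji : s.reg 10 = j) (hpr : s.arr 3 = pr) (hsd : s.arr 12 = sd)
    (hp1 : ∀ u < L.n, pr u ≤ 1) (hs1 : ∀ u < L.n, sd u ≤ 1) (hc : ∀ u < L.n, s.arr 13 u = c u)
    (hcn : ∀ u < L.n, c u ≤ 2 * L.n) (hN : s.arr 14 (c j) = N) (hNn : N ≤ L.n)
    (h6 : s.reg 6 ≤ 1) :
    wp W checkVertex s fun t s' => t ≤ (L.nb j).length * 40 + 30 ∧ s'.reg 6 ≤ 1 ∧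
      (s'.reg 6 = 1 ↔ s.reg 6 = 1 ∧ (∀ y ∈ L.nb j, pr y ≠ 0 ∧ sd y = sd j → c y = c j) ∧
        1 + (L.nb j).countP (fun y => decide (pr y ≠ 0 ∧ sd y = sd j)) = N) := by
  have hl := hW.lin
  have hlen : ∀ l l', L.nb j = l ++ l' →
      l.countP (fun y => decide (pr y ≠ 0 ∧ sd y = sd j)) ≤ L.off L.n := by
    intro l l' h
    have h1 := List.countP_le_length (l := l) (p := fun y => decide (pr y ≠ 0 ∧ sd y = sd j))
    have h2 : l.length ≤ (L.nb j).length := by rw [h]; simp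
    have h3 := L.off_succ j
    have h4 := L.off_le (show j + 1 ≤ L.n from hj)
    omega
  unfold checkVertex
  rw [wp_seq, wp_set]
  simp only [Exp.Fits, Exp.eval, Exp.cost]
  refine ⟨by omega, ?_⟩
  have hL₁ : L.Holds (s.setReg 19 1) := hL.congr (by simp [Store.setReg_reg]) rfl rfl
  refine wp_seq_of (wp_forNbr L j 29 (fun l s' => s'.reg 19 =
      1 + l.countP (fun y => decide (pr y ≠ 0 ∧ sd y = sd j)) ∧ s'.reg 6 ≤ 1 ∧
      (s'.reg 6 = 1 ↔ s.reg 6 = 1 ∧ ∀ y ∈ l, pr y ≠ 0 ∧ sd y = sd j → c y = c j))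
      hL₁ hj (by simpa [Store.setReg_reg] using hji) (by decide) (by omega)
      rfl rfl rfl rfl rfl (fun l s₁ b h => ⟨h, h, h⟩) ?_ ?_) ?_
  · simpa [Store.setReg_reg] using h6
  · rintro l y l' s₂ hl' ⟨h19, h6, h6'⟩ hy hF₂
    have hyn : y < L.n := L.lt (u := j) (by rw [hl']; simp)
    have ha : ∀ x, s₂.arr x = s.arr x := fun x => hF₂.2 x rfl
    have e10 : s₂.reg 10 = j := by rw [hF₂.1 _ rfl]; simpa [Store.setReg_reg] using hji
    have hpy := hp1 y hyn
    have hsy := hs1 y hyn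
    have hsj := hs1 j hj
    have hcy := hcn y hyn
    have hcj := hcn j hj
    have hlen := hlen l _ hl'
    have hle : (pr y * if sd y = sd j then 1 else 0) ≤ 1 := by split_ifs <;> omega
    rw [wp_cond]
    simp only [wp_seq, wp_set, wp_cond, wp_skip, Exp.Fits, Exp.eval, Exp.cost, ha, hpr, hsd,
      e10, hy, Store.setReg_reg, Store.setReg_arr, h19, reduceIte, Nat.reduceEqDiff, hc y hyn,
      hc j hj]
    refine ⟨by omega, fun h => ?_, fun h => ?_⟩
    · have h1 : pr y ≠ 0 ∧ sd y = sd j := by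
        by_cases e : sd y = sd j <;> simp_all
      have hcount : (l ++ [y]).countP (fun y => decide (pr y ≠ 0 ∧ sd y = sd j)) =
          l.countP (fun y => decide (pr y ≠ 0 ∧ sd y = sd j)) + 1 := by
        simp [h1]
      rw [hcount]
      refine ⟨by omega, by omega, fun h2 => ?_, fun h2 => ?_⟩
      · have h2' : c y = c j := by
          by_contra h3
          exact h2 (if_neg h3)
        refine ⟨by omega, by omega, h6, ?_⟩
        rw [h6']
        simp [or_imp, forall_and, h2']
      · have h2' : c y ≠ c j := by
          intro h3
          rw [if_pos h3] at h2
          omega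
        refine ⟨by omega, by omega, by omega, by omega, ?_⟩
        simp [or_imp, forall_and, h2', h1]
    · have h1 : ¬ (pr y ≠ 0 ∧ sd y = sd j) := by
        rintro ⟨h1, h2⟩
        rw [if_pos h2] at h
        omega
      have hcount : (l ++ [y]).countP (fun y => decide (pr y ≠ 0 ∧ sd y = sd j)) =
          l.countP (fun y => decide (pr y ≠ 0 ∧ sd y = sd j)) := by
        rw [List.countP_append, List.countP_singleton, if_neg (by simpa using h1), Nat.add_zero]
      rw [hcount, h6']
      refine ⟨by omega, rfl, h6, and_congr Iff.rfl ?_⟩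
      simp only [List.mem_append, List.mem_singleton, or_imp, forall_and, forall_eq]
      exact ⟨fun H => ⟨H, fun h => absurd h h1⟩, And.left⟩
  · rintro t₂ s₂ ⟨ht₂, h19, h6, h6'⟩ hF₂
    have ha : ∀ x, s₂.arr x = s.arr x := fun x => hF₂.2 x rfl
    have e10 : s₂.reg 10 = j := by rw [hF₂.1 _ rfl]; simpa [Store.setReg_reg] using hji
    have hcj := hcn j hj
    have hlen := hlen (L.nb j) [] (by simp)
    simp only [wp_set, wp_cond, wp_skip, Exp.Fits, Exp.eval, Exp.cost, ha, hc j hj, e10,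
      Store.setReg_reg, h19, hN, reduceIte]
    set d := (L.nb j).countP (fun y => decide (pr y ≠ 0 ∧ sd y = sd j))
    refine ⟨by omega, fun h2 => ?_, fun h2 => ?_⟩
    · have h2' : 1 + d = N := by
        by_contra h3
        exact h2 (if_neg h3)
      refine ⟨by omega, h6, ?_⟩
      rw [h6']
      tauto
    · have h2' : 1 + d ≠ N := by
        intro h3
        rw [if_pos h3] at h2
        omega
      refine ⟨by omega, by omega, by omega, ?_⟩
      simp [h2']

/-- Test whether the sides in array `12` are a 2-subcoloring of the present vertices with at most
`K` clusters on side `1`; the result goes into register `6`. -/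
def checkProg : Prog :=
  .seq (clsProg 12 13) (.seq (forTo 10 4 (.put 14 (.reg 10) (.const 0)))
    (.seq (forTo 10 0 (.cond (.cell 3 (.reg 10))
        (.put 14 (.cell 13 (.reg 10)) (.add (.cell 14 (.cell 13 (.reg 10))) (.const 1))) .skip))
      (.seq (.set 6 (.lt (.reg 8) (.add (.reg 3) (.const 1))))
        (forTo 10 0 (.cond (.cell 3 (.reg 10)) checkVertex .skip)))))

/-- Linear time comes from counting: array `14` accumulates the size of each class of numbers, so no
pair of vertices has to be compared beyond the edges. -/
theorem wp_checkProg {s : Store} {pr sd : ℕ → ℕ} (hW : Wide L K W) (hL : L.Holds s)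
    (h3 : s.reg 3 = K) (h4 : s.reg 4 = 2 * L.n + 7)
    (hpr : s.arr 3 = pr) (hsd : s.arr 12 = sd) (hp1 : ∀ u < L.n, pr u ≤ 1)
    (hs1 : ∀ u < L.n, sd u ≤ 1) :
    wp W checkProg s fun t s' => t ≤ 300 * (L.n + L.off L.n + 1) ∧ s'.reg 6 ≤ 1 ∧
      (s'.reg 6 = 1 ↔ L.Check pr sd K) := by
  have hl := hW.lin
  unfold checkProg
  refine wp_seq_of (wp_clsProg hW hL hpr hsd (by decide) (by decide) (by decide) (by decide)
    hp1 hs1) ?_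
  rintro t₁ s₁ ⟨ht₁, hc₁, h8₁⟩ hF₁
  have hL₁ : L.Holds s₁ := hL.frame hF₁ rfl rfl rfl
  have hle := fun u => clsRun_le L pr sd le_rfl u
  set c := L.clsRun pr sd L.n with hc
  have h4₁ : s₁.reg 4 = 2 * L.n + 7 := by rw [hF₁.1 _ rfl, h4]
  refine wp_seq_of (wp_fill (N := 2 * L.n + 7) h4₁ (by decide) (by omega)) ?_
  rintro t₂ s₂ ⟨ht₂, hz₂⟩ hF₂
  have hL₂ : L.Holds s₂ := hL₁.frame hF₂ rfl rfl rfl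
  have hpr₂ : s₂.arr 3 = pr := by rw [hF₂.2 _ rfl, hF₁.2 _ rfl, hpr]
  have h13₂ : s₂.arr 13 = s₁.arr 13 := hF₂.2 _ rfl
  refine wp_seq_of (wp_forTo_const L.n 15 (fun j s' => ∀ i < 2 * L.n + 7, s'.arr 14 i =
      (List.range j).countP (fun w => decide (pr w ≠ 0 ∧ c.1 w = i))) hL₂.reg (by decide) rfl rfl
      (by omega) ?_ ?_) ?_
  · intro i hi
    simp [hz₂, hi]
  · intro j s₃ hj hji hI hF₃
    have e3 : s₃.arr 3 = pr := by rw [hF₃.2 _ rfl, hpr₂]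
    have e13 : s₃.arr 13 j = c.1 j := by rw [hF₃.2 _ rfl, h13₂, hc₁ j hj]
    have hcj := hle j
    have hcount : (List.range j).countP (fun w => decide (pr w ≠ 0 ∧ c.1 w = c.1 j)) ≤ j := by
      simpa using List.countP_le_length (l := List.range j)
        (p := fun w => decide (pr w ≠ 0 ∧ c.1 w = c.1 j))
    have hpj := hp1 j hj
    rw [wp_cond]
    simp only [wp_put, wp_skip, Exp.Fits, Exp.eval, Exp.cost, e3, e13, hji, hI (c.1 j) (by omega)]
    refine ⟨by omega, fun h => ⟨by omega, by omega, by omega, fun i hi => ?_⟩,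
      fun h => ⟨by omega, fun i hi => ?_⟩⟩
    · simp only [Store.setReg_arr, Store.setCell_arr, if_true, Function.update_apply,
        List.range_succ, List.countP_append, hI i hi]
      by_cases hic : i = c.1 j
      · subst hic
        simp [h]
      · simp [hic, Ne.symm hic]
    · simp only [Store.setReg_arr, List.range_succ, List.countP_append, hI i hi]
      simp [h]
  rintro t₃ s₃ ⟨ht₃, hI₃⟩ hF₃
  have e8 : s₃.reg 8 = c.2 := by rw [hF₃.1 _ rfl, hF₂.1 _ rfl, h8₁]
  have e3 : s₃.reg 3 = K := by rw [hF₃.1 _ rfl, hF₂.1 _ rfl, hF₁.1 _ rfl, h3]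
  rw [wp_seq, wp_set]
  simp only [Exp.Fits, Exp.eval, Exp.cost, e8, e3]
  have hc0 := hle 0
  refine ⟨by omega, ?_⟩
  have hL₄ : L.Holds (s₃.setReg 6 (if c.2 < K + 1 then 1 else 0)) :=
    hL₂.congr (by simp [Store.setReg_reg, hF₃.1 0 rfl]) (hF₃.2 _ rfl) (hF₃.2 _ rfl)
  have hpr₄ : s₃.arr 3 = pr := by rw [hF₃.2 _ rfl, hpr₂]
  have hsd₄ : s₃.arr 12 = sd := by rw [hF₃.2 _ rfl, hF₂.2 _ rfl, hF₁.2 _ rfl, hsd]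
  have h13₄ : ∀ u < L.n, s₃.arr 13 u = c.1 u := by
    intro u hu
    rw [hF₃.2 _ rfl, h13₂, hc₁ u hu]
  let T : ℕ → Prop := fun u => pr u ≠ 0 →
    (∀ y ∈ L.nb u, pr y ≠ 0 ∧ sd y = sd u → c.1 y = c.1 u) ∧
    1 + (L.nb u).countP (fun y => decide (pr y ≠ 0 ∧ sd y = sd u)) =
      (List.range L.n).countP (fun w => decide (pr w ≠ 0 ∧ c.1 w = c.1 u))
  refine (wp_forTo L.n (fun j => (L.nb j).length * 40 + 50)
    (fun j s' => s'.reg 6 ≤ 1 ∧ (s'.reg 6 = 1 ↔ c.2 ≤ K ∧ ∀ u < j, T u)) hL₄.reg (by decide) rfl rfl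
    (by omega) ?_ ?_).mono ?_
  · simp only [Store.setReg_reg, reduceIte, Nat.reduceEqDiff]
    constructor
    · split_ifs <;> omega
    · split_ifs with h <;> simp <;> omega
  · intro j s₅ hj hji ⟨hI₅, hI₅'⟩ hF₅
    have hL₅ : L.Holds s₅ := hL₄.frame hF₅ rfl rfl rfl
    have ha : ∀ x, s₅.arr x = s₃.arr x := fun x => hF₅.2 x rfl
    have hpj := hp1 j hj
    have hcj := hle j
    have hT : (∀ u < j + 1, T u) ↔ (∀ u < j, T u) ∧ T j :=
      ⟨fun H => ⟨fun u hu => H u (by omega), H j (by omega)⟩, fun H u hu => by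
        rcases Nat.lt_succ_iff_lt_or_eq.1 hu with h' | rfl
        · exact H.1 u h'
        · exact H.2⟩
    rw [wp_cond]
    simp only [Exp.Fits, Exp.eval, Exp.cost, hji, ha, hpr₄, hT]
    refine ⟨by omega, fun h => ?_, fun h => ?_⟩
    · refine (wp_checkVertex (c := c.1) hW hL₅ hj hji (by rw [ha, hpr₄]) (by rw [ha, hsd₄]) hp1 hs1
        (fun u hu => by rw [ha, h13₄ u hu]) (fun u _ => (hle u).1)
        (by rw [ha, hI₃ _ (by omega)]) ?_ hI₅).mono ?_
      · simpa using List.countP_le_length (l := List.range L.n)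
          (p := fun w => decide (pr w ≠ 0 ∧ c.1 w = c.1 j))
      · rintro t s' ⟨ht, h6, h6'⟩
        refine ⟨by omega, h6, ?_⟩
        have hTj : T j ↔ _ := ⟨fun H => H h, fun H _ => H⟩
        rw [hTj, ← and_assoc, ← hI₅']
        exact h6'
    · rw [wp_skip]
      refine ⟨by omega, hI₅, ?_⟩
      have hTj : T j := fun hp => absurd h hp
      simp only [hTj, and_true]
      exact hI₅'
  · rintro t s' ⟨ht, hI, hI'⟩
    refine ⟨?_, hI, ?_⟩
    · have := sum_deg L 40 58 L.n
      simp only [add_assoc, Nat.reduceAdd] at ht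
      omega
    · rw [hI']
      constructor
      · rintro ⟨h1, h2⟩
        exact ⟨fun u hu hp => (h2 u hu hp).1, fun u hu hp => (h2 u hu hp).2, h1⟩
      · rintro ⟨h1, h2, h3⟩
        exact ⟨h3, fun u hu hp => ⟨h1 u hu hp, h2 u hu hp⟩⟩

end Ram

/-! ### Programs for the propagation -/

namespace Ram

open Flip

variable {W K : ℕ} {L : ListGraph}

theorem length_le_of_nodup {q : List ℕ} {n : ℕ} (h : q.Nodup) (h' : ∀ y ∈ q, y < n) :
    q.length ≤ n := by
  have := Finset.card_le_card (s := q.toFinset) (t := Finset.range n) (by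
    intro y hy
    simpa using h' y (by simpa using hy))
  rwa [List.toFinset_card_of_nodup h, Finset.card_range] at this

/-- The arrays and registers that do not change during the propagation. -/
structure Static (L : ListGraph) (K : ℕ) (pr sd cls dig : ℕ → ℕ) (s : Store) : Prop where
  holds : L.Holds s
  adj : HasAdj L s
  arr3 : s.arr 3 = pr
  arr2 : s.arr 2 = sd
  arr5 : s.arr 5 = cls
  arr11 : s.arr 11 = dig
  pr_le : ∀ u < L.n, pr u ≤ 1
  sd_le : ∀ u < L.n, sd u ≤ 1
  cls_le : ∀ u < L.n, cls u ≤ 2 * L.n + 1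
  dig_le : ∀ i, dig i ≤ K + 2

theorem Static.frame {pr sd cls dig : ℕ → ℕ} {s s' : Store} {p : Prog}
    (h : Static L K pr sd cls dig s) (hF : Frame p s s') (h0 : p.wr 0 = false)
    (a0 : p.wa 0 = false) (a1 : p.wa 1 = false) (a2 : p.wa 2 = false) (a3 : p.wa 3 = false)
    (a4 : p.wa 4 = false) (a5 : p.wa 5 = false) (a11 : p.wa 11 = false) :
    Static L K pr sd cls dig s' where
  holds := h.holds.frame hF h0 a0 a1
  adj := by rw [HasAdj, hF.2 _ a4]; exact h.adj
  arr3 := by rw [hF.2 _ a3, h.arr3]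
  arr2 := by rw [hF.2 _ a2, h.arr2]
  arr5 := by rw [hF.2 _ a5, h.arr5]
  arr11 := by rw [hF.2 _ a11, h.arr11]
  pr_le := h.pr_le
  sd_le := h.sd_le
  cls_le := h.cls_le
  dig_le := h.dig_le

theorem Static.setReg {pr sd cls dig : ℕ → ℕ} {s : Store} {x a : ℕ}
    (h : Static L K pr sd cls dig s) (hx : x ≠ 0) : Static L K pr sd cls dig (s.setReg x a) :=
  h.frame (p := .set x (.const 0)) ⟨fun y hy => by
    simp [Prog.wr] at hy
    simp [Store.setReg_reg, Ne.symm hy], fun _ _ => rfl⟩ (by simp [Prog.wr, hx]) rfl rfl rfl rfl rfl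
    rfl rfl

/-- Array `7` holds the queue, register `12` its length, and array `6` the flipped vertices. -/
structure HasQueue (L : ListGraph) (q : List ℕ) (s : Store) : Prop where
  get : ∀ i (h : i < q.length), s.arr 7 i = q[i]
  len : s.reg 12 = q.length
  mem : ∀ u < L.n, s.arr 6 u = if u ∈ q then 1 else 0

theorem HasQueue.frame {q : List ℕ} {s s' : Store} {p : Prog} (h : HasQueue L q s)
    (hF : Frame p s s') (h0 : p.wr 12 = false) (a6 : p.wa 6 = false) (a7 : p.wa 7 = false) :
    HasQueue L q s' :=
  ⟨by rw [hF.2 _ a7]; exact h.get, by rw [hF.1 _ h0]; exact h.len, by rw [hF.2 _ a6]; exact h.mem⟩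

/-- Move the vertex in register `22` if the vertex in register `14` with the label in register
`15` forces this. -/
def testProg : Prog :=
  .cond (.mul (.cell 3 (.reg 22)) (.mul (.eq (.eq (.cell 2 (.reg 22)) (.cell 2 (.reg 14))) (.const 0))
      (.mul (.eq (.cell 6 (.reg 22)) (.const 0))
        (.eq (.eq (.cell 4 (.add (.mul (.reg 14) (.reg 0)) (.reg 22)))
          (.eq (.cell 5 (.reg 22)) (.reg 15))) (.const 0)))))
    (.seq (.put 6 (.reg 22) (.const 1)) (.seq (.put 7 (.reg 12) (.reg 22))
      (.set 12 (.add (.reg 12) (.const 1))))) .skip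

theorem wp_testProg {pr sd cls dig : ℕ → ℕ} {s : Store} {q : List ℕ} {x t y : ℕ} (hW : Wide L K W)
    (hS : Static L K pr sd cls dig s) (hq : HasQueue L q s) (hql : q.length ≤ L.n)
    (hx : x < L.n) (hy : y < L.n) (ht : t ≤ 2 * (L.n + K) + 7)
    (r14 : s.reg 14 = x) (r15 : s.reg 15 = t) (r22 : s.reg 22 = y) :
    wp W testProg s fun T s' => T ≤ 60 ∧
      HasQueue L (if viol L pr sd cls x t q y then q ++ [y] else q) s' := by
  have hl := hW.lin
  have hsq := hW.sq
  have hi := index_le hx hy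
  have := hS.pr_le y hy
  have := hS.sd_le y hy
  have := hS.sd_le x hx
  have := hS.cls_le y hy
  have e1 : ∀ p : Prop, [Decidable p] → (if p then 1 else 0) ≤ 1 := by intro p _; split_ifs <;> omega
  have e2 : ∀ a b, a ≤ 1 → b ≤ 1 → a * b ≤ 1 := fun a b h h' => Nat.mul_le_mul h h'
  unfold testProg
  rw [wp_cond]
  simp only [Exp.Fits, Exp.eval, Exp.cost, r14, r15, r22, hS.arr3, hS.arr2, hS.arr5, hq.mem y hy,
    hS.adj x hx y hy, hS.holds.reg, wp_seq, wp_put, wp_set, wp_skip,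
    Store.setCell_reg, hq.len]
  -- Products of 0/1 values act as conjunction, comparison with 0 as negation, and equality of two
  -- indicators as equivalence.
  have hviol : (pr y * ((if (if sd y = sd x then 1 else 0) = 0 then 1 else 0) *
      ((if (if y ∈ q then 1 else 0) = 0 then 1 else 0) *
        if (if (if y ∈ L.nb x then 1 else 0) = if cls y = t then 1 else 0 then 1 else 0) = 0 then 1
        else 0)) ≠ 0) ↔ viol L pr sd cls x t q y = true := by
    simp only [viol, decide_eq_true_eq, mul_ne_zero_iff]
    by_cases h1 : sd y = sd x <;> by_cases h2 : y ∈ q <;> by_cases h3 : y ∈ L.nb x <;>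
      by_cases h4 : cls y = t <;> simp [h1, h2, h3, h4]
  refine ⟨?_, fun h => ?_, fun h => ?_⟩
  · have b1 := e1 ((if sd y = sd x then 1 else 0) = 0)
    have b2 := e1 ((if y ∈ q then 1 else 0) = 0)
    have b3 := e1 ((if (if y ∈ L.nb x then 1 else 0) = if cls y = t then 1 else 0 then 1 else 0) = 0)
    have b4 := e1 (y ∈ q)
    have b5 := e1 (y ∈ L.nb x)
    have b6 := e2 _ _ b2 b3
    have b7 := e2 _ _ b1 b6
    have b8 := e2 _ _ (hS.pr_le y hy) b7
    omega
  · rw [if_pos (hviol.1 h)]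
    refine ⟨by omega, by omega, by omega, by omega, by omega, by omega, ?_, ?_, ?_⟩
    · intro i hi
      simp only [Store.setReg_arr, Store.setCell_arr, Nat.reduceEqDiff, reduceIte, Function.update_apply]
      by_cases h1 : i = q.length
      · subst h1; simp
      · have h2 : i < q.length := by simp at hi; omega
        rw [if_neg h1, hq.get i h2, List.getElem_append_left h2]
    · simp [Store.setReg_reg]
    · intro u hu
      simp only [Store.setReg_arr, Store.setCell_arr, Nat.reduceEqDiff, reduceIte, Function.update_apply,
        hq.mem u hu, List.mem_append, List.mem_singleton]
      by_cases h1 : u = y <;> simp [h1]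
  · rw [if_neg (fun h' => hviol.2 h' h)]
    exact ⟨by omega, hq⟩

/-- Move the vertices of the closed neighborhood of the vertex in register `18` for which this is
forced. -/
def scanProg : Prog := .seq (forNbr 18 testProg) (.seq (.set 22 (.reg 18)) testProg)

/-- The queue grows during the scan, but the test of `y` asks only whether `y` itself is queued.
Since the scanned vertices are distinct, testing one after the other agrees with filtering by the
initial queue. -/
theorem filter_viol_append {pr sd cls : ℕ → ℕ} {x t y : ℕ} {q l : List ℕ} (h : (l ++ [y]).Nodup) :
    (if viol L pr sd cls x t (q ++ l.filter (viol L pr sd cls x t q)) y then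
      (q ++ l.filter (viol L pr sd cls x t q)) ++ [y] else q ++ l.filter (viol L pr sd cls x t q)) =
    q ++ (l ++ [y]).filter (viol L pr sd cls x t q) := by
  have hy : y ∉ l := by
    rw [List.nodup_append] at h
    exact fun h' => h.2.2 y h' y (by simp) rfl
  have : viol L pr sd cls x t (q ++ l.filter (viol L pr sd cls x t q)) y =
      viol L pr sd cls x t q y := by
    simp [viol, hy]
  rw [this, List.filter_append]
  by_cases h' : viol L pr sd cls x t q y <;> simp [h']

theorem wp_scanProg {pr sd cls dig : ℕ → ℕ} {s : Store} {q : List ℕ} {x t z : ℕ} (hW : Wide L K W)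
    (hS : Static L K pr sd cls dig s) (hq : HasQueue L q s) (hqn : q.Nodup)
    (hlt : ∀ y ∈ q, y < L.n) (hx : x < L.n) (hz : z < L.n) (ht : t ≤ 2 * (L.n + K) + 7)
    (r14 : s.reg 14 = x) (r15 : s.reg 15 = t) (r18 : s.reg 18 = z) :
    wp W scanProg s fun T s' => T ≤ (L.nb z).length * 80 + 80 ∧
      HasQueue L (scan L pr sd cls x t z q) s' := by
  have hl := hW.lin
  -- Every intermediate queue is a sublist of the final one, which consists of distinct vertices.
  have hlen : ∀ l, l <+: L.nb z ++ [z] →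
      (q ++ l.filter (viol L pr sd cls x t q)).length ≤ L.n := by
    intro l hl'
    refine (List.Sublist.length_le ?_).trans (length_le_of_nodup
      (nodup_scan (L := L) (pr := pr) (sd := sd) (cls := cls) (x := x) (t := t) (z := z) hqn)
      (lt_scan hz hlt))
    exact List.Sublist.append (List.Sublist.refl _) (hl'.sublist.filter _)
  unfold scanProg
  refine wp_seq_of (wp_forNbr L z 60 (fun l s' => HasQueue L (q ++ l.filter (viol L pr sd cls x t q)) s')
    hS.holds hz r18 (by decide) (by omega) rfl rfl rfl rfl rfl
    (fun l s₁ b h => ⟨⟨h.1, h.2, h.3⟩, ⟨h.1, h.2, h.3⟩, ⟨h.1, h.2, h.3⟩⟩) (by simpa using hq) ?_) ?_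
  · intro l y l' s₂ hl' hI hy hF
    have hyn : y < L.n := L.lt (u := z) (by rw [hl']; simp)
    have hS₂ := hS.frame hF rfl rfl rfl rfl rfl rfl rfl rfl
    have hnd : (l ++ [y]).Nodup := by
      have := L.nodup z
      rw [hl', List.append_cons] at this
      exact (List.nodup_append.1 this).1
    refine (wp_testProg (q := q ++ l.filter (viol L pr sd cls x t q)) hW hS₂ hI
      (hlen l ⟨y :: l' ++ [z], by rw [hl']; simp⟩) hx hyn ht
      (by rw [hF.1 _ rfl, r14]) (by rw [hF.1 _ rfl, r15]) hy).mono ?_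
    rintro T s' ⟨hT, hI'⟩
    rw [filter_viol_append hnd] at hI'
    exact ⟨hT, hI'⟩
  · rintro T₁ s₁ ⟨hT₁, hI⟩ hF
    have hS₁ := hS.frame hF rfl rfl rfl rfl rfl rfl rfl rfl
    have e18 : s₁.reg 18 = z := by rw [hF.1 _ rfl, r18]
    rw [wp_seq, wp_set]
    simp only [Exp.Fits, Exp.eval, Exp.cost, e18]
    refine ⟨by omega, ?_⟩
    refine (wp_testProg (q := q ++ (L.nb z).filter (viol L pr sd cls x t q)) (y := z) hW
      (hS₁.setReg (by decide)) ⟨hI.1, by simpa [Store.setReg_reg] using hI.2, hI.3⟩ (hlen _ (List.prefix_append _ _)) hx hz ht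
      (by simp [Store.setReg_reg, hF.1 14 rfl, r14]) (by simp [Store.setReg_reg, hF.1 15 rfl, r15])
      (by simp [Store.setReg_reg])).mono ?_
    rintro T s' ⟨hT, hI'⟩
    rw [filter_viol_append (nodup_closed z)] at hI'
    exact ⟨by omega, hI'⟩

end Ram

/-! ### Determining labels from guesses -/

namespace Ram

open Flip

variable {W K : ℕ} {L : ListGraph}

/-- Write the cluster with the index given in register `16` among the clusters on side `0` adjacent
to the vertex in register `14` into register `15`. -/
def classScan : Prog :=
  .seq (.set 15 (.const 0)) (.seq (.set 17 (.const 0))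
    (forNbr 14 (.cond (.mul (.cell 3 (.reg 22)) (.mul (.eq (.cell 2 (.reg 22)) (.const 0))
        (.eq (.eq (.cell 10 (.cell 5 (.reg 22))) (.add (.reg 14) (.const 1))) (.const 0))))
      (.seq (.put 10 (.cell 5 (.reg 22)) (.add (.reg 14) (.const 1)))
        (.seq (.cond (.eq (.reg 17) (.reg 16)) (.set 15 (.cell 5 (.reg 22))) .skip)
          (.set 17 (.add (.reg 17) (.const 1))))) .skip)))

theorem getD_append_singleton (l : List ℕ) (c d : ℕ) :
    (l ++ [c]).getD d 0 = if l.length = d then c else l.getD d 0 := by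
  rcases lt_trichotomy d l.length with h | h | h
  · rw [if_neg (by omega), List.getD_append _ _ _ _ h]
  · subst h
    simp
  · rw [if_neg (by omega), List.getD_eq_default _ _ (by simp; omega),
      List.getD_eq_default _ _ (by omega)]

/-- Clusters already seen for `x` are recognized by the stamp `x + 1` in array `10`. Provided this
stamp has not been used before, the array need not be cleared between vertices. -/
theorem wp_classScan {pr sd cls dig : ℕ → ℕ} {s : Store} {x d : ℕ} (hW : Wide L K W)
    (hS : Static L K pr sd cls dig s) (hx : x < L.n) (r14 : s.reg 14 = x) (r16 : s.reg 16 = d)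
    (hd : d ≤ K + 2)
    (hst : ∀ c < 2 * L.n + 7, s.arr 10 c ≠ x + 1 ∧ s.arr 10 c ≤ L.n) :
    wp W classScan s fun T s' => T ≤ (L.nb x).length * 60 + 20 ∧
      s'.reg 15 = (classes L pr sd cls x).getD d 0 ∧
      ∀ c < 2 * L.n + 7, s'.arr 10 c = s.arr 10 c ∨ s'.arr 10 c = x + 1 := by
  have hl := hW.lin
  unfold classScan
  rw [wp_seq, wp_set]
  simp only [Exp.Fits, Exp.eval, Exp.cost]
  refine ⟨by omega, ?_⟩
  rw [wp_seq, wp_set]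
  simp only [Exp.Fits, Exp.eval, Exp.cost]
  refine ⟨by omega, ?_⟩
  have hS₁ : Static L K pr sd cls dig ((s.setReg 15 0).setReg 17 0) :=
    (hS.setReg (by decide)).setReg (by decide)
  refine (wp_forNbr L x 49 (fun l s' => ∃ acc, acc =
      firstOcc ((l.filter fun y => decide (pr y ≠ 0 ∧ sd y = 0)).map cls) ∧
      s'.reg 17 = acc.length ∧ acc.length ≤ l.length ∧
      s'.reg 15 = acc.getD d 0 ∧ (∀ c < 2 * L.n + 7, s'.arr 10 c = x + 1 ↔ c ∈ acc) ∧
      ∀ c < 2 * L.n + 7, s'.arr 10 c = s.arr 10 c ∨ s'.arr 10 c = x + 1)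
    hS₁.holds hx (by simpa [Store.setReg_reg] using r14) (by decide) (by omega) rfl rfl rfl rfl rfl
    (fun l s₁ b h => ⟨h, h, h⟩) ?_ ?_).mono ?_
  · refine ⟨[], rfl, by simp [Store.setReg_reg], by simp, by simp [Store.setReg_reg],
      fun c hc => ?_, fun c hc => Or.inl rfl⟩
    simpa using (hst c hc).1
  · rintro l y l' s₂ hl' ⟨acc, hacc, h17, hlen, h15, hmem, hold⟩ hy hF
    have hyn : y < L.n := L.lt (u := x) (by rw [hl']; simp)
    have hS₂ := hS₁.frame hF rfl rfl rfl rfl rfl rfl rfl rfl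
    have e14 : s₂.reg 14 = x := by rw [hF.1 _ rfl]; simpa [Store.setReg_reg] using r14
    have e16 : s₂.reg 16 = d := by rw [hF.1 _ rfl]; simpa [Store.setReg_reg] using r16
    have hcy := hS.cls_le y hyn
    have hpy := hS.pr_le y hyn
    have hsy := hS.sd_le y hyn
    have hlx : l.length ≤ L.off L.n := by
      have h2 : l.length ≤ (L.nb x).length := by rw [hl']; simp
      have h3 := L.off_succ x
      have h4 := L.off_le (show x + 1 ≤ L.n from hx)
      omega
    have hm := hmem (cls y) (by omega)
    have hb : s₂.arr 10 (cls y) ≤ L.n + 1 := by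
      rcases hold (cls y) (by omega) with h | h
      · have := (hst (cls y) (by omega)).2
        omega
      · omega
    rw [List.filter_append, List.map_append]
    rw [wp_cond]
    simp only [Exp.Fits, Exp.eval, Exp.cost, e14, hy, hS₂.arr3, hS₂.arr2, hS₂.arr5]
    have e1 : ∀ p : Prop, [Decidable p] → (if p then 1 else 0) ≤ 1 := by
      intro p _; split_ifs <;> omega
    have e2 : ∀ a b, a ≤ 1 → b ≤ 1 → a * b ≤ 1 := fun a b h h' => Nat.mul_le_mul h h'
    have b1 := e1 (sd y = 0)
    have b2 := e1 (s₂.arr 10 (cls y) = x + 1)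
    have b3 := e1 ((if s₂.arr 10 (cls y) = x + 1 then 1 else 0) = 0)
    have b4 := e2 _ _ b1 b3
    have b5 := e2 _ _ hpy b4
    refine ⟨by omega, fun h => ?_, fun h => ?_⟩
    · have h1 : pr y ≠ 0 ∧ sd y = 0 ∧ s₂.arr 10 (cls y) ≠ x + 1 := by
        simp only [mul_ne_zero_iff] at h
        refine ⟨h.1, ?_, ?_⟩
        · by_contra h'; simp [h'] at h
        · intro h'; simp [h'] at h
      have hn : cls y ∉ acc := fun h' => h1.2.2 (hm.2 h')
      have hnew : firstOcc ((l.filter fun y => decide (pr y ≠ 0 ∧ sd y = 0)).map cls ++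
          ([y].filter fun y => decide (pr y ≠ 0 ∧ sd y = 0)).map cls) = acc ++ [cls y] := by
        rw [show ([y].filter fun y => decide (pr y ≠ 0 ∧ sd y = 0)).map cls = [cls y] by simp [h1],
          firstOcc_append, ← hacc, if_neg hn]
      rw [hnew]
      have hstamp : (∀ c < 2 * L.n + 7, Function.update (s₂.arr 10) (cls y) (x + 1) c = x + 1 ↔
            c ∈ acc ++ [cls y]) ∧ ∀ c < 2 * L.n + 7,
          Function.update (s₂.arr 10) (cls y) (x + 1) c = s.arr 10 c ∨
            Function.update (s₂.arr 10) (cls y) (x + 1) c = x + 1 := by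
        refine ⟨fun c hc => ?_, fun c hc => ?_⟩
        · rw [Function.update_apply, List.mem_append, List.mem_singleton, ← hmem c hc]
          split_ifs with h2 <;> simp [h2]
        · rw [Function.update_apply]
          split_ifs with h2
          · exact Or.inr rfl
          · exact hold c hc
      simp only [wp_seq, wp_put, wp_cond, wp_set, wp_skip, Exp.Fits, Exp.eval, Exp.cost, e14, e16,
        hy, h17, hS₂.arr5, Store.setCell_reg, Store.setCell_arr, Store.setReg_arr, Store.setReg_reg,
        Nat.reduceEqDiff, reduceIte]
      refine ⟨by omega, by omega, by omega, fun h2 => ?_, fun h2 => ?_⟩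
      · have h2' : acc.length = d := by
          by_contra h3
          exact h2 (if_neg h3)
        refine ⟨by omega, by omega, by omega, _, rfl, by simp, by simp; omega, ?_,
          hstamp⟩
        rw [getD_append_singleton, if_pos h2']
      · have h2' : acc.length ≠ d := by
          intro h3
          rw [if_pos h3] at h2
          omega
        refine ⟨by omega, by omega, _, rfl, by simp, by simp; omega, ?_,
          hstamp⟩
        rw [getD_append_singleton, if_neg h2', h15]
    · have h1 : (pr y ≠ 0 ∧ sd y = 0) → s₂.arr 10 (cls y) = x + 1 := by
        rintro ⟨h1, h2⟩
        by_contra h3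
        rw [if_pos h2, if_neg h3] at h
        simp at h
        exact h1 h
      have hnew : firstOcc ((l.filter fun y => decide (pr y ≠ 0 ∧ sd y = 0)).map cls ++
          ([y].filter fun y => decide (pr y ≠ 0 ∧ sd y = 0)).map cls) = acc := by
        by_cases h2 : pr y ≠ 0 ∧ sd y = 0
        · rw [show ([y].filter fun y => decide (pr y ≠ 0 ∧ sd y = 0)).map cls = [cls y] by simp [h2],
            firstOcc_append, ← hacc, if_pos (hm.1 (h1 h2))]
        · rw [show ([y].filter fun y => decide (pr y ≠ 0 ∧ sd y = 0)).map cls = [] by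
            rw [List.filter_cons_of_neg (by simpa using h2)]; rfl, List.append_nil, hacc]
      rw [hnew]
      simp only [wp_skip]
      exact ⟨by omega, acc, rfl, h17, by simp; omega, h15, hmem, hold⟩
  · rintro T s' ⟨hT, acc, hacc, h17, hlen, h15, hmem, hold⟩
    refine ⟨by omega, ?_, hold⟩
    rw [h15, hacc, classes]

theorem classes_getD_le {pr sd cls : ℕ → ℕ} (hc : ∀ u < L.n, cls u ≤ 2 * L.n + 1) (x d : ℕ) :
    (classes L pr sd cls x).getD d 0 ≤ 2 * L.n + 1 := by
  by_cases h : d < (classes L pr sd cls x).length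
  · rw [List.getD_eq_getElem _ _ h]
    obtain ⟨y, hy, -, -, e⟩ := Solution.mem_classes.1 (List.getElem_mem h)
    rw [← e]
    exact hc y (L.lt hy)
  · rw [List.getD_eq_default _ _ (by omega)]
    omega

/-- The largest possible digit `K + 2` gives the label `2 * (K + 3)`; this explains the size `2 *
L.n + 7` of arrays indexed by labels. -/
theorem lbl_le {pr sd cls : ℕ → ℕ} (hc : ∀ u < L.n, cls u ≤ 2 * L.n + 1) {x d : ℕ} (hK : K ≤ L.n)
    (hd : d ≤ K + 2) : lbl L pr sd cls x d ≤ 2 * L.n + 6 := by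
  rw [lbl]
  split_ifs
  · omega
  · have := classes_getD_le (pr := pr) (sd := sd) hc x d
    omega

/-- Determine the label of the vertex in register `14`, with a guess if necessary. -/
def labelProg : Prog :=
  .seq (.cond (.cell 8 (.cell 5 (.reg 14))) .skip
    (.seq (.set 16 (.cell 11 (.reg 13))) (.seq (.set 13 (.add (.reg 13) (.const 1)))
      (.seq (.cond (.cell 2 (.reg 14)) classScan
          (.set 15 (.mul (.const 2) (.add (.reg 16) (.const 1)))))
        (.put 8 (.cell 5 (.reg 14)) (.add (.reg 15) (.const 1)))))))
    (.set 15 (.sub (.cell 8 (.cell 5 (.reg 14))) (.const 1)))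

theorem wp_labelProg {pr sd cls dig lab lab' : ℕ → ℕ} {s : Store} {x m : ℕ} (hW : Wide L K W)
    (hK : K ≤ L.n) (hS : Static L K pr sd cls dig s) (hx : x < L.n) (r14 : s.reg 14 = x)
    (r13 : s.reg 13 = m) (hm : m ≤ L.n) (hlab : ∀ c < 2 * L.n + 7, s.arr 8 c = lab c)
    (hlab_le : ∀ c, lab c ≤ 2 * L.n + 7)
    (hst : ∀ c < 2 * L.n + 7, s.arr 10 c ≠ x + 1 ∧ s.arr 10 c ≤ L.n)
    (hlab' : lab' = if lab (cls x) = 0 then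
      Function.update lab (cls x) (lbl L pr sd cls x (dig m) + 1) else lab) :
    wp W labelProg s fun T s' => T ≤ (L.nb x).length * 60 + 80 ∧
      (∀ c < 2 * L.n + 7, s'.arr 8 c = lab' c) ∧ s'.reg 15 = lab' (cls x) - 1 ∧
      s'.reg 13 = (if lab (cls x) = 0 then m + 1 else m) ∧
      ∀ c < 2 * L.n + 7, s'.arr 10 c = s.arr 10 c ∨ s'.arr 10 c = x + 1 := by
  have hl := hW.lin
  have hcx := hS.cls_le x hx
  have hsx := hS.sd_le x hx
  have hlx := hlab_le (cls x)
  have hdm := hS.dig_le m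
  have hlbl := lbl_le (pr := pr) (sd := sd) (x := x) hS.cls_le hK hdm
  unfold labelProg
  rw [wp_seq, wp_cond]
  simp only [Exp.Fits, Exp.eval, Exp.cost, r14, hS.arr5, hlab (cls x) (by omega)]
  refine ⟨by omega, fun h => ?_, fun h => ?_⟩
  · rw [if_neg h] at hlab'
    rw [hlab', if_neg h]
    simp only [wp_skip, wp_set, Exp.Fits, Exp.eval, Exp.cost, r14, hS.arr5, hlab (cls x) (by omega),
      Store.setReg_arr, Store.setReg_reg, Nat.reduceEqDiff, reduceIte]
    refine ⟨by omega, by omega, hlab, ?_, r13, fun c _ => ?_⟩ <;> simp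
  rw [if_pos h] at hlab'
  have hx' : lab' (cls x) = lbl L pr sd cls x (dig m) + 1 := by rw [hlab', Function.update_self]
  rw [if_pos h, wp_seq, wp_set]
  simp only [Exp.Fits, Exp.eval, Exp.cost, r13, hS.arr11]
  refine ⟨by omega, ?_⟩
  rw [wp_seq, wp_set]
  simp only [Exp.Fits, Exp.eval, Exp.cost, r13, Store.setReg_reg, Nat.reduceEqDiff, reduceIte]
  refine ⟨by omega, ?_⟩
  set s₁ := (s.setReg 16 (dig m)).setReg 13 (m + 1) with hs₁
  have hS₁ : Static L K pr sd cls dig s₁ := (hS.setReg (by decide)).setReg (by decide)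
  have e14 : s₁.reg 14 = x := by simp [hs₁, Store.setReg_reg, r14]
  have e16 : s₁.reg 16 = dig m := by simp [hs₁, Store.setReg_reg]
  have e13 : s₁.reg 13 = m + 1 := by simp [hs₁, Store.setReg_reg]
  refine wp_seq_of (Q' := fun T s' => T ≤ (L.nb x).length * 60 + 30 ∧
      s'.reg 15 = lbl L pr sd cls x (dig m) ∧
      ∀ c < 2 * L.n + 7, s'.arr 10 c = s.arr 10 c ∨ s'.arr 10 c = x + 1) ?_ ?_
  · rw [wp_cond]
    simp only [Exp.Fits, Exp.eval, Exp.cost, e14, hS₁.arr2]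
    refine ⟨by omega, fun h' => ?_, fun h' => ?_⟩
    · refine (wp_classScan hW hS₁ hx e14 e16 hdm hst).mono ?_
      rintro T s' ⟨hT, h15, h10⟩
      refine ⟨by omega, ?_, h10⟩
      rw [h15, lbl, if_neg h']
    · simp only [wp_set, Exp.Fits, Exp.eval, Exp.cost, e16, Store.setReg_reg, reduceIte]
      refine ⟨by omega, by omega, ?_, fun c _ => Or.inl rfl⟩
      rw [lbl, if_pos h']
  · rintro T s₂ ⟨hT, h15, h10⟩ hF
    have hS₂ := hS₁.frame hF rfl rfl rfl rfl rfl rfl rfl rfl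
    have f14 : s₂.reg 14 = x := by rw [hF.1 _ rfl, e14]
    have f13 : s₂.reg 13 = m + 1 := by rw [hF.1 _ rfl, e13]
    have h8 : s₂.arr 8 = s.arr 8 := hF.2 _ rfl
    simp only [wp_put, wp_set, Exp.Fits, Exp.eval, Exp.cost, f14, h15, hS₂.arr5, Store.setCell_arr,
      Store.setCell_reg, Store.setReg_arr, Store.setReg_reg, Nat.reduceEqDiff, reduceIte, f13,
      Function.update_self, hx', Nat.add_sub_cancel]
    refine ⟨by omega, by omega, by omega, by omega, fun c hc => ?_, trivial, trivial, h10⟩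
    rw [hlab', Function.update_apply, Function.update_apply, h8, hlab c hc]

end Ram

/-! ### Representation of the state and amortized cost of a step -/

namespace Ram

open Flip

variable {W K : ℕ} {L : ListGraph}

/-- The store represents the state of the propagation. -/
structure Rep (L : ListGraph) (st : Flip.State) (s : Store) : Prop where
  queue : HasQueue L st.q s
  hd : s.reg 11 = st.hd
  qc : s.reg 13 = st.log.length
  lab : ∀ c < 2 * L.n + 7, s.arr 8 c = st.lab c
  ptr : ∀ t < 2 * L.n + 7, s.arr 9 t = st.ptr t
  stamp : ∀ c < 2 * L.n + 7, s.arr 10 c ≠ 0 → ∃ y ∈ st.q.take st.hd, s.arr 10 c = y + 1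
  lab_le : ∀ c, st.lab c ≤ 2 * L.n + 7
  log_le : st.log.length ≤ st.hd

/-- The cost of scanning the neighborhood of the vertex `p - 1`. -/
def weight (L : ListGraph) (p : ℕ) : ℕ := if p = 0 then 0 else (L.nb (p - 1)).length

/-- The potential of the propagation. -/
def potential (L : ListGraph) (ptr : ℕ → ℕ) : ℕ :=
  ∑ t ∈ Finset.range (2 * L.n + 7), weight L (ptr t)

/-- Replacing a pointer releases the degree of the old one, which pays for its scan, and charges the
degree of `x`, which is treated only once. -/
theorem potential_update (ptr : ℕ → ℕ) {t : ℕ} (ht : t < 2 * L.n + 7) (x : ℕ) :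
    potential L (Function.update ptr t (x + 1)) + weight L (ptr t) =
      potential L ptr + (L.nb x).length := by
  have hm : t ∈ Finset.range (2 * L.n + 7) := by simpa using ht
  rw [potential, potential, ← Finset.sum_erase_add _ _ hm, ← Finset.sum_erase_add _ _ hm,
    Function.update_self, Finset.sum_congr rfl (g := fun t => weight L (ptr t))]
  · simp [weight]
    ring
  · intro i hi
    rw [Function.update_of_ne (Finset.ne_of_mem_erase hi)]

/-- The initial pointers of different numbers are different vertices, because a vertex determines
its number. -/
theorem potential_ptrRun_le (pr cls : ℕ → ℕ) : potential L (ptrRun pr cls L.n) ≤ L.off L.n := by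
  set p := ptrRun pr cls L.n with hp
  have hspec := (ptrRun_spec (pr := pr) (cls := cls) L.n).1
  rw [← hp] at hspec
  have h1 : potential L p = ∑ t ∈ (Finset.range (2 * L.n + 7)).filter (fun t => p t ≠ 0),
      (L.nb (p t - 1)).length := by
    rw [potential, Finset.sum_filter]
    refine Finset.sum_congr rfl fun t _ => ?_
    by_cases h : p t = 0 <;> simp [weight, h]
  have hinj : Set.InjOn (fun t => p t - 1)
      ((Finset.range (2 * L.n + 7)).filter (fun t => p t ≠ 0) : Finset ℕ) := by
    intro t ht t' ht' h
    simp only [Finset.coe_filter, Set.mem_ofPred_eq] at ht ht'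
    obtain ⟨u, -, -, hc, e⟩ := hspec t ht.2
    obtain ⟨u', -, -, hc', e'⟩ := hspec t' ht'.2
    have : u = u' := by
      dsimp only at h
      omega
    rw [← hc, ← hc', this]
  rw [h1, ← Finset.sum_image (f := fun u => (L.nb u).length) hinj, ListGraph.off]
  refine Finset.sum_le_sum_of_subset ?_
  intro u hu
  simp only [Finset.mem_image, Finset.mem_filter] at hu
  obtain ⟨t, ht, rfl⟩ := hu
  obtain ⟨u, hu, -, -, e⟩ := hspec t ht.2
  simp [e, hu]

/-- Treat the next vertex of the queue. -/
def procProg : Prog :=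
  .seq (.set 14 (.cell 7 (.reg 11))) (.seq (.set 11 (.add (.reg 11) (.const 1)))
    (.seq labelProg (.seq (.set 18 (.reg 14)) (.seq scanProg
      (.seq (.cond (.cell 9 (.reg 15))
          (.seq (.set 18 (.sub (.cell 9 (.reg 15)) (.const 1))) scanProg) .skip)
        (.put 9 (.reg 15) (.add (.reg 14) (.const 1))))))))

theorem wp_procProg {pr sd cls dig : ℕ → ℕ} {s : Store} {st : Flip.State} (hW : Wide L K W)
    (hK : K ≤ L.n) (hS : Static L K pr sd cls dig s) (hR : Rep L st s) (hB : Basic L st)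
    (hq : st.hd < st.q.length) :
    wp W procProg s fun T s' =>
      T + 80 * potential L (step L pr sd cls (fun m _ => dig m) st).ptr ≤
        80 * potential L st.ptr + (300 * (L.nb (st.q.getD st.hd 0)).length + 300) ∧
      Rep L (step L pr sd cls (fun m _ => dig m) st) s' := by
  have hl := hW.lin
  have hqn := hB.length_le
  have hxq : st.q.getD st.hd 0 ∈ st.q := by
    rw [List.getD_eq_getElem _ _ hq]
    exact List.getElem_mem hq
  have htake : st.q.take (st.hd + 1) = st.q.take st.hd ++ [st.q.getD st.hd 0] := by
    rw [List.getD_eq_getElem _ _ hq, List.take_succ_eq_append_getElem hq]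
  have h7 : s.arr 7 st.hd = st.q.getD st.hd 0 := by
    rw [List.getD_eq_getElem _ _ hq]
    exact hR.queue.get _ hq
  -- The queue has no repetitions, so `x` was not treated before and its stamp is fresh.
  have hxn : st.q.getD st.hd 0 ∉ st.q.take st.hd := by
    have h1 := (List.take_sublist (st.hd + 1) st.q).nodup hB.nodup
    rw [htake, List.nodup_append] at h1
    exact fun h => h1.2.2 _ h _ (by simp) rfl
  rw [step, if_pos hq]
  dsimp only
  set x := st.q.getD st.hd 0 with hxdef
  have hx : x < L.n := hB.lt x hxq
  set lab := if st.lab (cls x) = 0 then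
      Function.update st.lab (cls x) (lbl L pr sd cls x (dig st.log.length) + 1) else st.lab with hlab
  set t := lab (cls x) - 1 with ht
  have hcx := hS.cls_le x hx
  have hlble := lbl_le (pr := pr) (sd := sd) (x := x) hS.cls_le hK (hS.dig_le st.log.length)
  have hlab_le : ∀ c, lab c ≤ 2 * L.n + 7 := by
    intro c
    rw [hlab]
    split_ifs
    · rw [Function.update_apply]
      split_ifs
      · omega
      · exact hR.lab_le c
    · exact hR.lab_le c
  have htle : t ≤ 2 * L.n + 6 := by have := hlab_le (cls x); omega
  have hpt : st.ptr t ≤ L.n := by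
    by_cases h0 : st.ptr t = 0
    · omega
    · have := hB.ptr t h0; omega
  unfold procProg
  rw [wp_seq, wp_set]
  simp only [Exp.Fits, Exp.eval, Exp.cost, hR.hd, h7]
  refine ⟨by omega, ?_⟩
  rw [wp_seq, wp_set]
  simp only [Exp.Fits, Exp.eval, Exp.cost, hR.hd, Store.setReg_reg, Nat.reduceEqDiff, reduceIte]
  refine ⟨by omega, ?_⟩
  set s₁ := (s.setReg 14 x).setReg 11 (st.hd + 1) with hs₁
  have hS₁ : Static L K pr sd cls dig s₁ := (hS.setReg (by decide)).setReg (by decide)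
  have e14 : s₁.reg 14 = x := by simp [hs₁, Store.setReg_reg]
  have e11 : s₁.reg 11 = st.hd + 1 := by simp [hs₁, Store.setReg_reg]
  have e13 : s₁.reg 13 = st.log.length := by simpa [hs₁, Store.setReg_reg] using hR.qc
  have hQ₁ : HasQueue L st.q s₁ :=
    ⟨hR.queue.get, by simpa [hs₁, Store.setReg_reg] using hR.queue.len, hR.queue.mem⟩
  have hlog := hR.log_le
  refine wp_seq_of (wp_labelProg (lab := st.lab) (lab' := lab) hW hK hS₁ hx e14 e13 (by omega)
    hR.lab hR.lab_le ?_ rfl) ?_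
  · intro c hc
    by_cases h0 : s.arr 10 c = 0
    · simp [hs₁, h0]
    · obtain ⟨y, hy, e⟩ := hR.stamp c hc h0
      have hyn := hB.lt y (List.mem_of_mem_take hy)
      have : y ≠ x := fun h => hxn (h ▸ hy)
      simp only [hs₁, Store.setReg_arr, e]
      omega
  rintro T₂ s₂ ⟨hT₂, h8₂, h15₂, h13₂, h10₂⟩ hF₂
  have hS₂ := hS₁.frame hF₂ rfl rfl rfl rfl rfl rfl rfl rfl
  have f14 : s₂.reg 14 = x := by rw [hF₂.1 _ rfl, e14]
  have hQ₂ : HasQueue L st.q s₂ := hQ₁.frame hF₂ rfl rfl rfl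
  rw [wp_seq, wp_set]
  simp only [Exp.Fits, Exp.eval, Exp.cost, f14]
  refine ⟨by omega, ?_⟩
  refine wp_seq_of (wp_scanProg (q := st.q) (x := x) (t := t) (z := x) hW (hS₂.setReg (by decide))
    ⟨hQ₂.1, by simpa [Store.setReg_reg] using hQ₂.2, hQ₂.3⟩ hB.nodup hB.lt hx hx (by omega)
    (by simpa [Store.setReg_reg] using f14) (by simpa [Store.setReg_reg] using h15₂)
    (by simp [Store.setReg_reg])) ?_
  rintro T₃ s₃ ⟨hT₃, hQ₃⟩ hF₃
  set q₁ := scan L pr sd cls x t x st.q with hq₁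
  have hS₃ := (hS₂.setReg (a := x) (show 18 ≠ 0 by decide)).frame hF₃ rfl rfl rfl rfl rfl rfl rfl rfl
  have h8₃ : s₃.arr 8 = s₂.arr 8 := hF₃.2 _ rfl
  have h9₃ : s₃.arr 9 = s.arr 9 := by rw [hF₃.2 _ rfl, Store.setReg_arr, hF₂.2 _ rfl]; rfl
  have h10₃ : s₃.arr 10 = s₂.arr 10 := hF₃.2 _ rfl
  have g14 : s₃.reg 14 = x := by rw [hF₃.1 _ rfl]; simpa [Store.setReg_reg] using f14
  have g15 : s₃.reg 15 = t := by rw [hF₃.1 _ rfl]; simpa [Store.setReg_reg] using h15₂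
  have g11 : s₃.reg 11 = st.hd + 1 := by
    rw [hF₃.1 _ rfl]; simp [Store.setReg_reg, hF₂.1 11 rfl, e11]
  have g13 : s₃.reg 13 = if st.lab (cls x) = 0 then st.log.length + 1 else st.log.length := by
    rw [hF₃.1 _ rfl]; simpa [Store.setReg_reg] using h13₂
  set q₂ := if st.ptr t = 0 then q₁ else scan L pr sd cls x t (st.ptr t - 1) q₁ with hq₂
  have hpre : st.q <+: q₂ := by
    rw [hq₂]
    split_ifs
    · exact prefix_scan
    · exact prefix_scan.trans prefix_scan
  refine wp_seq_of (Q' := fun T s' => T ≤ weight L (st.ptr t) * 80 + 100 ∧ HasQueue L q₂ s') ?_ ?_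
  · rw [wp_cond]
    simp only [Exp.Fits, Exp.eval, Exp.cost, g15, h9₃, hR.ptr t (by omega)]
    refine ⟨by omega, fun h => ?_, fun h => ?_⟩
    · rw [wp_seq, wp_set]
      simp only [Exp.Fits, Exp.eval, Exp.cost, g15, h9₃, hR.ptr t (by omega)]
      refine ⟨by omega, ?_⟩
      refine (wp_scanProg (q := q₁) (x := x) (t := t) (z := st.ptr t - 1) hW (hS₃.setReg (by decide))
        ⟨hQ₃.1, by simpa [Store.setReg_reg] using hQ₃.2, hQ₃.3⟩ (nodup_scan hB.nodup)
        (lt_scan hx hB.lt) hx (hB.ptr t h) (by omega)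
        (by simpa [Store.setReg_reg] using g14) (by simpa [Store.setReg_reg] using g15)
        (by simp [Store.setReg_reg])).mono ?_
      rintro T s' ⟨hT, hQ⟩
      rw [hq₂, weight, if_neg h, if_neg h]
      exact ⟨by omega, hQ⟩
    · rw [wp_skip, hq₂, if_pos h]
      exact ⟨by omega, hQ₃⟩
  · rintro T₄ s₄ ⟨hT₄, hQ₄⟩ hF₄
    have k14 : s₄.reg 14 = x := by rw [hF₄.1 _ rfl, g14]
    have k15 : s₄.reg 15 = t := by rw [hF₄.1 _ rfl, g15]
    have h9₄ : s₄.arr 9 = s.arr 9 := by rw [hF₄.2 _ rfl, h9₃]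
    have h8₄ : s₄.arr 8 = s₂.arr 8 := by rw [hF₄.2 _ rfl, h8₃]
    have h10₄ : s₄.arr 10 = s₂.arr 10 := by rw [hF₄.2 _ rfl, h10₃]
    have hpot := potential_update (L := L) st.ptr (t := t) (by omega) x
    simp only [wp_put, Exp.Fits, Exp.eval, Exp.cost, k14, k15]
    refine ⟨by omega, by omega, by omega, ⟨?_, ?_, ?_⟩, ?_, ?_, ?_, ?_, ?_, hlab_le, ?_⟩
    · simpa [Store.setCell_arr] using hQ₄.1
    · simpa using hQ₄.2
    · simpa [Store.setCell_arr] using hQ₄.3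
    · rw [Store.setCell_reg, hF₄.1 _ rfl, g11]
    · rw [Store.setCell_reg, hF₄.1 _ rfl, g13]
      split_ifs <;> simp
    · intro c hc
      simp only [Store.setCell_arr, Nat.reduceEqDiff, reduceIte, h8₄, h8₂ c hc]
    · intro c hc
      simp only [Store.setCell_arr, reduceIte, h9₄, Function.update_apply, hR.ptr c hc]
    · intro c hc
      simp only [Store.setCell_arr, Nat.reduceEqDiff, reduceIte, h10₄]
      have e : q₂.take (st.hd + 1) = st.q.take (st.hd + 1) := by
        rw [List.prefix_iff_eq_take.1 hpre, List.take_take, min_eq_left (by omega)]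
      rw [e, htake]
      intro h0
      rcases h10₂ c hc with h | h
      · rw [h] at h0 ⊢
        obtain ⟨y, hy, e⟩ := hR.stamp c hc h0
        exact ⟨y, List.mem_append_left _ hy, e⟩
      · exact ⟨x, by simp, h⟩
    · split_ifs
      · simp; omega
      · exact hlog.trans (Nat.le_succ _)

end Ram

/-! ### The propagation as a whole and one attempt -/

namespace Ram

open Flip

variable {W K : ℕ} {L : ListGraph}

theorem sum_map_le {l : List ℕ} {n : ℕ} (g : ℕ → ℕ) (h : l.Nodup) (h' : ∀ y ∈ l, y < n) :
    (l.map g).sum ≤ ∑ u ∈ Finset.range n, g u := by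
  rw [← List.sum_toFinset g h]
  refine Finset.sum_le_sum_of_subset ?_
  intro y hy
  simpa using h' y (by simpa using hy)

/-- Treat the queue. -/
def mainLoop : Prog := .loop (.lt (.reg 11) (.reg 12)) procProg

theorem wp_mainLoop {pr sd cls dig : ℕ → ℕ} {s : Store} {v : ℕ} (hW : Wide L K W) (hK : K ≤ L.n)
    (hv : v < L.n) (hS : Static L K pr sd cls dig s) (hR : Rep L (init L pr cls v) s) :
    wp W mainLoop s fun T s' => T ≤ 400 * (L.n + L.off L.n + 1) ∧
      HasQueue L (run L pr sd cls (fun m _ => dig m) v (L.n + 1)).q s' := by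
  have hl := hW.lin
  -- Time plus potential is bounded by the initial potential and a sum over treated vertices; these
  -- are distinct, so the sum is at most linear in the size of the graph.
  refine wp_loop (fun T s₁ => ∃ i, Rep L (run L pr sd cls (fun m _ => dig m) v i) s₁ ∧
    i = (run L pr sd cls (fun m _ => dig m) v i).hd ∧
    T + 80 * potential L (run L pr sd cls (fun m _ => dig m) v i).ptr ≤
      80 * potential L (init L pr cls v).ptr +
        (((run L pr sd cls (fun m _ => dig m) v i).q.take
          (run L pr sd cls (fun m _ => dig m) v i).hd).map
          (fun y => (L.nb y).length * 300 + 310)).sum) (fun s₁ => L.n - s₁.reg 11) ?_ ?_ ?_ ?_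
  · refine ⟨0, hR, rfl, ?_⟩
    show 0 + 80 * potential L (init L pr cls v).ptr ≤ _
    omega
  · rintro T s₁ ⟨i, hR₁, -, -⟩ -
    have hB := basic_run (pr := pr) (sd := sd) (cls := cls) hv (fun m _ => dig m) i
    have := hB.length_le
    have := hB.hd
    simp only [Exp.Fits, hR₁.hd, hR₁.queue.len]
    omega
  · rintro T s₁ ⟨i, hR₁, hi, hT⟩ hF hev
    have hB := basic_run (pr := pr) (sd := sd) (cls := cls) hv (fun m _ => dig m) i
    have hlen := hB.length_le
    have hS₁ := hS.frame hF rfl rfl rfl rfl rfl rfl rfl rfl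
    have hsucc := run_succ L pr sd cls (fun m _ => dig m) v i
    have hpre := step_q_prefix (L := L) (pr := pr) (sd := sd) (cls := cls) (fun m _ => dig m)
      (run L pr sd cls (fun m _ => dig m) v i)
    set st := run L pr sd cls (fun m _ => dig m) v i with hst
    have hq : st.hd < st.q.length := by
      by_contra h
      simp [Exp.eval, hR₁.hd, hR₁.queue.len, h] at hev
    have hhd := step_hd (L := L) (pr := pr) (sd := sd) (cls := cls) (ch := fun m _ => dig m) hq
    refine (wp_procProg hW hK hS₁ hR₁ hB hq).mono ?_
    rintro T' s₂ ⟨hT', hR₂⟩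
    refine ⟨⟨i + 1, ?_, ?_, ?_⟩, ?_⟩
    · rw [hsucc]; exact hR₂
    · rw [hsucc, hhd, ← hi]
    · rw [hsucc, hhd]
      have e : (step L pr sd cls (fun m _ => dig m) st).q.take (st.hd + 1) =
          st.q.take st.hd ++ [st.q.getD st.hd 0] := by
        rw [List.getD_eq_getElem _ _ hq, ← List.take_succ_eq_append_getElem hq,
          List.prefix_iff_eq_take.1 hpre, List.take_take, min_eq_left (by omega)]
      rw [e, List.map_append, List.sum_append]
      simp only [List.map_cons, List.map_nil, List.sum_cons, List.sum_nil, Exp.cost]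
      omega
    · rw [hR₁.hd, hR₂.hd, hhd]
      omega
  · rintro T s₁ ⟨i, hR₁, hi, hT⟩ hF hev
    have hB := basic_run (pr := pr) (sd := sd) (cls := cls) hv (fun m _ => dig m) i
    have hlen := hB.length_le
    have hfin := run_of_done (L := L) (pr := pr) (sd := sd) (cls := cls) (ch := fun m _ => dig m)
      (v := v) (i := i) (j := L.n + 1)
    have hp0 := potential_ptrRun_le (L := L) pr cls
    have hp1 : potential L (init L pr cls v).ptr = potential L (ptrRun pr cls L.n) := rfl
    set st := run L pr sd cls (fun m _ => dig m) v i with hst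
    have hq : ¬ st.hd < st.q.length := by
      intro h
      simp [Exp.eval, hR₁.hd, hR₁.queue.len, h] at hev
    have hle := hB.hd
    rw [hfin (by omega) hq]
    refine ⟨?_, hR₁.queue⟩
    have hsum := sum_map_le (l := st.q.take st.hd) (n := L.n)
      (fun y => (L.nb y).length * 300 + 310) ((List.take_sublist _ _).nodup hB.nodup)
      (fun y hy => hB.lt y (List.mem_of_mem_take hy))
    rw [sum_deg] at hsum
    simp only [Exp.cost]
    omega

/-- Initialize the propagation from the vertex in register `2`. -/
def initProg : Prog :=
  .seq (forTo 10 4 (.put 8 (.reg 10) (.const 0))) (.seq (forTo 10 4 (.put 9 (.reg 10) (.const 0)))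
    (.seq (forTo 10 4 (.put 10 (.reg 10) (.const 0))) (.seq (forTo 10 0 (.put 6 (.reg 10) (.const 0)))
      (.seq (forTo 10 0 (.cond (.cell 3 (.reg 10))
          (.put 9 (.cell 5 (.reg 10)) (.add (.reg 10) (.const 1))) .skip))
        (.seq (.put 6 (.reg 2) (.const 1)) (.seq (.put 7 (.const 0) (.reg 2))
          (.seq (.set 11 (.const 0)) (.seq (.set 12 (.const 1)) (.set 13 (.const 0))))))))))

theorem wp_initProg {pr sd cls dig : ℕ → ℕ} {s : Store} {v : ℕ} (hW : Wide L K W)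
    (hv : v < L.n) (hS : Static L K pr sd cls dig s) (h2 : s.reg 2 = v)
    (h4 : s.reg 4 = 2 * L.n + 7) :
    wp W initProg s fun T s' => T ≤ 300 * (L.n + 1) ∧ Rep L (init L pr cls v) s' := by
  have hl := hW.lin
  unfold initProg
  refine wp_seq_of (wp_fill (N := 2 * L.n + 7) h4 (by decide) (by omega)) ?_
  rintro T₁ s₁ ⟨hT₁, hz₁⟩ hF₁
  refine wp_seq_of (wp_fill (N := 2 * L.n + 7) (by rw [hF₁.1 _ rfl, h4]) (by decide) (by omega)) ?_
  rintro T₂ s₂ ⟨hT₂, hz₂⟩ hF₂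
  refine wp_seq_of (wp_fill (N := 2 * L.n + 7) (by rw [hF₂.1 _ rfl, hF₁.1 _ rfl, h4]) (by decide)
    (by omega)) ?_
  rintro T₃ s₃ ⟨hT₃, hz₃⟩ hF₃
  refine wp_seq_of (wp_fill (N := L.n) (by rw [hF₃.1 _ rfl, hF₂.1 _ rfl, hF₁.1 _ rfl, hS.holds.reg])
    (by decide) (by omega)) ?_
  rintro T₄ s₄ ⟨hT₄, hz₄⟩ hF₄
  have hS₄ : Static L K pr sd cls dig s₄ :=
    (((hS.frame hF₁ rfl rfl rfl rfl rfl rfl rfl rfl).frame hF₂ rfl rfl rfl rfl rfl rfl rfl rfl).frame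
      hF₃ rfl rfl rfl rfl rfl rfl rfl rfl).frame hF₄ rfl rfl rfl rfl rfl rfl rfl rfl
  refine wp_seq_of (wp_forTo_const L.n 12 (fun j s' => ∀ t < 2 * L.n + 7,
    s'.arr 9 t = ptrRun pr cls j t) hS₄.holds.reg (by decide) rfl rfl (by omega) ?_ ?_) ?_
  · intro t ht
    simp only [Store.setReg_arr, hF₄.2 9 rfl, hF₃.2 9 rfl, hz₂, ht, if_true, ptrRun]
  · intro j s₅ hj hji hI hF
    have hS₅ := hS₄.frame hF rfl rfl rfl rfl rfl rfl rfl rfl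
    have := hS.pr_le j hj
    have := hS.cls_le j hj
    rw [wp_cond]
    simp only [wp_put, wp_skip, Exp.Fits, Exp.eval, Exp.cost, hji, hS₅.arr3, hS₅.arr5]
    refine ⟨by omega, fun h => ⟨by omega, by omega, by omega, fun t ht => ?_⟩,
      fun h => ⟨by omega, fun t ht => ?_⟩⟩
    · simp only [Store.setReg_arr, Store.setCell_arr, reduceIte]
      rw [ptrRun, if_pos h, Function.update_apply, Function.update_apply, hI t ht]
    · rw [ptrRun, if_neg (by simpa using h)]
      exact hI t ht
  rintro T₅ s₅ ⟨hT₅, hI₅⟩ hF₅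
  have hS₅ := hS₄.frame hF₅ rfl rfl rfl rfl rfl rfl rfl rfl
  have e2 : s₅.reg 2 = v := by
    rw [hF₅.1 _ rfl, hF₄.1 _ rfl, hF₃.1 _ rfl, hF₂.1 _ rfl, hF₁.1 _ rfl, h2]
  simp only [wp_seq, wp_put, wp_set, Exp.Fits, Exp.eval, Exp.cost, e2, Store.setCell_reg]
  refine ⟨by omega, by omega, by omega, by omega, by omega, by omega, by omega, by omega,
    ⟨?_, ?_, ?_⟩, ?_, ?_, ?_, ?_, ?_, ?_, ?_⟩
  · intro i hi
    obtain rfl : i = 0 := by simpa [init] using hi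
    simp [init, Store.setCell_arr]
  · simp [init, Store.setReg_reg]
  · intro u hu
    simp only [Store.setReg_arr, Store.setCell_arr, Nat.reduceEqDiff, reduceIte,
      Function.update_apply, init, List.mem_singleton, hF₅.2 6 rfl, hz₄, hu]
  · simp [init, Store.setReg_reg]
  · simp [init, Store.setReg_reg]
  · intro c hc
    simp [init, Store.setCell_arr, hF₅.2 8 rfl, hF₄.2 8 rfl, hF₃.2 8 rfl, hF₂.2 8 rfl, hz₁, hc]
  · intro t ht
    simp [init, Store.setCell_arr, hI₅ t ht]
  · intro c hc h0
    exfalso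
    apply h0
    simp [Store.setCell_arr, hF₅.2 10 rfl, hF₄.2 10 rfl, hz₃, hc]
  · intro c
    simp [init]
  · simp [init]

/-- Try the guess given by array `11`: propagate and check the result. -/
def tryProg : Prog :=
  .seq (.put 2 (.reg 2) (.sub (.const 1) (.cell 11 (.reg 5)))) (.seq initProg (.seq mainLoop
    (.seq (forTo 10 0 (.put 12 (.reg 10) (.eq (.eq (.cell 2 (.reg 10)) (.cell 6 (.reg 10))) (.const 0))))
      (.seq (.put 3 (.reg 2) (.const 1)) (.seq checkProg
        (.cond (.reg 6) .skip (.put 3 (.reg 2) (.const 0))))))))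

/-- Digit `D` is the final side of `v`: the old side is set to `1 - dig D` so that starting the
queue with `v` moves it there. On failure `v` is made absent again, while its entry among the sides
may remain changed. -/
theorem wp_tryProg {pr sd cls dig : ℕ → ℕ} {s : Store} {v D : ℕ} (hW : Wide L K W) (hK : K ≤ L.n)
    (hv : v < L.n) (hS : Static L K pr sd cls dig s) (h2 : s.reg 2 = v) (h3 : s.reg 3 = K)
    (h4 : s.reg 4 = 2 * L.n + 7) (h5 : s.reg 5 = D) (hD : D ≤ 2 * L.n + 1) (hpv : pr v = 0) :
    wp W tryProg s fun T s' => T ≤ 1200 * (L.n + L.off L.n + 1) ∧ s'.reg 6 ≤ 1 ∧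
      (s'.reg 6 = 1 ↔ L.Good (Function.update pr v 1) (newSide (Function.update sd v (1 - dig D))
        (run L pr (Function.update sd v (1 - dig D)) cls (fun m _ => dig m) v (L.n + 1)).q) K) ∧
      (s'.reg 6 = 1 → s'.arr 3 = Function.update pr v 1 ∧
        L.Good (Function.update pr v 1) (s'.arr 12) K) ∧
      (s'.reg 6 ≠ 1 → s'.arr 3 = pr) ∧
      (∀ u < L.n, s'.arr 12 u ≤ 1) ∧
      s'.arr 2 = Function.update sd v (1 - dig D) := by
  have hl := hW.lin
  have hdD := hS.dig_le D
  unfold tryProg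
  rw [wp_seq, wp_put]
  simp only [Exp.Fits, Exp.eval, Exp.cost, h2, h5, hS.arr11]
  refine ⟨by omega, by omega, ?_⟩
  set sd' := Function.update sd v (1 - dig D) with hsd'
  set s₁ := s.setCell 2 v (1 - dig D) with hs₁
  have hS₁ : Static L K pr sd' cls dig s₁ := by
    refine ⟨⟨hS.holds.1, hS.holds.2, hS.holds.3⟩, hS.adj, hS.arr3, ?_, hS.arr5, hS.arr11, hS.pr_le, ?_,
      hS.cls_le, hS.dig_le⟩
    · simp [hs₁, Store.setCell_arr, hS.arr2, hsd']
    · intro u hu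
      have := hS.sd_le u hu
      rw [hsd', Function.update_apply]
      split_ifs <;> omega
  refine wp_seq_of (wp_initProg (v := v) hW hv hS₁ h2 h4) ?_
  rintro T₂ s₂ ⟨hT₂, hR₂⟩ hF₂
  have hS₂ := hS₁.frame hF₂ rfl rfl rfl rfl rfl rfl rfl rfl
  refine wp_seq_of (wp_mainLoop hW hK hv hS₂ hR₂) ?_
  rintro T₃ s₃ ⟨hT₃, hQ₃⟩ hF₃
  have hS₃ := hS₂.frame hF₃ rfl rfl rfl rfl rfl rfl rfl rfl
  set q := (run L pr sd' cls (fun m _ => dig m) v (L.n + 1)).q with hq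
  refine wp_seq_of (wp_forTo_const L.n 20 (fun j s' => ∀ u < j, s'.arr 12 u = newSide sd' q u)
    hS₃.holds.reg (by decide) rfl rfl (by omega) (by simp) ?_) ?_
  · intro j s₄ hj hji hI hF
    have hS₄ := hS₃.frame hF rfl rfl rfl rfl rfl rfl rfl rfl
    have h6 : s₄.arr 6 j = if j ∈ q then 1 else 0 := by rw [hF.2 _ rfl, hQ₃.mem j hj]
    have := hS₁.sd_le j hj
    have e : ∀ p : Prop, [Decidable p] → (if p then 1 else 0) ≤ 1 := by
      intro p _; split_ifs <;> omega
    have b1 := e (j ∈ q)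
    simp only [wp_put, Exp.Fits, Exp.eval, Exp.cost, hji, hS₄.arr2, h6]
    refine ⟨by omega, by omega, by omega, fun u hu => ?_⟩
    simp only [Store.setReg_arr, Store.setCell_arr, reduceIte, Function.update_apply]
    by_cases h : u = j
    · subst h
      rw [if_pos rfl, newSide]
      by_cases h' : sd' u = if u ∈ q then 1 else 0 <;> simp [h']
    · rw [if_neg h]
      exact hI u (by omega)
  rintro T₄ s₄ ⟨hT₄, hI₄⟩ hF₄
  have hS₄ := hS₃.frame hF₄ rfl rfl rfl rfl rfl rfl rfl rfl
  have e2 : s₄.reg 2 = v := by rw [hF₄.1 _ rfl, hF₃.1 _ rfl, hF₂.1 _ rfl]; exact h2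
  rw [wp_seq, wp_put]
  simp only [Exp.Fits, Exp.eval, Exp.cost, e2]
  refine ⟨by omega, by omega, ?_⟩
  have hsd12 : ∀ u < L.n, s₄.arr 12 u ≤ 1 := fun u hu => by
    rw [hI₄ u hu]; exact newSide_le q u
  have hgood : L.Good (Function.update pr v 1) (s₄.arr 12) K ↔
      L.Good (Function.update pr v 1) (newSide sd' q) K := by
    refine exists_congr fun f => and_congr ?_ ?_
    · refine forall_congr' fun u => forall_congr' fun hu => forall_congr' fun w =>
        forall_congr' fun hw => ?_
      rw [hI₄ u hu, hI₄ w hw]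
    · refine forall_congr' fun u => forall_congr' fun hu => ?_
      rw [hI₄ u hu]
  refine wp_seq_of (wp_checkProg (pr := Function.update pr v 1) (sd := s₄.arr 12) hW
    ⟨hS₄.holds.1, hS₄.holds.2, hS₄.holds.3⟩ ?_ ?_ ?_ ?_ ?_ hsd12) ?_
  · rw [Store.setCell_reg, hF₄.1 _ rfl, hF₃.1 _ rfl, hF₂.1 _ rfl]; exact h3
  · rw [Store.setCell_reg, hF₄.1 _ rfl, hF₃.1 _ rfl, hF₂.1 _ rfl]; exact h4
  · simp [Store.setCell_arr, hS₄.arr3]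
  · simp [Store.setCell_arr]
  · intro u hu
    have := hS.pr_le u hu
    rw [Function.update_apply]
    split_ifs <;> omega
  rintro T₅ s₅ ⟨hT₅, h6, h6'⟩ hF₅
  rw [L.check_iff_good _ _ hsd12] at h6'
  have k2 : s₅.reg 2 = v := by rw [hF₅.1 _ rfl, Store.setCell_reg, e2]
  have k3 : s₅.arr 3 = Function.update pr v 1 := by
    rw [hF₅.2 _ rfl]; simp [Store.setCell_arr, hS₄.arr3]
  have k12 : s₅.arr 12 = s₄.arr 12 := by
    rw [hF₅.2 _ rfl]; simp [Store.setCell_arr]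
  have ka2 : s₅.arr 2 = sd' := by
    rw [hF₅.2 _ rfl]; simp [Store.setCell_arr, hS₄.arr2]
  rw [wp_cond]
  simp only [wp_skip, wp_put, Exp.Fits, Exp.eval, Exp.cost, k2]
  refine ⟨by omega, fun h => ?_, fun h => ?_⟩
  · have h1 : s₅.reg 6 = 1 := by omega
    rw [← hgood, k12]
    exact ⟨by omega, h6, h6', fun _ => ⟨k3, h6'.1 h1⟩, fun h' => absurd h1 h', hsd12, ka2⟩
  · refine ⟨by omega, by omega, by omega, h6, ?_, ?_, ?_, ?_, ?_⟩
    · rw [← hgood]; exact h6'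
    · intro h'
      rw [Store.setCell_reg] at h'
      omega
    · intro _
      simp only [Store.setCell_arr, reduceIte, k3]
      rw [Function.update_idem, Function.update_eq_self_iff, hpv]
    · simpa [Store.setCell_arr, k12] using hsd12
    · simp [Store.setCell_arr, ka2]

end Ram

/-! ### Counting in a positional system -/

/-- The digits of `C` to the base `b`. -/
def digits (b C i : ℕ) : ℕ := C / b ^ i % b

theorem exists_digits {b : ℕ} (D : ℕ) (dig : ℕ → ℕ) (h : ∀ i < D, dig i < b) :
    ∃ C < b ^ D, ∀ i < D, digits b C i = dig i := by
  induction D generalizing dig with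
  | zero => exact ⟨0, by simp, by simp⟩
  | succ D ih =>
    obtain ⟨C, hC, hd⟩ := ih (fun i => dig (i + 1)) fun i hi => h (i + 1) (by omega)
    have h0 := h 0 (by omega)
    refine ⟨dig 0 + b * C, ?_, fun i hi => ?_⟩
    · rw [pow_succ']
      calc dig 0 + b * C < b + b * C := by omega
        _ = b * (C + 1) := by ring
        _ ≤ b * b ^ D := Nat.mul_le_mul_left _ hC
    · rcases i with _ | i
      · simp [digits, Nat.mod_eq_of_lt h0]
      · rw [digits, pow_succ', ← Nat.div_div_eq_div_mul, Nat.add_mul_div_left _ _ (by omega),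
          Nat.div_eq_of_lt h0, zero_add]
        exact hd i (by omega)

/-- Divisibility of `C + 1` by `b ^ i` means that the lowest `i` digits of `C` are all `b - 1`, that
is, that the carry reaches position `i`. -/
theorem pow_succ_dvd_succ_iff {b C i : ℕ} (hb : 0 < b) (h : b ^ i ∣ C + 1) :
    b ^ (i + 1) ∣ C + 1 ↔ digits b C i + 1 = b := by
  obtain ⟨m, hm⟩ := h
  have hx : C / b ^ i + 1 = m := by
    have := Nat.succ_div (a := C) (b := b ^ i)
    rw [if_pos ⟨m, hm⟩, hm, Nat.mul_div_cancel_left _ (by positivity)] at this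
    exact this.symm
  have hr := Nat.mod_lt (C / b ^ i) hb
  rw [hm, pow_succ, Nat.mul_dvd_mul_iff_left (by positivity), ← hx, digits]
  rw [← Nat.div_add_mod (C / b ^ i) b, add_assoc, Nat.dvd_add_right (dvd_mul_right _ _),
    Nat.mul_add_mod, Nat.mod_mod]
  constructor
  · intro h
    have := Nat.le_of_dvd (by omega) h
    omega
  · intro h
    rw [h]

theorem digits_succ_of_dvd {b C i j : ℕ} (hb : 0 < b) (h : b ^ i ∣ C + 1) (hj : j < i) :
    digits b (C + 1) j = 0 := by
  obtain ⟨m, hm⟩ := h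
  obtain ⟨d, rfl⟩ := Nat.exists_eq_add_of_lt hj
  rw [digits, hm, pow_succ, pow_add, mul_assoc, mul_assoc,
    Nat.mul_div_cancel_left _ (by positivity), mul_left_comm]
  exact Nat.mul_mod_right _ _

theorem digits_succ_of_lt {b C i j : ℕ} (h : ¬ b ^ (i + 1) ∣ C + 1) (hj : i < j) :
    digits b (C + 1) j = digits b C j := by
  rw [digits, Nat.succ_div, if_neg, add_zero, digits]
  exact fun h' => h ((pow_dvd_pow b hj).trans h')

theorem digits_succ_self {b C i : ℕ} (hb : 0 < b) (h : b ^ i ∣ C + 1)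
    (h' : ¬ b ^ (i + 1) ∣ C + 1) : digits b (C + 1) i = digits b C i + 1 := by
  have hx := (pow_succ_dvd_succ_iff hb h).not.1 h'
  have hr : digits b C i < b := Nat.mod_lt _ hb
  rw [digits, Nat.succ_div, if_pos h, ← Nat.mod_add_mod]
  exact Nat.mod_eq_of_lt (by rw [digits] at hx hr; omega)

theorem digits_eq_zero {b C D i : ℕ} (hb : 0 < b) (h : C < b ^ D) (hi : D ≤ i) :
    digits b C i = 0 := by
  rw [digits, Nat.div_eq_of_lt (h.trans_le (Nat.pow_le_pow_right hb hi)), Nat.zero_mod]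

/-! ### Incrementing the counter -/

namespace Ram

variable {W : ℕ}

/-- Total correctness of a loop with at most `N` iterations. -/
theorem wp_loop_le {e : Exp} {p : Prog} {Q : ℕ → Store → Prop} (N : ℕ) (I : ℕ → ℕ → Store → Prop)
    {s : Store} (h0 : I 0 0 s) (hfit : ∀ j t s₁, I j t s₁ → Frame p s s₁ → e.Fits W s₁)
    (hstep : ∀ j t s₁, I j t s₁ → Frame p s s₁ → e.eval s₁ ≠ 0 →
      j < N ∧ wp W p s₁ fun t' s₂ => I (j + 1) (t + (e.cost + 1 + t')) s₂)
    (hend : ∀ j t s₁, I j t s₁ → Frame p s s₁ → e.eval s₁ = 0 → Q (t + (e.cost + 1)) s₁) :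
    wp W (.loop e p) s Q := by
  suffices H : ∀ d j t s₁, N ≤ j + d → I j t s₁ → Frame p s s₁ →
      wp W (.loop e p) s₁ fun t' s₂ => Q (t + t') s₂ by
    simpa using H N 0 0 s (by omega) h0 (Frame.refl _ _)
  intro d
  induction d with
  | zero =>
    intro j t s₁ hd hI hF
    have hv : e.eval s₁ = 0 := by
      by_contra hv
      have := (hstep j t s₁ hI hF hv).1
      omega
    exact ⟨_, _, .loop_false (hfit j t s₁ hI hF) hv, hend j t s₁ hI hF hv⟩
  | succ d ih =>
    intro j t s₁ hd hI hF
    by_cases hv : e.eval s₁ = 0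
    · exact ⟨_, _, .loop_false (hfit j t s₁ hI hF) hv, hend j t s₁ hI hF hv⟩
    · obtain ⟨t', s₂, hr, hI'⟩ := (hstep j t s₁ hI hF hv).2
      obtain ⟨t'', s₃, hr', hq⟩ := ih (j + 1) _ s₂ (by omega) hI' (hF.trans hr.frame)
      refine ⟨_, _, .loop_true (hfit j t s₁ hI hF) hv hr hr', ?_⟩
      convert hq using 1
      ring

/-- Count up by one in array `11`, with digits to the base `K + 3`. -/
def incProg : Prog :=
  .seq (.set 10 (.const 0)) (.seq
    (.loop (.eq (.cell 11 (.reg 10)) (.add (.reg 3) (.const 2)))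
      (.seq (.put 11 (.reg 10) (.const 0)) (.set 10 (.add (.reg 10) (.const 1)))))
    (.put 11 (.reg 10) (.add (.cell 11 (.reg 10)) (.const 1))))

theorem wp_incProg {s : Store} {K C D : ℕ} (hW : D + K + 5 ≤ W) (h3 : s.reg 3 = K)
    (h11 : s.arr 11 = digits (K + 3) C) (hC : C + 1 < (K + 3) ^ (D + 1)) :
    wp W incProg s fun T s' => T ≤ 15 * (D + 1) + 15 ∧ s'.arr 11 = digits (K + 3) (C + 1) := by
  have hlt : ∀ i, digits (K + 3) C i < K + 3 := fun i => Nat.mod_lt _ (by omega)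
  -- The carry stops at position `D` at the latest, since `C + 1` still fits into `D + 1` digits.
  have hle : ∀ i, (K + 3) ^ i ∣ C + 1 → i ≤ D := by
    intro i hi
    by_contra h
    have := Nat.le_of_dvd (by omega) hi
    have := Nat.pow_le_pow_right (show 0 < K + 3 by omega) (show D + 1 ≤ i by omega)
    omega
  unfold incProg
  rw [wp_seq, wp_set]
  refine ⟨by simp [Exp.Fits], ?_⟩
  simp only [Exp.eval, Exp.cost]
  refine wp_seq_of (Q' := fun T s' => T ≤ 15 * (D + 1) + 6 ∧ ∃ i, s'.reg 10 = i ∧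
    (K + 3) ^ i ∣ C + 1 ∧ ¬ (K + 3) ^ (i + 1) ∣ C + 1 ∧
    ∀ j, s'.arr 11 j = if j < i then 0 else digits (K + 3) C j) ?_ ?_
  · refine wp_loop_le (D + 1) (fun i T s' => T ≤ 15 * i ∧ s'.reg 10 = i ∧ (K + 3) ^ i ∣ C + 1 ∧
      ∀ j, s'.arr 11 j = if j < i then 0 else digits (K + 3) C j) ?_ ?_ ?_ ?_
    · simp [Store.setReg_reg, h11]
    · rintro i T s₁ ⟨-, h10, hd, ha⟩ hF
      have e3 : s₁.reg 3 = K := by rw [hF.1 _ rfl, Store.setReg_reg]; simpa using h3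
      have := hle i hd
      have := hlt i
      simp only [Exp.Fits, Exp.eval, h10, e3, ha, lt_irrefl, if_false]
      omega
    · rintro i T s₁ ⟨hT, h10, hd, ha⟩ hF hev
      have e3 : s₁.reg 3 = K := by rw [hF.1 _ rfl, Store.setReg_reg]; simpa using h3
      have hi := hle i hd
      refine ⟨by omega, ?_⟩
      have hdig : digits (K + 3) C i + 1 = K + 3 := by
        by_contra h
        simp only [Exp.eval, h10, e3, ha, lt_irrefl, if_false] at hev
        rw [if_neg (by omega)] at hev
        exact hev rfl
      simp only [wp_seq, wp_put, wp_set, Exp.Fits, Exp.eval, Exp.cost, h10, Store.setCell_reg,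
        Store.setReg_reg, Store.setReg_arr, Store.setCell_arr, reduceIte]
      refine ⟨by omega, by omega, by omega, by omega, trivial, (pow_succ_dvd_succ_iff (by omega) hd).2 hdig,
        fun j => ?_⟩
      rw [Function.update_apply, ha]
      split_ifs <;> first | rfl | omega
    · rintro i T s₁ ⟨hT, h10, hd, ha⟩ hF hev
      have e3 : s₁.reg 3 = K := by rw [hF.1 _ rfl, Store.setReg_reg]; simpa using h3
      have := hle i hd
      refine ⟨by simp only [Exp.cost]; omega, i, h10, hd, ?_, ha⟩
      rw [pow_succ_dvd_succ_iff (by omega) hd]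
      intro h
      simp only [Exp.eval, h10, e3, ha, lt_irrefl, if_false] at hev
      rw [if_pos (by omega)] at hev
      exact one_ne_zero hev
  · rintro T s₁ ⟨hT, i, h10, hd, hnd, ha⟩ -
    have := hle i hd
    have := hlt i
    have hs := digits_succ_self (by omega) hd hnd
    simp only [wp_put, Exp.Fits, Exp.eval, Exp.cost, h10, ha, lt_irrefl, if_false]
    refine ⟨by omega, by omega, by omega, ?_⟩
    funext j
    simp only [Store.setCell_arr, reduceIte, Function.update_apply, ha]
    rcases lt_trichotomy j i with h | h | h
    · rw [if_neg h.ne, if_pos h, digits_succ_of_dvd (by omega) hd h]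
    · rw [if_pos h, h, hs]
    · rw [if_neg h.ne', if_neg (by omega), digits_succ_of_lt hnd h]

end Ram

/-! ### Search through all guesses and the insertion step -/

namespace Ram

open Flip

variable {W K : ℕ} {L : ListGraph}

/-- The sides found from the guess `dig`. -/
def result (L : ListGraph) (pr sd cls : ℕ → ℕ) (v D : ℕ) (dig : ℕ → ℕ) : ℕ → ℕ :=
  newSide (Function.update sd v (1 - dig D))
    (run L pr (Function.update sd v (1 - dig D)) cls (fun m _ => dig m) v (L.n + 1)).q

/-- Try all guesses. -/
def searchProg : Prog :=
  .loop (.mul (.eq (.reg 6) (.const 0)) (.lt (.cell 11 (.reg 5)) (.const 2)))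
    (.seq tryProg (.cond (.reg 6) .skip incProg))

/-- Guesses need only the digits 0 to `K + 1`. The base `K + 3` is at least 3 even for `K = 0`, so
the top digit can reach 2, which signals the end of the search without overflow. -/
theorem two_mul_pow_lt (K D : ℕ) : 2 * (K + 3) ^ D < (K + 3) ^ (D + 1) := by
  have : 0 < (K + 3) ^ D := by positivity
  rw [pow_succ']
  exact Nat.mul_lt_mul_of_pos_right (by omega) this

theorem wp_searchProg {pr sd cls : ℕ → ℕ} {s : Store} {v D : ℕ} (hW : Wide L K W) (hK : K ≤ L.n)
    (hv : v < L.n) (hS : Static L K pr sd cls (digits (K + 3) 0) s) (h2 : s.reg 2 = v)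
    (h3 : s.reg 3 = K) (h4 : s.reg 4 = 2 * L.n + 7) (h5 : s.reg 5 = D) (hD : D ≤ 2 * L.n + 1)
    (h6 : s.reg 6 = 0) (hpv : pr v = 0) :
    wp W searchProg s fun T s' =>
      T ≤ 2 * (K + 3) ^ D * (1300 * (L.n + L.off L.n + 1)) + 9 ∧ s'.reg 6 ≤ 1 ∧
      (∀ i, D < i → s'.arr 11 i = 0) ∧
      (s'.reg 6 = 1 → s'.arr 3 = Function.update pr v 1 ∧
        L.Good (Function.update pr v 1) (s'.arr 12) K ∧ ∀ u < L.n, s'.arr 12 u ≤ 1) ∧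
      (s'.reg 6 = 0 → s'.arr 3 = pr ∧ (∃ a ≤ 1, s'.arr 2 = Function.update sd v a) ∧
        ∀ C < 2 * (K + 3) ^ D, ¬ L.Good (Function.update pr v 1)
          (result L pr sd cls v D (digits (K + 3) C)) K) := by
  have hl := hW.lin
  have hpow : 0 < (K + 3) ^ D := by positivity
  have hpow' := two_mul_pow_lt K D
  have hlt : ∀ C i, digits (K + 3) C i < K + 3 := fun C i => Nat.mod_lt _ (by omega)
  have hDl : ∀ C < (K + 3) ^ (D + 1), digits (K + 3) C D = C / (K + 3) ^ D := by
    intro C hC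
    rw [digits, Nat.mod_eq_of_lt]
    rwa [Nat.div_lt_iff_lt_mul (by positivity), ← pow_succ']
  set N := L.n + L.off L.n + 1 with hN
  -- `C` counts the rounds and `C'` is the value of the counter. They agree until a round succeeds;
  -- then the counter is not advanced.
  refine wp_loop_le (2 * (K + 3) ^ D) (fun C T s' => C ≤ 2 * (K + 3) ^ D ∧
    T ≤ C * (1300 * N) ∧ ∃ C' ≤ 2 * (K + 3) ^ D, s'.arr 11 = digits (K + 3) C' ∧
    ((s'.reg 6 = 0 ∧ C' = C ∧
      (∃ a ≤ 1, Static L K pr (Function.update sd v a) cls (digits (K + 3) C) s') ∧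
      ∀ c < C, ¬ L.Good (Function.update pr v 1) (result L pr sd cls v D (digits (K + 3) c)) K) ∨
    (s'.reg 6 = 1 ∧ s'.arr 3 = Function.update pr v 1 ∧
      L.Good (Function.update pr v 1) (s'.arr 12) K ∧ ∀ u < L.n, s'.arr 12 u ≤ 1))) ?_ ?_ ?_ ?_
  · refine ⟨by omega, by omega, 0, by omega, hS.arr11, Or.inl ⟨h6, rfl, ⟨sd v, hS.sd_le v hv, ?_⟩, ?_⟩⟩
    · rw [Function.update_eq_self]; exact hS
    · intro c hc; omega
  · rintro C T s₁ ⟨hC, hT, C', hC', ha, h⟩ hF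
    have e5 : s₁.reg 5 = D := by rw [hF.1 _ rfl, h5]
    have e6 : s₁.reg 6 ≤ 1 := by rcases h with h | h <;> omega
    have := hlt C' D
    have e : ∀ p : Prop, [Decidable p] → (if p then 1 else 0) ≤ 1 := by
      intro p _; split_ifs <;> omega
    simp only [Exp.Fits, Exp.eval, e5, ha]
    have b1 := e (s₁.reg 6 = 0)
    have b2 := e (digits (K + 3) C' D < 2)
    exact ⟨by omega, by omega, (Nat.mul_le_mul b1 b2).trans (by omega)⟩
  · rintro C T s₁ ⟨hC, hT, C', hC', ha, h⟩ hF hev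
    have e5 : s₁.reg 5 = D := by rw [hF.1 _ rfl, h5]
    have e4 : s₁.reg 4 = 2 * L.n + 7 := by rw [hF.1 _ rfl, h4]
    have e3 : s₁.reg 3 = K := by rw [hF.1 _ rfl, h3]
    have e2 : s₁.reg 2 = v := by rw [hF.1 _ rfl, h2]
    simp only [Exp.eval, e5, ha] at hev
    have hr6 : s₁.reg 6 = 0 := by by_contra h; simp [h] at hev
    have hdig : digits (K + 3) C' D < 2 := by by_contra h; simp [h] at hev
    obtain ⟨-, rfl, ⟨a, ha1, hS₁⟩, hfail⟩ : _ := h.resolve_right (by omega)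
    rw [hDl C' (by omega), Nat.div_lt_iff_lt_mul (by positivity)] at hdig
    refine ⟨hdig, ?_⟩
    refine wp_seq_of (wp_tryProg hW hK hv hS₁ e2 e3 e4 e5 hD hpv) ?_
    rintro T₁ s₂ ⟨hT₁, h6₁, hiff, hok, hno, h12, ha2⟩ hF₁
    rw [Function.update_idem] at hiff ha2
    have hmul : (C' + 1) * (1300 * N) = C' * (1300 * N) + 1300 * N := by ring
    have e11 : s₂.arr 11 = digits (K + 3) C' := by rw [hF₁.2 _ rfl, ha]
    rw [wp_cond]
    refine ⟨by simp only [Exp.Fits]; omega, fun hv6 => ?_, fun hv6 => ?_⟩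
    · simp only [Exp.eval] at hv6
      rw [wp_skip]
      obtain ⟨k1, k2⟩ := hok (by omega)
      refine ⟨by omega, by simp only [Exp.cost]; omega, C', hC', e11, Or.inr ⟨by omega, k1, k2, h12⟩⟩
    · simp only [Exp.eval] at hv6
      have e3' : s₂.reg 3 = K := by rw [hF₁.1 _ rfl, e3]
      refine (wp_incProg (W := W) (D := D) (by omega) e3' e11 (by omega)).frame.mono ?_
      rintro T₂ s₃ ⟨⟨hT₂, h11⟩, hF₂⟩
      have hda : digits (K + 3) C' D ≤ 1 := by
        rw [hDl C' (by omega)]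
        have : C' / (K + 3) ^ D < 2 := by rwa [Nat.div_lt_iff_lt_mul (by positivity)]
        omega
      have hle1 : 1 - digits (K + 3) C' D ≤ 1 := by omega
      have hS₂ := hS₁.holds.frame hF₁ rfl rfl rfl
      have hS₃ := hS₂.frame hF₂ rfl rfl rfl
      refine ⟨by omega, by simp only [Exp.cost]; omega, C' + 1, by omega, h11,
        Or.inl ⟨by rw [hF₂.1 _ rfl, hv6], rfl, ⟨_, hle1, ?_⟩, ?_⟩⟩
      · refine ⟨hS₃, ?_, ?_, ?_, ?_, h11, hS.pr_le, ?_, hS.cls_le, fun i => ?_⟩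
        · rw [HasAdj, hF₂.2 _ rfl, hF₁.2 _ rfl]; exact hS₁.adj
        · rw [hF₂.2 _ rfl, hno (by omega)]
        · rw [hF₂.2 _ rfl, ha2]
        · rw [hF₂.2 _ rfl, hF₁.2 _ rfl, hS₁.arr5]
        · intro u hu
          have := hS.sd_le u hu
          rw [Function.update_apply]
          split_ifs <;> omega
        · have := hlt (C' + 1) i
          omega
      · intro c hc
        rcases Nat.lt_succ_iff_lt_or_eq.1 hc with h | rfl
        · exact hfail c h
        · exact fun hg => absurd (hiff.2 hg) (by omega)
  · rintro C T s₁ ⟨hC, hT, C', hC', ha, h⟩ hF hev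
    have e5 : s₁.reg 5 = D := by rw [hF.1 _ rfl, h5]
    simp only [Exp.eval, e5, ha] at hev
    have hmul := Nat.mul_le_mul_right (1300 * N) hC
    refine ⟨by simp only [Exp.cost]; omega, by rcases h with h | h <;> omega, ?_, ?_, ?_⟩
    · intro i hi
      rw [ha, digits_eq_zero (D := D + 1) (by omega) (by omega) (by omega)]
    · intro h6'
      exact (h.resolve_left (by omega)).2
    · intro h6'
      obtain ⟨-, rfl, ⟨a, ha1, hS₁⟩, hfail⟩ : _ := h.resolve_right (by omega)
      have hdig : ¬ digits (K + 3) C' D < 2 := by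
        intro h; simp [h, h6'] at hev
      rw [hDl C' (by omega), Nat.div_lt_iff_lt_mul (by positivity)] at hdig
      have : C' = 2 * (K + 3) ^ D := by omega
      exact ⟨hS₁.arr3, ⟨a, ha1, hS₁.arr2⟩, this ▸ hfail⟩

/-- The old side of the absent vertex `v` is immaterial, so it may be chosen opposite to `σ v`. The
fitting guesses with `σ v` as top digit are the digits of some `C`, and a top digit of at most 1
gives the bound on `C`. -/
theorem exists_good_result {pr sd cls σ : ℕ → ℕ} {v : ℕ} (hv : v < L.n) (pv : pr v = 0)
    (cv : cls v = 2 * L.n + 1) (num : L.IsNumbering pr sd K cls) (hsd : ∀ u < L.n, sd u ≤ 1)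
    (hσ : ∀ u < L.n, σ u ≤ 1) (hg : L.Good (Function.update pr v 1) σ K) :
    ∃ C < 2 * (K + 3) ^ (2 * K + 1), L.Good (Function.update pr v 1)
      (result L pr sd cls v (2 * K + 1) (digits (K + 3) C)) K := by
  have hσv := hσ v hv
  have num' : L.IsNumbering pr (Function.update sd v (1 - σ v)) K cls := by
    have h : ∀ u, pr u ≠ 0 → Function.update sd v (1 - σ v) u = sd u := by
      intro u hu
      rw [Function.update_of_ne]
      rintro rfl
      exact hu pv
    refine ⟨fun u hu w hw pu pw hs => ?_, fun u hu pu hs => ?_, fun u hu pu hs => ?_⟩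
    · rw [h u pu, h w pw] at hs
      exact num.eq_iff u hu w hw pu pw hs
    · rw [h u pu] at hs
      exact num.left u hu pu hs
    · rw [h u pu] at hs
      exact num.right u hu pu hs
  obtain ⟨f, S⟩ := exists_solution hv cv num' (by
    intro u hu
    have := hsd u hu
    rw [Function.update_apply]
    split_ifs <;> omega) hσ (by rw [Function.update_self]; omega) hg
  obtain ⟨dig, hlt, hd⟩ := S.exists_guess
  obtain ⟨C, hC, hdig⟩ := exists_digits (b := K + 3) (2 * K + 1 + 1)
    (Function.update dig (2 * K + 1) (σ v)) (by
      intro i hi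
      have := hlt i
      rw [Function.update_apply]
      split_ifs <;> omega)
  have hD := hdig (2 * K + 1) (by omega)
  rw [Function.update_self] at hD
  refine ⟨C, ?_, ?_⟩
  · rw [digits, Nat.mod_eq_of_lt] at hD
    · rw [← Nat.div_lt_iff_lt_mul (by positivity), hD]
      omega
    · rwa [Nat.div_lt_iff_lt_mul (by positivity), ← pow_succ']
  · rw [result, hD]
    refine hd _ fun i hi => ?_
    rw [hdig i (by omega), Function.update_of_ne (by omega)]

/-- Extend the 2-subcoloring of the present vertices by the vertex in register `2`. -/
def inductProg : Prog :=
  .seq (clsProg 2 5) (.seq (.put 5 (.reg 2) (.add (.mul (.const 2) (.reg 0)) (.const 1)))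
    (.seq (forTo 10 4 (.put 11 (.reg 10) (.const 0))) (.seq (.set 6 (.const 0)) (.seq searchProg
      (.cond (.reg 6) (forTo 10 0 (.put 2 (.reg 10) (.cell 12 (.reg 10)))) .skip)))))

theorem wp_inductProg {pr sd : ℕ → ℕ} {s : Store} {v : ℕ} (hW : Wide L K W) (hK : K ≤ L.n)
    (hv : v < L.n) (hL : L.Holds s) (hA : HasAdj L s) (h3a : s.arr 3 = pr) (h2a : s.arr 2 = sd)
    (hp : ∀ u < L.n, pr u ≤ 1) (hs : ∀ u < L.n, sd u ≤ 1)
    (hz : ∀ i, 2 * K + 1 < i → s.arr 11 i = 0) (h2 : s.reg 2 = v)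
    (h3 : s.reg 3 = K) (h4 : s.reg 4 = 2 * L.n + 7) (h5 : s.reg 5 = 2 * K + 1)
    (hpv : pr v = 0) (hg : L.Good pr sd K) :
    wp W inductProg s fun T s' =>
      T ≤ 2000 * ((K + 3) ^ (2 * K + 1) * (2 * (L.n + L.off L.n + 1))) ∧ s'.reg 6 ≤ 1 ∧
      (∀ i, 2 * K + 1 < i → s'.arr 11 i = 0) ∧ (∀ u < L.n, s'.arr 2 u ≤ 1) ∧
      (s'.reg 6 = 1 → s'.arr 3 = Function.update pr v 1 ∧
        L.Good (Function.update pr v 1) (s'.arr 2) K) ∧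
      (s'.reg 6 = 0 → ¬ ∃ σ : ℕ → ℕ, (∀ u < L.n, σ u ≤ 1) ∧
        L.Good (Function.update pr v 1) σ K) := by
  have hl := hW.lin
  have hpow : 0 < (K + 3) ^ (2 * K + 1) := by positivity
  unfold inductProg
  refine wp_seq_of (wp_clsProg hW hL h3a h2a (by decide) (by decide) (by decide) (by decide) hp hs) ?_
  rintro T₁ s₁ ⟨hT₁, hc, -⟩ hF₁
  rw [wp_seq, wp_put]
  have e2 : s₁.reg 2 = v := by rw [hF₁.1 _ rfl, h2]
  have e0 : s₁.reg 0 = L.n := by rw [hF₁.1 _ rfl, hL.reg]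
  simp only [Exp.Fits, Exp.eval, Exp.cost, e2, e0]
  refine ⟨by omega, by omega, ?_⟩
  set s₂ := s₁.setCell 5 v (2 * L.n + 1) with hs₂
  have r2 : s₂.reg = s₁.reg := rfl
  refine wp_seq_of (wp_fill (N := 2 * L.n + 7) (by rw [r2, hF₁.1 _ rfl, h4]) (by decide)
    (by omega)) ?_
  rintro T₃ s₃ ⟨hT₃, hz₃⟩ hF₃
  rw [wp_seq, wp_set]
  refine ⟨by simp [Exp.Fits], ?_⟩
  simp only [Exp.eval, Exp.cost]
  have h11 : s₃.arr 11 = digits (K + 3) 0 := by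
    funext i
    rw [hz₃ i, digits, Nat.zero_div, Nat.zero_mod]
    split_ifs with h
    · rfl
    · have : s₂.arr 11 = s.arr 11 := by rw [hs₂, Store.setCell_arr]; exact hF₁.2 _ rfl
      rw [this, hz i (by omega)]
  have h5a : s₃.arr 5 = s₂.arr 5 := hF₃.2 _ rfl
  set cls := s₂.arr 5 with hcls
  -- Numbers on side 0 are at most `2 * L.n - 1`, so this odd number makes `v` a cluster of its own
  -- on either side.
  have hcv : cls v = 2 * L.n + 1 := by simp [hcls, hs₂, Store.setCell_arr]
  have hcu : ∀ u < L.n, u ≠ v → cls u = (L.clsRun pr sd L.n).1 u := by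
    intro u hu huv
    simp only [hcls, hs₂, Store.setCell_arr, reduceIte, Function.update_of_ne huv, hc u hu]
  have num : L.IsNumbering pr sd K cls := by
    have h := L.isNumbering_clsRun pr sd hg
    have hne : ∀ u, pr u ≠ 0 → u ≠ v := by rintro u hu rfl; exact hu hpv
    refine ⟨fun u hu w hw pu pw hs => ?_, fun u hu pu hs => ?_, fun u hu pu hs => ?_⟩
    · rw [hcu u hu (hne u pu), hcu w hw (hne w pw)]
      exact h.eq_iff u hu w hw pu pw hs
    · rw [hcu u hu (hne u pu)]
      exact h.left u hu pu hs
    · rw [hcu u hu (hne u pu)]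
      exact h.right u hu pu hs
  have hS₃ : Static L K pr sd cls (digits (K + 3) 0) s₃ := by
    refine ⟨(hL.frame hF₁ rfl rfl rfl).congr ?_ ?_ ?_, ?_, ?_, ?_, h5a, h11, hp, hs,
      fun u hu => ?_, fun i => ?_⟩
    · rw [hF₃.1 _ rfl, r2]
    · rw [hF₃.2 _ rfl]; rfl
    · rw [hF₃.2 _ rfl]; rfl
    · have : s₃.arr 4 = s.arr 4 := by rw [hF₃.2 _ rfl, ← hF₁.2 _ rfl]; rfl
      rw [HasAdj, this]; exact hA
    · rw [hF₃.2 _ rfl, ← h3a, ← hF₁.2 _ rfl]; rfl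
    · rw [hF₃.2 _ rfl, ← h2a, ← hF₁.2 _ rfl]; rfl
    · by_cases h : u = v
      · rw [h, hcv]
      · have := (clsRun_le L pr sd le_rfl u).1
        rw [hcu u hu h]; omega
    · have : digits (K + 3) 0 i < K + 3 := Nat.mod_lt _ (by omega)
      omega
  refine wp_seq_of (wp_searchProg hW hK hv (hS₃.setReg (x := 6) (a := 0) (by decide)) ?_ ?_ ?_ ?_
    (show 2 * K + 1 ≤ 2 * L.n + 1 by omega) ?_ hpv) ?_
  · simp [Store.setReg_reg, hF₃.1 2 rfl, r2, e2]
  · simp [Store.setReg_reg, hF₃.1 3 rfl, r2, hF₁.1 3 rfl, h3]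
  · simp [Store.setReg_reg, hF₃.1 4 rfl, r2, hF₁.1 4 rfl, h4]
  · simp [Store.setReg_reg, hF₃.1 5 rfl, r2, hF₁.1 5 rfl, h5]
  · simp [Store.setReg_reg]
  rintro T₄ s₄ ⟨hT₄, h6, hz₄, hok, hno⟩ hF₄
  have hL₄ : L.Holds s₄ := (hS₃.setReg (x := 6) (a := 0) (by decide)).holds.frame hF₄ rfl rfl rfl
  have hbig : L.n + L.off L.n + 1 ≤ (K + 3) ^ (2 * K + 1) * (L.n + L.off L.n + 1) :=
    Nat.le_mul_of_pos_left _ hpow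
  have hmul1 : 2 * (K + 3) ^ (2 * K + 1) * (1300 * (L.n + L.off L.n + 1)) =
    2600 * ((K + 3) ^ (2 * K + 1) * (L.n + L.off L.n + 1)) := by ring
  have hmul2 : 2000 * ((K + 3) ^ (2 * K + 1) * (2 * (L.n + L.off L.n + 1))) =
    4000 * ((K + 3) ^ (2 * K + 1) * (L.n + L.off L.n + 1)) := by ring
  rw [hmul2]
  rw [hmul1] at hT₄
  rw [wp_cond]
  refine ⟨by simp only [Exp.Fits]; omega, fun h => ?_, fun h => ?_⟩
  · simp only [Exp.eval] at h
    obtain ⟨k1, k2, k3⟩ := hok (by omega)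
    refine (wp_forTo_const L.n 5 (fun j s' => ∀ u < j, s'.arr 2 u = s₄.arr 12 u) hL₄.reg
      (by decide) rfl rfl (by omega) (by simp) ?_).frame.mono ?_
    · intro j s₅ hj hji hI hF
      have e12 : s₅.arr 12 = s₄.arr 12 := hF.2 _ rfl
      have := k3 j hj
      simp only [wp_put, Exp.Fits, Exp.eval, Exp.cost, hji, e12, Store.setReg_arr,
        Store.setCell_arr, reduceIte]
      refine ⟨by omega, by omega, by omega, fun u hu => ?_⟩
      rw [Function.update_apply]
      split_ifs with h
      · rw [h]
      · exact hI u (by omega)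
    · rintro T₅ s₅ ⟨⟨hT₅, hI⟩, hF₅⟩
      have e6 : s₅.reg 6 = s₄.reg 6 := hF₅.1 _ rfl
      refine ⟨by simp only [Exp.cost]; omega, by omega, ?_, ?_, ?_, fun h => by omega⟩
      · rw [hF₅.2 _ rfl]; exact hz₄
      · intro u hu
        rw [hI u hu]; exact k3 u hu
      · intro _
        refine ⟨by rw [hF₅.2 _ rfl, k1], ?_⟩
        obtain ⟨f, hf, hf'⟩ := k2
        refine ⟨f, fun u hu w hw pu pw hsd => ?_, fun u hu pu hsd => ?_⟩
        · rw [hI u hu, hI w hw] at hsd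
          exact hf u hu w hw pu pw hsd
        · rw [hI u hu] at hsd
          exact hf' u hu pu hsd
  · simp only [Exp.eval] at h
    obtain ⟨k1, ⟨a, ha, k2⟩, k3⟩ := hno h
    rw [wp_skip]
    refine ⟨by simp only [Exp.cost]; omega, by omega, hz₄, ?_, fun h => by omega, ?_⟩
    · intro u hu
      have := hs u hu
      rw [k2, Function.update_apply]
      split_ifs <;> omega
    · rintro - ⟨σ, hσ, hσg⟩
      obtain ⟨C, hC, hC'⟩ := exists_good_result hv hpv hcv num hs hσ hσg
      exact k3 C hC hC'

end Ram

/-! ### Heredity and isolated vertices -/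

namespace ListGraph

variable {L : ListGraph} {K : ℕ}

/-- Validity passes to subsets of the present vertices; so an insertion that fails on an induced
subgraph excludes a solution for the whole graph. -/
theorem Good.congr {pr pr' sd sd' : ℕ → ℕ} (h : L.Good pr sd K)
    (hp : ∀ u < L.n, pr' u ≠ 0 → pr u ≠ 0) (hs : ∀ u < L.n, pr' u ≠ 0 → sd' u = sd u) :
    L.Good pr' sd' K := by
  obtain ⟨f, hf, hf'⟩ := h
  refine ⟨f, fun u hu w hw pu pw hsd => ?_, fun u hu pu hsd => ?_⟩
  · rw [hs u hu pu, hs w hw pw] at hsd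
    exact hf u hu w hw (hp u hu pu) (hp w hw pw) hsd
  · rw [hs u hu pu] at hsd
    exact hf' u hu (hp u hu pu) hsd

/-- Isolated vertices can be put on side `0`. -/
theorem Good.add_isolated {pr sd : ℕ → ℕ} (h : L.Good pr sd K)
    (hp : ∀ u < L.n, L.nb u ≠ [] → pr u ≠ 0) :
    L.Good (fun _ => 1) (fun u => if L.nb u = [] then 0 else sd u) K := by
  obtain ⟨f, hf, hf'⟩ := h
  -- `B` exceeds all cluster numbers in use, so `B + u` is a new number for each isolated vertex
  -- `u`.
  set B := ∑ u ∈ Finset.range L.n, (f u + 1) with hB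
  have hlt : ∀ u < L.n, f u < B := by
    intro u hu
    have := Finset.single_le_sum (f := fun u => f u + 1) (fun _ _ => Nat.zero_le _)
      (Finset.mem_range.2 hu)
    omega
  have hnil : ∀ u w, L.nb u = [] → w ∉ L.nb u ∧ u ∉ L.nb w := by
    intro u w hu
    have : w ∉ L.nb u := by simp [hu]
    exact ⟨this, fun h => this (L.symm h)⟩
  refine ⟨fun u => if L.nb u = [] then B + u else f u, fun u hu w hw _ _ hsd => ?_,
    fun u hu _ hsd => ?_⟩
  · have h1 := hlt u hu
    have h2 := hlt w hw
    dsimp only at hsd ⊢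
    by_cases hu' : L.nb u = [] <;> by_cases hw' : L.nb w = []
    · simp only [if_pos hu', if_pos hw', (hnil u w hu').1, or_false]
      omega
    · simp only [if_pos hu', if_neg hw', (hnil u w hu').1, or_false]
      constructor
      · intro h; omega
      · rintro rfl; exact absurd hu' hw'
    · simp only [if_neg hu', if_pos hw', (hnil w u hw').2, or_false]
      constructor
      · intro h; omega
      · rintro rfl; exact absurd hw' hu'
    · simp only [if_neg hu', if_neg hw'] at hsd ⊢
      exact hf u hu w hw (hp u hu hu') (hp w hw hw') hsd
  · dsimp only at hsd ⊢
    by_cases hu' : L.nb u = []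
    · simp [if_pos hu'] at hsd
    · rw [if_neg hu'] at hsd ⊢
      exact hf' u hu (hp u hu hu') hsd

/-- The number of vertices that are not isolated. -/
def support (L : ListGraph) : ℕ := ((Finset.range L.n).filter fun u => L.nb u ≠ []).card

theorem support_le_n : L.support ≤ L.n :=
  (Finset.card_filter_le _ _).trans_eq (Finset.card_range _)

theorem support_le_off : L.support ≤ L.off L.n := by
  rw [support, Finset.card_filter, off]
  refine Finset.sum_le_sum fun u _ => ?_
  split_ifs with h
  · exact List.length_pos_iff.2 h
  · exact Nat.zero_le _

end ListGraph

/-! ### The two complete algorithms -/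

namespace Ram

variable {W K : ℕ} {L : ListGraph}

/-- Compute the parameters and the adjacency matrix. -/
def setupProg : Prog :=
  .seq (.set 4 (.add (.mul (.const 2) (.reg 0)) (.const 7)))
    (.seq (.cond (.lt (.reg 1) (.reg 0)) (.set 3 (.reg 1)) (.set 3 (.reg 0)))
      (.seq (.set 5 (.add (.mul (.const 2) (.reg 3)) (.const 1))) adjProg))

theorem wp_setupProg {s : Store} {k : ℕ} (hW : Wide L (min k L.n) W) (hk : k ≤ W) (hL : L.Holds s)
    (h1 : s.reg 1 = k) (h4 : ∀ i, s.arr 4 i = 0) :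
    wp W setupProg s fun T s' => T ≤ 100 * (L.n + L.off L.n + 1) ∧ HasAdj L s' ∧
      s'.reg 3 = min k L.n ∧ s'.reg 4 = 2 * L.n + 7 ∧ s'.reg 5 = 2 * min k L.n + 1 := by
  have hl := hW.lin
  unfold setupProg
  rw [wp_seq, wp_set]
  simp only [Exp.Fits, Exp.eval, Exp.cost, hL.reg]
  refine ⟨by omega, ?_⟩
  refine wp_seq_of (Q' := fun T s' => T ≤ 10 ∧ s'.reg 3 = min k L.n) ?_ ?_
  · rw [wp_cond]
    simp only [wp_set, Exp.Fits, Exp.eval, Exp.cost, Store.setReg_reg, Nat.reduceEqDiff,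
      OfNat.zero_ne_ofNat, OfNat.one_ne_ofNat, reduceIte, hL.reg, h1]
    refine ⟨by omega, fun h => ⟨by omega, by omega, ?_⟩, fun h => ⟨by omega, by omega, ?_⟩⟩
    · have : k < L.n := by by_contra h'; simp [h'] at h
      omega
    · have : ¬ k < L.n := by intro h'; simp [h'] at h
      omega
  rintro T₁ s₁ ⟨hT₁, h3⟩ hF₁
  rw [wp_seq, wp_set]
  simp only [Exp.Fits, Exp.eval, Exp.cost, h3]
  refine ⟨by omega, ?_⟩
  have e0 : s₁.reg 0 = L.n := by rw [hF₁.1 _ rfl, Store.setReg_reg]; exact hL.reg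
  have e4 : s₁.reg 4 = 2 * L.n + 7 := by rw [hF₁.1 _ rfl, Store.setReg_reg]; simp
  refine (wp_adjProg hW ⟨?_, ?_, ?_⟩ ?_).frame.mono ?_
  · simpa [Store.setReg_reg] using e0
  · rw [Store.setReg_arr, hF₁.2 _ rfl]; exact hL.off
  · rw [Store.setReg_arr, hF₁.2 _ rfl]; exact hL.nb
  · rw [Store.setReg_arr, hF₁.2 _ rfl]; exact h4
  · rintro T₂ s₂ ⟨⟨hT₂, hA⟩, hF₂⟩
    refine ⟨by omega, hA, ?_, ?_, ?_⟩
    · rw [hF₂.1 _ rfl, Store.setReg_reg]; exact h3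
    · rw [hF₂.1 _ rfl, Store.setReg_reg]; exact e4
    · rw [hF₂.1 _ rfl, Store.setReg_reg]; simp

/-- Extend a 2-subcoloring of all vertices but the one in register `2`. -/
def extendProg : Prog :=
  .seq setupProg (.seq (forTo 10 0 (.put 3 (.reg 10) (.const 1)))
    (.seq (.put 3 (.reg 2) (.const 0)) (.seq inductProg (.set 0 (.reg 6)))))

theorem wp_extendProg {s : Store} {k v : ℕ} {sd : ℕ → ℕ} (hW : Wide L (min k L.n) W) (hk : k ≤ W)
    (hL : L.Holds s) (h1 : s.reg 1 = k) (h2 : s.reg 2 = v) (hv : v < L.n)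
    (h3a : ∀ i, s.arr 3 i = 0) (h4a : ∀ i, s.arr 4 i = 0) (h11a : ∀ i, s.arr 11 i = 0)
    (h2a : s.arr 2 = sd) (hs : ∀ u < L.n, sd u ≤ 1)
    (hg : L.Good (fun u => if u = v then 0 else 1) sd (min k L.n)) :
    wp W extendProg s fun T s' =>
      T ≤ 3000 * ((min k L.n + 3) ^ (2 * min k L.n + 1) * (2 * (L.n + L.off L.n + 1))) ∧
      s'.reg 0 ≤ 1 ∧
      (s'.reg 0 = 1 → L.Good (fun _ => 1) (s'.arr 2) (min k L.n) ∧ ∀ u < L.n, s'.arr 2 u ≤ 1) ∧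
      (s'.reg 0 = 0 → ¬ ∃ σ : ℕ → ℕ, (∀ u < L.n, σ u ≤ 1) ∧ L.Good (fun _ => 1) σ (min k L.n)) := by
  have hl := hW.lin
  have hpow : 0 < (min k L.n + 3) ^ (2 * min k L.n + 1) := by positivity
  have hbig : L.n + L.off L.n + 1 ≤
      (min k L.n + 3) ^ (2 * min k L.n + 1) * (L.n + L.off L.n + 1) :=
    Nat.le_mul_of_pos_left _ hpow
  unfold extendProg
  refine wp_seq_of (wp_setupProg hW hk hL h1 h4a) ?_
  rintro T₁ s₁ ⟨hT₁, hA, h3, h4, h5⟩ hF₁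
  have hL₁ : L.Holds s₁ := hL.frame hF₁ rfl rfl rfl
  refine wp_seq_of (wp_forTo_const L.n 3 (fun j s' => ∀ u, s'.arr 3 u = if u < j then 1 else 0)
    hL₁.reg (by decide) rfl rfl (by omega) ?_ ?_) ?_
  · intro u
    simp only [Store.setReg_arr, hF₁.2 3 rfl, h3a]
    simp
  · intro j s₂ hj hji hI hF
    simp only [wp_put, Exp.Fits, Exp.eval, Exp.cost, hji, Store.setReg_arr, Store.setCell_arr,
      reduceIte]
    refine ⟨by omega, by omega, by omega, fun u => ?_⟩
    rw [Function.update_apply, hI u]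
    split_ifs <;> omega
  rintro T₂ s₂ ⟨hT₂, hI⟩ hF₂
  have e2 : s₂.reg 2 = v := by rw [hF₂.1 _ rfl, hF₁.1 _ rfl, h2]
  rw [wp_seq, wp_put]
  simp only [Exp.Fits, Exp.eval, Exp.cost, e2]
  refine ⟨by omega, by omega, ?_⟩
  set pr : ℕ → ℕ := Function.update (s₂.arr 3) v 0 with hpr
  have hpr' : ∀ u < L.n, pr u ≠ 0 → u ≠ v := by
    rintro u hu h rfl
    exact h (Function.update_self _ _ _)
  refine wp_seq_of (wp_inductProg (pr := pr) (sd := sd) hW (min_le_right _ _) hv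
    ((hL₁.frame hF₂ rfl rfl rfl).congr rfl rfl rfl) ?_ ?_ ?_ ?_ hs ?_ e2 ?_ ?_ ?_ ?_ ?_) ?_
  · have : (s₂.setCell 3 v 0).arr 4 = s₁.arr 4 := hF₂.2 4 rfl
    rw [HasAdj, this]; exact hA
  · simp [Store.setCell_arr, hpr]
  · rw [← h2a, ← hF₁.2 2 rfl, ← hF₂.2 2 rfl]; rfl
  · intro u hu
    rw [hpr, Function.update_apply, hI u]
    split_ifs <;> omega
  · have : (s₂.setCell 3 v 0).arr 11 = s.arr 11 := (hF₂.2 11 rfl).trans (hF₁.2 11 rfl)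
    rw [this]; exact fun i _ => h11a i
  · exact (hF₂.1 3 rfl).trans h3
  · exact (hF₂.1 4 rfl).trans h4
  · exact (hF₂.1 5 rfl).trans h5
  · exact Function.update_self _ _ _
  · exact hg.congr (fun u hu h => by rw [if_neg (hpr' u hu h)]; decide) fun _ _ _ => rfl
  rintro T₃ s₃ ⟨hT₃, h6, -, hle, hok, hno⟩ -
  rw [wp_set]
  simp only [Exp.Fits, Exp.eval, Exp.cost, Store.setReg_reg, reduceIte, Store.setReg_arr]
  have hone : ∀ u < L.n, Function.update pr v 1 u ≠ 0 := by
    intro u hu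
    rw [Function.update_apply, hpr, Function.update_apply, hI u]
    split_ifs <;> omega
  refine ⟨by omega, ?_, h6, fun h => ⟨?_, hle⟩, fun h => ?_⟩
  · have : ∀ a b : ℕ, a * (2 * b) = 2 * (a * b) := fun a b => by ring
    rw [this] at hT₃ ⊢
    omega
  · exact (hok h).2.congr (fun u hu _ => hone u hu) fun _ _ _ => rfl
  · rintro ⟨σ, hσ, hσg⟩
    exact hno h ⟨σ, hσ, hσg.congr (fun _ _ _ => one_ne_zero) fun _ _ _ => rfl⟩

/-- Decide whether there is a 2-subcoloring. -/
def decideProg : Prog :=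
  .seq setupProg (.seq (.set 6 (.const 1)) (.seq
    (forTo 2 0 (.cond (.lt (.cell 0 (.reg 2)) (.cell 0 (.add (.reg 2) (.const 1))))
      (.cond (.reg 6) inductProg .skip) .skip)) (.set 0 (.reg 6))))

/-- Only vertices with a nonempty list are inserted, so the expensive step is charged `L.support`
times. After a failure the remaining insertions are skipped. -/
theorem wp_decideProg {s : Store} {k : ℕ} (hW : Wide L (min k L.n) W) (hk : k ≤ W)
    (hL : L.Holds s) (h1 : s.reg 1 = k) (h2a : ∀ i, s.arr 2 i = 0)
    (h3a : ∀ i, s.arr 3 i = 0) (h4a : ∀ i, s.arr 4 i = 0) (h11a : ∀ i, s.arr 11 i = 0) :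
    wp W decideProg s fun T s' =>
      T ≤ L.support * (2000 * ((min k L.n + 3) ^ (2 * min k L.n + 1) *
        (2 * (L.n + L.off L.n + 1)))) + 200 * (L.n + L.off L.n + 1) ∧
      s'.reg 0 ≤ 1 ∧
      (s'.reg 0 = 1 ↔ ∃ σ : ℕ → ℕ, (∀ u < L.n, σ u ≤ 1) ∧ L.Good (fun _ => 1) σ (min k L.n)) := by
  have hl := hW.lin
  set K := min k L.n with hKdef
  set X := 2000 * ((K + 3) ^ (2 * K + 1) * (2 * (L.n + L.off L.n + 1))) with hX
  unfold decideProg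
  refine wp_seq_of (wp_setupProg hW hk hL h1 h4a) ?_
  rintro T₁ s₁ ⟨hT₁, hA, h3, h4, h5⟩ hF₁
  have hL₁ : L.Holds s₁ := hL.frame hF₁ rfl rfl rfl
  rw [wp_seq, wp_set]
  refine ⟨by simp only [Exp.Fits]; omega, ?_⟩
  simp only [Exp.eval, Exp.cost]
  set s₂ := s₁.setReg 6 1 with hs₂
  have hL₂ : L.Holds s₂ := ⟨by rw [hs₂, Store.setReg_reg]; exact hL₁.reg, hL₁.off, hL₁.nb⟩
  refine wp_seq_of (wp_forTo L.n (fun j => (if L.nb j ≠ [] then X else 0) + 20) (fun j s' =>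
    s'.reg 6 ≤ 1 ∧ (∀ i, 2 * K + 1 < i → s'.arr 11 i = 0) ∧ (∀ u < L.n, s'.arr 2 u ≤ 1) ∧
    (s'.reg 6 = 1 → (s'.arr 3 = fun u => if u < j ∧ L.nb u ≠ [] then 1 else 0) ∧
      L.Good (s'.arr 3) (s'.arr 2) K) ∧
    (s'.reg 6 = 0 → ¬ ∃ σ : ℕ → ℕ, (∀ u < L.n, σ u ≤ 1) ∧ L.Good (fun _ => 1) σ K))
    hL₂.reg (by decide) rfl rfl (by omega) ?_ ?_) ?_
  · have e6 : (s₂.setReg 2 0).reg 6 = 1 := by simp [hs₂, Store.setReg_reg]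
    have e3 : (s₂.setReg 2 0).arr 3 = fun _ => 0 := by
      funext u
      show s₁.arr 3 u = 0
      rw [hF₁.2 _ rfl, h3a]
    refine ⟨e6.le, ?_, ?_, fun _ => ⟨?_, ?_⟩, fun h => by omega⟩
    · intro i _
      show s₁.arr 11 i = 0
      rw [hF₁.2 _ rfl, h11a]
    · intro u _
      show s₁.arr 2 u ≤ 1
      rw [hF₁.2 _ rfl, h2a]
      omega
    · rw [e3]; simp
    · rw [e3]
      exact ⟨fun _ => 0, by simp, by simp⟩
  · rintro j s₃ hj hji ⟨h6, hz, hle, hok, hno⟩ hF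
    have hL₃ := hL₂.frame hF rfl rfl rfl
    have o1 := L.off_le hj.le
    have o2 := L.off_le (u := j + 1) (by omega)
    have os := L.off_succ j
    rw [wp_cond]
    simp only [Exp.Fits, Exp.eval, Exp.cost, hji, hL₃.off j hj.le, hL₃.off (j + 1) hj]
    refine ⟨by omega, fun h => ?_, fun h => ?_⟩
    · have hne : L.nb j ≠ [] := by
        intro h'
        rw [os, h'] at h
        simp at h
      simp only [if_pos hne]
      rw [wp_cond]
      simp only [Exp.Fits, Exp.eval, Exp.cost]
      refine ⟨by omega, fun h => ?_, fun h => ?_⟩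
      · obtain ⟨hp3, hg⟩ := hok (by omega)
        have hpj : s₃.arr 3 j = 0 := by rw [hp3]; simp
        refine (wp_inductProg hW (min_le_right _ _) hj hL₃ ?_ rfl rfl ?_ hle hz hji ?_ ?_ ?_ hpj
          hg).mono ?_
        · have : s₃.arr 4 = s₁.arr 4 := hF.2 4 rfl
          rw [HasAdj, this]; exact hA
        · intro u _
          rw [hp3]
          dsimp only
          split_ifs <;> omega
        · rw [hF.1 _ rfl, hs₂, Store.setReg_reg]; exact h3
        · rw [hF.1 _ rfl, hs₂, Store.setReg_reg]; exact h4
        · rw [hF.1 _ rfl, hs₂, Store.setReg_reg]; exact h5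
        · rintro T₄ s₄ ⟨hT₄, k6, kz, kle, kok, kno⟩
          simp only [Store.setReg_reg, Store.setReg_arr, Nat.reduceEqDiff, reduceIte]
          refine ⟨by omega, k6, kz, kle, fun h => ?_, fun h => ?_⟩
          · obtain ⟨k1, k2⟩ := kok h
            refine ⟨?_, by rw [k1]; exact k2⟩
            rw [k1, hp3]
            funext u
            rw [Function.update_apply]
            by_cases hu : u = j
            · simp [hu, hne]
            · have : u < j + 1 ↔ u < j := by omega
              simp [hu, this]
          -- A 2-subcoloring of all vertices would restrict to those present after the failed
          -- insertion.
          · rintro ⟨σ, hσ, hσg⟩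
            exact kno h ⟨σ, hσ, hσg.congr (fun _ _ _ => one_ne_zero) fun _ _ _ => rfl⟩
      · rw [wp_skip]
        simp only [Store.setReg_reg, Store.setReg_arr, Nat.reduceEqDiff, reduceIte]
        exact ⟨by omega, h6, hz, hle, fun h => by omega, hno⟩
    · have hnil : L.nb j = [] := by
        rw [← List.length_eq_zero_iff]
        by_contra h'
        rw [if_pos (by omega)] at h
        omega
      rw [wp_skip]
      simp only [Store.setReg_reg, Store.setReg_arr, Nat.reduceEqDiff, reduceIte]
      refine ⟨by omega, h6, hz, hle, fun h => ⟨?_, (hok h).2⟩, hno⟩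
      rw [(hok h).1]
      funext u
      have : u < j + 1 ∧ L.nb u ≠ [] ↔ u < j ∧ L.nb u ≠ [] := by
        constructor
        · rintro ⟨h1, h2⟩
          refine ⟨?_, h2⟩
          have : u ≠ j := by rintro rfl; exact h2 hnil
          omega
        · rintro ⟨h1, h2⟩
          exact ⟨by omega, h2⟩
      simp only [this]
  · rintro T₃ s₃ ⟨hT₃, h6, -, hle, hok, hno⟩ -
    have hsum : ∑ j ∈ Finset.range L.n, ((if L.nb j ≠ [] then X else 0) + 20 + 8) =
        L.support * X + L.n * 28 := by
      simp only [add_assoc, Finset.sum_add_distrib, ListGraph.support, Finset.card_filter,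
        Finset.sum_mul, ite_mul, one_mul, zero_mul, Finset.sum_const, Finset.card_range, smul_eq_mul]
      omega
    rw [hsum] at hT₃
    rw [wp_set]
    simp only [Exp.Fits, Exp.eval, Exp.cost, Store.setReg_reg, reduceIte]
    refine ⟨by omega, by omega, h6, fun h => ?_, fun h => ?_⟩
    · obtain ⟨hp3, hg⟩ := hok h
      refine ⟨_, fun u hu => ?_, hg.add_isolated fun u hu hne => ?_⟩
      · have := hle u hu
        split_ifs <;> omega
      · rw [hp3]
        simp [hu, hne]
    · by_contra h'
      exact hno (by omega) h

end Ram

/-! ### Cluster graphs and cluster numbers -/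

section Clusters

variable {V : Type*} {G : SimpleGraph V} {A : Set V}

theorem isClusterGraph_of_numbering {f : V → ℕ}
    (hf : ∀ u ∈ A, ∀ w ∈ A, f u = f w ↔ u = w ∨ G.Adj u w) : IsClusterGraph (G.induce A) := by
  intro u w huw hne
  have h : f u = f w := by
    obtain ⟨p⟩ := huw
    clear hne
    induction p with
    | nil => rfl
    | cons h _ ih => exact ((hf _ (Subtype.prop _) _ (Subtype.prop _)).2 (Or.inr h)).trans ih
  exact ((hf u u.2 w w.2).1 h).resolve_left fun h => hne (Subtype.ext h)

theorem card_clusters_le_of_numbering {f : V → ℕ} {k : ℕ}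
    (hf : ∀ u ∈ A, ∀ w ∈ A, f u = f w ↔ u = w ∨ G.Adj u w) (hk : ∀ u ∈ A, f u < k) :
    Nat.card (G.induce A).ConnectedComponent ≤ k := by
  choose r hr using fun c : (G.induce A).ConnectedComponent => c.exists_rep
  have := Nat.card_le_card_of_injective
    (fun c => (⟨f (r c), hk _ (r c).2⟩ : Fin k)) (fun c d h => by
      have h' : f (r c) = f (r d) := by simpa using h
      rw [← hr c, ← hr d]
      rcases (hf _ (r c).2 _ (r d).2).1 h' with h | h
      · rw [Subtype.ext h]
      · exact SimpleGraph.ConnectedComponent.sound (SimpleGraph.Adj.reachable h))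
  simpa using this

theorem IsClusterGraph.exists_numbering [Finite V] (h : IsClusterGraph (G.induce A)) :
    ∃ f : V → ℕ, (∀ u ∈ A, ∀ w ∈ A, f u = f w ↔ u = w ∨ G.Adj u w) ∧
      ∀ u ∈ A, f u < Nat.card (G.induce A).ConnectedComponent := by
  classical
  have : Finite (G.induce A).ConnectedComponent :=
    Finite.of_surjective _ (Quot.mk_surjective)
  let e := Finite.equivFin (G.induce A).ConnectedComponent
  refine ⟨fun u => if hu : u ∈ A then e ((G.induce A).connectedComponentMk ⟨u, hu⟩) else 0,
    fun u hu w hw => ?_, fun u hu => ?_⟩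
  · dsimp only
    rw [dif_pos hu, dif_pos hw, Fin.val_inj, e.apply_eq_iff_eq, SimpleGraph.ConnectedComponent.eq]
    constructor
    · intro hr
      by_cases huw : u = w
      · exact Or.inl huw
      · exact Or.inr (h _ _ hr fun h => huw (congrArg Subtype.val h))
    · rintro (rfl | hadj)
      · exact SimpleGraph.Reachable.refl _
      · exact SimpleGraph.Adj.reachable (G := G.induce A) (u := ⟨u, hu⟩) (v := ⟨w, hw⟩) hadj
  · dsimp only
    rw [dif_pos hu]
    exact Fin.is_lt _

theorem natCard_clusters_le [Finite V] :
    Nat.card (G.induce A).ConnectedComponent ≤ Nat.card V :=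
  (Nat.card_le_card_of_surjective _ Quot.mk_surjective).trans
    (Nat.card_le_card_of_injective _ Subtype.val_injective)

end Clusters

/-! ### The encoding of the input -/

theorem List.getElem?_flatten_add {α : Type*} (ll : List (List α)) (u i : ℕ) (hu : u < ll.length)
    (hi : i < ll[u].length) :
    ll.flatten[(ll.take u).flatten.length + i]? = some ll[u][i] := by
  have e : ll.flatten = (ll.take u).flatten ++ (ll[u] ++ (ll.drop (u + 1)).flatten) := by
    rw [← List.flatten_cons, ← List.drop_eq_getElem_cons hu, ← List.flatten_append,
      List.take_append_drop]
  rw [e, List.getElem?_append_right (Nat.le_add_right _ _), Nat.add_sub_cancel_left,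
    List.getElem?_append_left hi, List.getElem?_eq_getElem hi]

section Encoding

variable {n : ℕ} {G : SimpleGraph (Fin n)} {nbrs : Fin n → List (Fin n)}

/-- The graph given by adjacency lists, with natural numbers as vertices. -/
def IsAdjacencyLists.listGraph (h : IsAdjacencyLists G nbrs) : ListGraph where
  n := n
  nb u := if hu : u < n then (nbrs ⟨u, hu⟩).map Fin.val else []
  lt {u w} hw := by
    split_ifs at hw with hu
    · obtain ⟨x, -, rfl⟩ := List.mem_map.1 hw
      exact x.2
    · simp at hw
  symm {u w} hw := by
    split_ifs at hw with hu
    · obtain ⟨x, hx, rfl⟩ := List.mem_map.1 hw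
      rw [dif_pos x.2]
      exact List.mem_map.2 ⟨⟨u, hu⟩, ((h x).2 _).2 (((h _).2 _).1 hx).symm, rfl⟩
    · simp at hw
  irrefl u hw := by
    split_ifs at hw with hu
    · obtain ⟨x, hx, hxu⟩ := List.mem_map.1 hw
      have := ((h _).2 _).1 hx
      exact this.ne (Fin.ext hxu.symm)
    · simp at hw
  nodup u := by
    split_ifs with hu
    · exact (h _).1.map Fin.val_injective
    · simp

variable (h : IsAdjacencyLists G nbrs)

theorem IsAdjacencyLists.mem_nb {u w : Fin n} : (w : ℕ) ∈ h.listGraph.nb u ↔ G.Adj u w := by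
  rw [← (h u).2 w]
  simp [listGraph, Fin.val_inj]

theorem IsAdjacencyLists.length_take {i : ℕ} (hi : i ≤ n) :
    ((List.ofFn nbrs).take i).flatten.length = h.listGraph.off i := by
  induction i with
  | zero => simp [ListGraph.off]
  | succ i ih =>
    rw [ListGraph.off_succ, ← ih (by omega), List.take_succ_eq_append_getElem (by simpa using hi)]
    simp [listGraph, show i < n from hi]

theorem IsAdjacencyLists.off_n : h.listGraph.off n = 2 * G.edgeSet.ncard := by
  classical
  rw [Set.ncard_eq_toFinset_card', ← SimpleGraph.edgeFinset, ← G.sum_degrees_eq_twice_card_edges,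
    ListGraph.off, Finset.sum_range]
  refine Finset.sum_congr rfl fun u _ => ?_
  have : G.neighborFinset u = (nbrs u).toFinset := by
    ext w
    simp [(h u).2 w]
  rw [← G.card_neighborFinset_eq_degree, this, List.toFinset_card_of_nodup (h u).1]
  simp [listGraph]

theorem IsAdjacencyLists.holds {s : Ram.Store} {k : ℕ} (h0 : s.reg 0 = n)
    (a0 : s.arr 0 = (graphInput nbrs k).arr 0) (a1 : s.arr 1 = (graphInput nbrs k).arr 1) :
    h.listGraph.Holds s := by
  refine ⟨h0, fun u hu => ?_, fun u hu i hi => ?_⟩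
  · have hu : u ≤ n := hu
    rw [a0, ← h.length_take hu]
    simp [graphInput, hu]
  · have hu : u < n := hu
    rw [a1, ← h.length_take hu.le]
    have hi' : i < (nbrs ⟨u, hu⟩).length := by simpa [listGraph, hu] using hi
    have := List.getElem?_flatten_add (List.ofFn nbrs) u i (by simpa using hu) (by simpa using hi')
    simp only [graphInput, one_ne_zero, if_false, if_true, List.getD_eq_getElem?_getD,
      List.getElem?_map, this]
    simp [listGraph, hu]

end Encoding

section Subcoloring

variable {n k : ℕ} {G : SimpleGraph (Fin n)} {nbrs : Fin n → List (Fin n)}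
  {S A B : Set (Fin n)}

/-- The cut-off at `n` costs nothing: choosing a vertex in each cluster shows that there are at most
`n` clusters. -/
theorem IsValidSubcoloring.good (hAB : IsValidSubcoloring G S k A B)
    (h : IsAdjacencyLists G nbrs) {pr sd : ℕ → ℕ} (hp : ∀ u : Fin n, pr u ≠ 0 → u ∈ S)
    (hs : ∀ u : Fin n, pr u ≠ 0 → (sd u = 1 ↔ u ∈ A)) :
    h.listGraph.Good pr sd (min k n) := by
  classical
  obtain ⟨f, hf, hf'⟩ := hAB.cluster_left.exists_numbering
  obtain ⟨g, hg, -⟩ := hAB.cluster_right.exists_numbering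
  have hcard := natCard_clusters_le (G := G) (A := A)
  rw [Nat.card_fin] at hcard
  have hB : ∀ u : Fin n, pr u ≠ 0 → u ∉ A → u ∈ B := by
    intro u hu hA
    have := hp u hu
    rw [← hAB.union_eq] at this
    exact this.resolve_left hA
  refine ⟨fun u => if hu : u < n then (if (⟨u, hu⟩ : Fin n) ∈ A then f ⟨u, hu⟩ else g ⟨u, hu⟩) else 0,
    fun u hu w hw pu pw hsd => ?_, fun u hu pu hsd => ?_⟩
  · have hu : u < n := hu
    have hw : w < n := hw
    have hadj := h.mem_nb (u := ⟨u, hu⟩) (w := ⟨w, hw⟩)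
    dsimp only at hadj ⊢
    rw [dif_pos hu, dif_pos hw, hadj]
    have eu := hs ⟨u, hu⟩ pu
    have ew := hs ⟨w, hw⟩ pw
    dsimp only at eu ew
    have e : (u = w) ↔ (⟨u, hu⟩ : Fin n) = ⟨w, hw⟩ := by simp
    rw [e]
    by_cases hA : (⟨u, hu⟩ : Fin n) ∈ A
    · have hA' : (⟨w, hw⟩ : Fin n) ∈ A := by rw [← ew, ← hsd]; exact eu.2 hA
      rw [if_pos hA, if_pos hA']
      exact hf _ hA _ hA'
    · have hA' : (⟨w, hw⟩ : Fin n) ∉ A := by rw [← ew, ← hsd]; exact fun h => hA (eu.1 h)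
      rw [if_neg hA, if_neg hA']
      exact hg _ (hB _ pu hA) _ (hB _ pw hA')
  · have hu : u < n := hu
    have hA := (hs ⟨u, hu⟩ pu).1 hsd
    dsimp only
    rw [dif_pos hu, if_pos hA]
    have := hf' _ hA
    have := hAB.card_clusters_le
    omega

theorem ListGraph.Good.isValidSubcoloring {h : IsAdjacencyLists G nbrs} {σ : ℕ → ℕ}
    (hg : h.listGraph.Good (fun _ => 1) σ (min k n)) (hσ : ∀ u < n, σ u ≤ 1) :
    IsValidSubcoloring G Set.univ k {u : Fin n | σ u = 1} {u : Fin n | σ u ≠ 1} := by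
  obtain ⟨f, hf, hf'⟩ := hg
  have key : ∀ u w : Fin n, σ u = σ w → (f u = f w ↔ u = w ∨ G.Adj u w) := by
    intro u w hsd
    rw [hf u u.2 w w.2 one_ne_zero one_ne_zero hsd, h.mem_nb, Fin.val_inj]
  have hA : ∀ u ∈ {u : Fin n | σ u = 1}, ∀ w ∈ {u : Fin n | σ u = 1},
      f u = f w ↔ u = w ∨ G.Adj u w := by
    intro u hu w hw
    rw [Set.mem_ofPred_eq] at hu hw
    exact key u w (by rw [hu, hw])
  refine ⟨?_, ?_, isClusterGraph_of_numbering (f := fun u : Fin n => f u) hA,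
    isClusterGraph_of_numbering (f := fun u : Fin n => f u) ?_,
    card_clusters_le_of_numbering (f := fun u : Fin n => f u) hA ?_⟩
  · ext u
    simp [em]
  · rw [Set.disjoint_left]
    exact fun u h1 h2 => h2 h1
  · intro u hu w hw
    rw [Set.mem_ofPred_eq] at hu hw
    have := hσ u u.2
    have := hσ w w.2
    exact key u w (by omega)
  · intro u hu
    have := hf' u u.2 one_ne_zero hu
    omega

theorem exists_isValidSubcoloring_iff (h : IsAdjacencyLists G nbrs) :
    (∃ A B, IsValidSubcoloring G Set.univ k A B) ↔
      ∃ σ : ℕ → ℕ, (∀ u < n, σ u ≤ 1) ∧ h.listGraph.Good (fun _ => 1) σ (min k n) := by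
  classical
  constructor
  · rintro ⟨A, B, hAB⟩
    have hle : ∀ u < n, (if ∃ hu : u < n, (⟨u, hu⟩ : Fin n) ∈ A then 1 else 0) ≤ 1 := by
      intro u _
      split_ifs <;> omega
    refine ⟨fun u => if ∃ hu : u < n, (⟨u, hu⟩ : Fin n) ∈ A then 1 else 0, hle,
      hAB.good h (fun _ _ => trivial) fun u _ => ?_⟩
    simp
  · rintro ⟨σ, hσ, hg⟩
    exact ⟨_, _, hg.isValidSubcoloring hσ⟩

end Subcoloring

/-! ### Bounds on running time and word size -/

/-- For positive `K`, `(1 + 3 / K) ^ K ≤ exp 3`, and `exp 1 < 3`. -/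
theorem add_three_pow_le (K : ℕ) : (K + 3) ^ K ≤ 27 * K ^ K := by
  rcases Nat.eq_zero_or_pos K with rfl | hK
  · simp
  have hK' : (0 : ℝ) < K := by exact_mod_cast hK
  have h1 : (1 + 3 / (K : ℝ)) ^ K ≤ 27 := by
    calc (1 + 3 / (K : ℝ)) ^ K ≤ Real.exp (3 / K) ^ K := by
          gcongr
          rw [add_comm]
          exact Real.add_one_le_exp _
      _ = Real.exp 1 ^ 3 := by
          rw [← Real.exp_nat_mul, ← Real.exp_nat_mul]
          congr 1
          push_cast
          field_simp
      _ ≤ 3 ^ 3 := by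
          gcongr
          exact (Real.exp_one_lt_d9.trans (by norm_num)).le
      _ = 27 := by norm_num
  have h2 : ((K : ℝ) + 3) ^ K ≤ 27 * (K : ℝ) ^ K := by
    have e : (K : ℝ) + 3 = (1 + 3 / K) * K := by field_simp
    rw [e, mul_pow]
    gcongr
  exact_mod_cast h2

/-- For `K ≥ 1` the constant is `27 ^ 2 * 4`: the squared bound for `(K + 3) ^ K` and `K + 3 ≤ 4 *
K`. For `K = 0` the left side is 3. -/
theorem min_add_three_pow_le (k n : ℕ) :
    (min k n + 3) ^ (2 * min k n + 1) ≤ 2916 * max k 1 ^ (2 * k + 1) := by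
  set K := min k n with hK
  rcases Nat.eq_zero_or_pos K with h | h
  · rw [h]
    have : 0 < max k 1 ^ (2 * k + 1) := by positivity
    omega
  · have hk : max k 1 = k := by omega
    rw [hk]
    calc (K + 3) ^ (2 * K + 1) = ((K + 3) ^ K) ^ 2 * (K + 3) := by ring
      _ ≤ (27 * K ^ K) ^ 2 * (4 * K) := by
          gcongr
          · exact add_three_pow_le K
          · omega
      _ = 2916 * K ^ (2 * K + 1) := by ring
      _ ≤ 2916 * k ^ (2 * K + 1) := by
          gcongr
          exact min_le_left _ _
      _ ≤ 2916 * k ^ (2 * k + 1) := by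
          gcongr
          · omega
          · exact min_le_left _ _

/-- Addresses in the adjacency matrix are quadratic in `n` and all other demands are linear; the
generous fifth power absorbs the factor 8 because the base is at least 2. -/
theorem IsAdjacencyLists.wide {n k : ℕ} {G : SimpleGraph (Fin n)} {nbrs : Fin n → List (Fin n)}
    (h : IsAdjacencyLists G nbrs) :
    Ram.Wide h.listGraph (min k n) ((n + G.edgeSet.ncard + k + 2) ^ 5) := by
  have hoff : h.listGraph.off h.listGraph.n = 2 * G.edgeSet.ncard := h.off_n
  have hn : h.listGraph.n = n := rfl
  set m := G.edgeSet.ncard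
  set x := n + m + k + 2 with hx
  have h2 : 2 ≤ x := by omega
  refine ⟨?_, ?_⟩
  · rw [hoff, hn]
    calc 8 * (n + 2 * m + min k n + 4) ≤ 2 ^ 4 * x := by omega
      _ ≤ x ^ 4 * x := by gcongr
      _ = x ^ 5 := by ring
  · rw [hn]
    calc n * n + n = n * (n + 1) := by ring
      _ ≤ x * x := by gcongr <;> omega
      _ = x ^ 2 := by ring
      _ ≤ x ^ 5 := Nat.pow_le_pow_right (by omega) (by omega)

/-- With `s ≤ n` and `s ≤ 2 * m`, the product `s * (n + 2 * m + 1)` is `O(n * m)`: the summand `n`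
is paired with `s ≤ 2 * m`, the summand `2 * m` with `s ≤ n`. -/
theorem time_decide_le {s k n m X : ℕ} (hs : s ≤ n) (hs' : s ≤ 2 * m)
    (hX : X ≤ 2916 * max k 1 ^ (2 * k + 1)) :
    s * (2000 * (X * (2 * (n + 2 * m + 1)))) + 200 * (n + 2 * m + 1) ≤
      60000000 * (max k 1 ^ (2 * k + 1) * (max n 1 * max m 1)) := by
  set P := max k 1 ^ (2 * k + 1) with hP
  have hP1 : 1 ≤ P := Nat.one_le_iff_ne_zero.2 (by positivity)
  set N := max n 1
  set M := max m 1
  have hn : n ≤ N := le_max_left _ _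
  have hm : m ≤ M := le_max_left _ _
  have hN : 1 ≤ N := le_max_right _ _
  have hM : 1 ≤ M := le_max_right _ _
  have a1 : n ≤ N * M := by nlinarith
  have a2 : m ≤ N * M := by nlinarith
  have a3 : 1 ≤ N * M := by nlinarith
  have b1 : s * (n + 2 * m + 1) ≤ 5 * (N * M) := by
    have c1 : s * n ≤ 2 * M * N := Nat.mul_le_mul (by omega) hn
    have c2 : s * (2 * m) ≤ N * (2 * M) := Nat.mul_le_mul (by omega) (by omega)
    nlinarith
  calc s * (2000 * (X * (2 * (n + 2 * m + 1)))) + 200 * (n + 2 * m + 1)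
      = 4000 * (X * (s * (n + 2 * m + 1))) + 200 * (n + 2 * m + 1) := by ring
    _ ≤ 4000 * (2916 * P * (5 * (N * M))) + 200 * (4 * (N * M)) := by
        gcongr
        omega
    _ = 58320000 * (P * (N * M)) + 800 * (1 * (N * M)) := by ring
    _ ≤ 58320000 * (P * (N * M)) + 800 * (P * (N * M)) := by gcongr
    _ ≤ 60000000 * (P * (N * M)) := by omega

theorem time_extend_le {k n m X : ℕ} (hn : 0 < n) (hX : X ≤ 2916 * max k 1 ^ (2 * k + 1)) :
    3000 * (X * (2 * (n + 2 * m + 1))) ≤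
      60000000 * (max k 1 ^ (2 * k + 1) * (n + m)) := by
  calc 3000 * (X * (2 * (n + 2 * m + 1)))
      ≤ 3000 * (2916 * max k 1 ^ (2 * k + 1) * (2 * (2 * (n + m)))) := by
        gcongr
        omega
    _ = 34992000 * (max k 1 ^ (2 * k + 1) * (n + m)) := by ring
    _ ≤ _ := by gcongr; omega

/-! ### Assembly of both parts -/

theorem theorem3 :
    (∃ (P : Ram.Prog) (C c : ℕ),
      ∀ (n k : ℕ) (G : SimpleGraph (Fin n)) (nbrs : Fin n → List (Fin n)),
        IsAdjacencyLists G nbrs →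
        ∃ (t : ℕ) (s : Ram.Store),
          Ram.Run ((n + G.edgeSet.ncard + k + 2) ^ c) P (graphInput nbrs k) t s ∧
          t ≤ C * (max k 1 ^ (2 * k + 1) * (max n 1 * max G.edgeSet.ncard 1)) ∧
          ((∃ A B : Set (Fin n), IsValidSubcoloring G Set.univ k A B) → s.reg 0 = 1) ∧
          ((¬ ∃ A B : Set (Fin n), IsValidSubcoloring G Set.univ k A B) → s.reg 0 = 0)) ∧
    (∃ (P : Ram.Prog) (C c : ℕ),
      ∀ (n k : ℕ) (G : SimpleGraph (Fin n)) (nbrs : Fin n → List (Fin n))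
        (v : Fin n) (A' B' : Set (Fin n)),
        IsAdjacencyLists G nbrs →
        IsValidSubcoloring G {v}ᶜ k A' B' →
        ∃ (t : ℕ) (s : Ram.Store),
          Ram.Run ((n + G.edgeSet.ncard + k + 2) ^ c) P (inductiveInput nbrs k v A') t s ∧
          t ≤ C * (max k 1 ^ (2 * k + 1) * (n + G.edgeSet.ncard)) ∧
          ((∃ A B : Set (Fin n), IsValidSubcoloring G Set.univ k A B) →
            s.reg 0 = 1 ∧
            IsValidSubcoloring G Set.univ k
              {u : Fin n | s.arr 2 u = 1} {u : Fin n | s.arr 2 u ≠ 1}) ∧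
          ((¬ ∃ A B : Set (Fin n), IsValidSubcoloring G Set.univ k A B) → s.reg 0 = 0)) := by
  have hword : ∀ n m k : ℕ, k ≤ (n + m + k + 2) ^ 5 := fun n m k =>
    (show k ≤ n + m + k + 2 by omega).trans (Nat.le_self_pow (by decide) _)
  refine ⟨⟨Ram.decideProg, 60000000, 5, fun n k G nbrs h => ?_⟩,
    ⟨Ram.extendProg, 60000000, 5, fun n k G nbrs v A' B' h hAB => ?_⟩⟩
  · have hoff : h.listGraph.off h.listGraph.n = 2 * G.edgeSet.ncard := h.off_n
    have hn : h.listGraph.n = n := rfl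
    obtain ⟨t, s, hr, ht, h0, hiff⟩ := Ram.wp_decideProg (s := graphInput nbrs k) (k := k)
      h.wide (hword _ _ _) (h.holds (k := k) rfl rfl rfl) rfl (fun _ => rfl) (fun _ => rfl)
      (fun _ => rfl) (fun _ => rfl)
    rw [hoff, hn] at ht
    rw [hn, ← exists_isValidSubcoloring_iff h] at hiff
    have := h.listGraph.support_le_off
    rw [hoff] at this
    refine ⟨t, s, hr, ht.trans (time_decide_le ListGraph.support_le_n this
      (min_add_three_pow_le k n)), hiff.2, fun hno => ?_⟩
    have := hiff.not.2 hno
    omega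
  · have hoff : h.listGraph.off h.listGraph.n = 2 * G.edgeSet.ncard := h.off_n
    have hn : h.listGraph.n = n := rfl
    have hle : ∀ u < n, (inductiveInput nbrs k v A').arr 2 u ≤ 1 := by
      intro u _
      simp only [inductiveInput, if_true]
      split_ifs <;> omega
    have hg : h.listGraph.Good (fun u => if u = (v : ℕ) then 0 else 1)
        ((inductiveInput nbrs k v A').arr 2) (min k n) := by
      refine hAB.good h (fun u hu => ?_) fun u hu => ?_
      · rintro rfl
        simp at hu
      · simp [inductiveInput, Fin.val_inj]
    obtain ⟨t, s, hr, ht, h0, hok, hno⟩ := Ram.wp_extendProg (s := inductiveInput nbrs k v A')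
      (k := k) (v := v) h.wide (hword _ _ _) (h.holds (k := k) rfl rfl rfl) rfl rfl v.2
      (fun _ => rfl) (fun _ => rfl) (fun _ => rfl) rfl hle hg
    rw [hoff, hn] at ht
    rw [hn, ← exists_isValidSubcoloring_iff h] at hno
    refine ⟨t, s, hr, ht.trans (time_extend_le (Fin.pos v) (min_add_three_pow_le k n)),
      fun hex => ?_, fun hno' => ?_⟩
    · have h1 : s.reg 0 = 1 := by
        by_contra h1
        exact hno (by omega) hex
      exact ⟨h1, (hok h1).1.isValidSubcoloring (hok h1).2⟩
    · by_contra h1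
      have := hok (by omega)
      exact hno' ⟨_, _, this.1.isValidSubcoloring this.2⟩
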